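/- Let $\mathfrak g$ be a simple finite-dimensional complex Lie algebra with Chevalley generators $e_i,f_i,h_i$ ($i=1,\dots,r$) and Cartan matrix $A_{ij}$, $[h_i,e_j]=A_{ij}e_j$. Let $D\ge 3$ be an integer, and extend $A_{ij}$ to a matrix $A_{IJ}$ ($I,J=0,1,\dots,r$) with $A_{00}=0$ and with non-positive integers $A_{0i}=A_{i0}$ such that $\det A_{IJ}=-\frac{D-1}{D-2}\det A_{ij}$. Let $\mathcal B$ be the Borcherds–Kac–Moody superalgebra with Cartan matrix $A_{IJ}$ (with $e_0,f_0$ odd), graded so that $e_0\in\mathcal B_1$, $f_0\in\mathcal B_{-1}$. Then $\mathcal B_1=\mathbf r_1$ is the irreducible $\mathfrak g$-module with lowest weight vector $e_0$, $h_ie_0=A_{i0}e_0$, and $\mathcal B_+$ is the free Lie superalgebra on the odd space $\mathcal B_1$ modulo the ideal generated, under the actions of $\mathfrak g$ and $\mathcal B_1$, by $\{e_0,e_0\}$. For a vector space $U_1$ let $\mathcal U(U_1)=\bigoplus_{p\le 1}U_p\oplus\bigoplus_{p\ge2}U_p$ be its universal graded Lie superalgebra: $U_{-k}=\mathrm{Hom}(U_1,U_{-k+1})$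 for $k\ge0$, $U_+$ is free on $U_1$, and the bracket of $x\in U_1$ with $\Phi\in U_{-k}$ is evaluation. For $V_{-1}\subseteq U_{-1}$ let $\mathcal V(U_1,V_{-1})$ be the subalgebra generated by $U_1$ and $V_{-1}$, and $\mathcal V'(U_1,V_{-1})$ its quotient by the maximal graded ideal concentrated in degrees $\ge 2$. Let $\mathcal T_{-1}\subseteq\mathcal U(\mathcal B_1)_{-1}=\mathrm{Hom}(\mathcal B_1,\mathrm{End}\,\mathcal B_1)$ be the sum of all subspaces $V_{-1}$ such that (i) $\{V_{-1},\mathcal B_1\}$ is the image of $\mathfrak g$ in $\mathrm{End}\,\mathcal B_1$; (ii) $\mathcal V'(\mathcal B_1,V_{-1})_2\subseteq\mathcal B_2$, i.e. every element of the degree-2 part of the free Lie superalgebra on $\mathcal B_1$ that vanishes in $\mathcal B_2$ vanishes in $\mathcal V'(\mathcal B_1,V_{-1})_2$; (iii) $V_{-1}$ contains an element $\Theta$ with $\{\Theta,\Theta\}=0$ such that $\{\Theta,\mathcal B_1\}$ is a non-abelian subalgebra of $\mathfrak g$. Write $\mathbf r_{-1}=\mathbf t_{-1}$ for the representation of $\mathfrak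 g$ on $\mathcal T_{-1}$. Identify $\overline{\mathbf r}_1\times\mathbf{adj}$ (where $\overline{\mathbf r}_1$ is the dual of $\mathbf r_1$) with the subspace $\mathrm{Hom}(\mathcal B_1,\mathfrak g)\subseteq\mathcal U(\mathcal B_1)_{-1}$. In it let $\mathbf r_{\rm S}$ be the copy of $\overline{\mathbf r}_1$ embedded by the intertwiner $w\mapsto\sum_\alpha t_\alpha w\otimes t^\alpha$, where $t_\alpha$, $t^\alpha$ are bases of $\mathfrak g$ dual with respect to the Killing form; let $\mathbf r_{\rm L}$ be the irreducible component whose highest weight is the sum of the highest weights of $\overline{\mathbf r}_1$ and $\mathbf{adj}$; and let $\mathbf r_{\rm M}$ be the orthogonal complement of $\mathbf r_{\rm S}+\mathbf r_{\rm L}$, i.e. the annihilator, in the invariant pairing of $\overline{\mathbf r}_1\times\mathbf{adj}$ with $\mathbf r_1\times\mathbf{adj}$, of the corresponding components $\overline{\mathbf r}_{\rm S}+\overline{\mathbf r}_{\rm L}$ of $\mathbf r_1\times\mathbf{adj}$. Then $\mathbf r_{\rm S}\not\subseteq\mathbf r_{-1}$, $\mathbf r_{\rm L}\not\subseteq\mathbf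 r_{-1}$, and $\mathbf r_{-1}\subseteq\mathbf r_{\rm M}$. If $D=3$ and $\mathbf r_1\cong\mathbf{adj}$, then moreover, identifying $\overline{\mathbf r}_1\times\mathbf{adj}$ with $\mathbf{adj}\times\mathbf{adj}$, $\mathbf r_{-1}$ is contained in the symmetric part $(\mathbf{adj}\times\mathbf{adj})_+$. -/

import Mathlib

open scoped TensorProduct

namespace TensorHierarchy

noncomputable section

/-! ### The universal graded Lie superalgebra of a vector space `V`, acting on `T(V)`

Put `U₁ = V`, `U₀ = End V`, `U₋₁ = Hom(V, End V)`, ..., and let `U₊` be the free Lie superalgebra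
on the odd space `V`.  The universal graded Lie superalgebra `U(V)` is the sum of all these spaces,
with `⟦A, x⟧ = A x` for `A ∈ U₀`, `x ∈ U₁` and `⟦Φ, x⟧ = Φ x ∈ U₀` for `Φ ∈ U₋₁`, `x ∈ U₁`.
The `U(V)`-module induced from the trivial module of the non-positive part has the tensor algebra
`T(V)` as its underlying space.  On it `x ∈ U₁` acts by left multiplication, a non-positive element
kills the unit, and the action is determined by these facts and the supercommutators above.
This action is faithful (on `U₊` because the free Lie superalgebra embeds in `T(V)`, on
`U₋ₖ = Hom(V^{⊗(k+1)}, V)` because of its values on tensors of length `k + 1`), so we compute in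
`U(V)` by means of supercommutators of operators on `T(V)`. -/

section Universal

variable {V : Type*} [AddCommGroup V] [Module ℂ V]

/-- The action on `T(V)` of `x ∈ U₁ = V`: left multiplication by `x`. -/
def actOne : V →ₗ[ℂ] Module.End ℂ (TensorAlgebra ℂ V) :=
  LinearMap.mul ℂ (TensorAlgebra ℂ V) ∘ₗ TensorAlgebra.ι ℂ

/-- Auxiliary operator `(w, d) ↦ (x w, θ(x) w + s x d)` on pairs of tensors. -/
def extendStep (θ : V →ₗ[ℂ] Module.End ℂ (TensorAlgebra ℂ V)) (s : ℂ) :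
    V →ₗ[ℂ] Module.End ℂ (TensorAlgebra ℂ V × TensorAlgebra ℂ V) where
  toFun x := ((actOne x).comp (LinearMap.fst ℂ _ _)).prod
    ((θ x).comp (LinearMap.fst ℂ _ _) + s • (actOne x).comp (LinearMap.snd ℂ _ _))
  map_add' x y := by
    ext <;> simp
  map_smul' c x := by
    ext <;> simp [smul_comm c s]

theorem extendStep_apply_fst (θ : V →ₗ[ℂ] Module.End ℂ (TensorAlgebra ℂ V)) (s : ℂ) (x : V)
    (u : TensorAlgebra ℂ V × TensorAlgebra ℂ V) :
    (extendStep θ s x u).1 = TensorAlgebra.ι ℂ x * u.1 := rfl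

theorem extendStep_apply_snd (θ : V →ₗ[ℂ] Module.End ℂ (TensorAlgebra ℂ V)) (s : ℂ) (x : V)
    (u : TensorAlgebra ℂ V × TensorAlgebra ℂ V) :
    (extendStep θ s x u).2 = θ x u.1 + s • (TensorAlgebra.ι ℂ x * u.2) := rfl

/-- The unique operator `P` on `T(V)` with `P 1 = 0` and `P (x w) = θ(x) w + s x (P w)`
for `x ∈ V`. -/
def extendOp (θ : V →ₗ[ℂ] Module.End ℂ (TensorAlgebra ℂ V)) (s : ℂ) :
    Module.End ℂ (TensorAlgebra ℂ V) :=
  (LinearMap.snd ℂ _ _) ∘ₗ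
    (LinearMap.applyₗ ((1 : TensorAlgebra ℂ V), (0 : TensorAlgebra ℂ V))) ∘ₗ
      (TensorAlgebra.lift ℂ (extendStep θ s)).toLinearMap

theorem extendOp_one (θ : V →ₗ[ℂ] Module.End ℂ (TensorAlgebra ℂ V)) (s : ℂ) :
    extendOp θ s 1 = 0 := by
  simp [extendOp]

theorem tensor_left_induction (S : Submodule ℂ (TensorAlgebra ℂ V)) (h1 : 1 ∈ S)
    (hmul : ∀ (x : V) (w : TensorAlgebra ℂ V), w ∈ S → TensorAlgebra.ι ℂ x * w ∈ S)
    (w : TensorAlgebra ℂ V) : w ∈ S := by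
  have key : ∀ a : TensorAlgebra ℂ V, ∀ w ∈ S, a * w ∈ S := by
    intro a
    induction a using TensorAlgebra.induction with
    | algebraMap r =>
      intro w hw
      rw [← Algebra.smul_def]
      exact S.smul_mem r hw
    | ι x => exact fun w hw => hmul x w hw
    | mul a b ha hb =>
      intro w hw
      rw [mul_assoc]
      exact ha _ (hb _ hw)
    | add a b ha hb =>
      intro w hw
      rw [add_mul]
      exact S.add_mem (ha _ hw) (hb _ hw)
  simpa using key w 1 h1

theorem fst_lift_extendStep (θ : V →ₗ[ℂ] Module.End ℂ (TensorAlgebra ℂ V)) (s : ℂ)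
    (w : TensorAlgebra ℂ V) :
    (TensorAlgebra.lift ℂ (extendStep θ s) w (1, 0)).1 = w := by
  let L : TensorAlgebra ℂ V →ₗ[ℂ] TensorAlgebra ℂ V := (LinearMap.fst ℂ _ _) ∘ₗ
    (LinearMap.applyₗ ((1 : TensorAlgebra ℂ V), (0 : TensorAlgebra ℂ V))) ∘ₗ
      (TensorAlgebra.lift ℂ (extendStep θ s)).toLinearMap
  refine tensor_left_induction (LinearMap.eqLocus L LinearMap.id) ?_ ?_ w
  · simp [L]
  · intro x w hw
    have hw' : (TensorAlgebra.lift ℂ (extendStep θ s) w (1, 0)).1 = w := hw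
    change (TensorAlgebra.lift ℂ (extendStep θ s) (TensorAlgebra.ι ℂ x * w) (1, 0)).1 = _
    simp [extendStep_apply_fst, hw']

theorem extendOp_mul (θ : V →ₗ[ℂ] Module.End ℂ (TensorAlgebra ℂ V)) (s : ℂ) (x : V)
    (w : TensorAlgebra ℂ V) :
    extendOp θ s (TensorAlgebra.ι ℂ x * w) =
      θ x w + s • (TensorAlgebra.ι ℂ x * extendOp θ s w) := by
  have h := fst_lift_extendStep θ s w
  simp [extendOp, extendStep_apply_snd, h]

theorem extendOp_unique (θ : V →ₗ[ℂ] Module.End ℂ (TensorAlgebra ℂ V)) (s : ℂ)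
    (P : Module.End ℂ (TensorAlgebra ℂ V)) (h1 : P 1 = 0)
    (hmul : ∀ (x : V) (w : TensorAlgebra ℂ V),
      P (TensorAlgebra.ι ℂ x * w) = θ x w + s • (TensorAlgebra.ι ℂ x * P w)) :
    P = extendOp θ s := by
  ext1 w
  refine tensor_left_induction (LinearMap.eqLocus P (extendOp θ s)) ?_ ?_ w
  · simp [h1, extendOp_one]
  · intro x w hw
    have hw' : P w = extendOp θ s w := hw
    change P _ = extendOp θ s _
    rw [hmul, extendOp_mul, hw']

/-- The action on `T(V)` of `A ∈ U₀ = End V`: the derivation extending `A`. -/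
def actZero : Module.End ℂ V →ₗ[ℂ] Module.End ℂ (TensorAlgebra ℂ V) where
  toFun A := extendOp (actOne ∘ₗ A) 1
  map_add' A B := by
    refine (extendOp_unique _ _ _ ?_ ?_).symm
    · simp [extendOp_one]
    · intro x w
      simp only [LinearMap.add_apply, extendOp_mul, LinearMap.comp_apply, map_add, mul_add,
        smul_add]
      abel
  map_smul' c A := by
    refine (extendOp_unique _ _ _ ?_ ?_).symm
    · simp [extendOp_one]
    · intro x w
      simp [extendOp_mul]

/-- The action on `T(V)` of `Φ ∈ U₋₁ = Hom(V, End V)`: it kills the unit, and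
`Φ (x w) = (Φ x) w - x (Φ w)`. -/
def actNegOne (Φ : V →ₗ[ℂ] Module.End ℂ V) : Module.End ℂ (TensorAlgebra ℂ V) :=
  extendOp (actZero ∘ₗ Φ) (-1)

/-- The supercommutator of operators `a` of degree `p` and `b` of degree `q`. -/
def superBracket (p q : ℤ) (a b : Module.End ℂ (TensorAlgebra ℂ V)) :
    Module.End ℂ (TensorAlgebra ℂ V) :=
  a * b - ((-1 : ℂ) ^ (p * q)) • (b * a)

theorem superBracket_actZero_actOne (A : Module.End ℂ V) (x : V) :
    superBracket 0 1 (actZero A) (actOne x) = actOne (A x) := by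
  ext1 w
  simp [superBracket, actZero, actOne, extendOp_mul]

theorem superBracket_actNegOne_actOne (Φ : V →ₗ[ℂ] Module.End ℂ V) (x : V) :
    superBracket (-1) 1 (actNegOne Φ) (actOne x) = actZero (Φ x) := by
  ext1 w
  simp [superBracket, actNegOne, actOne, extendOp_mul]

/-- A family `S p` of spaces of operators contains `U₁ = V` in degree `1` and `N ⊆ U₋₁` in
degree `-1`, and is closed under the supercommutator. -/
structure ContainsGenerators (N : Submodule ℂ (V →ₗ[ℂ] Module.End ℂ V))
    (S : ℤ → Submodule ℂ (Module.End ℂ (TensorAlgebra ℂ V))) : Prop where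
  one_mem : ∀ x : V, actOne x ∈ S 1
  negOne_mem : ∀ Φ ∈ N, actNegOne Φ ∈ S (-1)
  bracket_mem : ∀ p q : ℤ, ∀ a ∈ S p, ∀ b ∈ S q, superBracket p q a b ∈ S (p + q)

/-- The degree `p` part of the subalgebra `𝒱(V, N)` of `U(V)` generated by `U₁ = V` and
`N ⊆ U₋₁`. -/
def subalg (N : Submodule ℂ (V →ₗ[ℂ] Module.End ℂ V)) (p : ℤ) :
    Submodule ℂ (Module.End ℂ (TensorAlgebra ℂ V)) :=
  ⨅ (S : ℤ → Submodule ℂ (Module.End ℂ (TensorAlgebra ℂ V))) (_ : ContainsGenerators N S), S p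

/-- Graded ideals of `𝒱(V, N)`. -/
structure IsGradedIdeal (N : Submodule ℂ (V →ₗ[ℂ] Module.End ℂ V))
    (I : ℤ → Submodule ℂ (Module.End ℂ (TensorAlgebra ℂ V))) : Prop where
  le : ∀ p, I p ≤ subalg N p
  bracket_mem : ∀ p q : ℤ, ∀ a ∈ subalg N p, ∀ b ∈ I q, superBracket p q a b ∈ I (p + q)

/-- The degree `p` part of the maximal graded ideal `𝒟₊` of `𝒱(V, N)` contained in the part of
degree at least `2`: the sum of all such graded ideals.  Then `𝒱'(V, N) = 𝒱(V, N) / 𝒟₊`. -/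
def maxIdeal (N : Submodule ℂ (V →ₗ[ℂ] Module.End ℂ V)) (p : ℤ) :
    Submodule ℂ (Module.End ℂ (TensorAlgebra ℂ V)) :=
  ⨆ (I : ℤ → Submodule ℂ (Module.End ℂ (TensorAlgebra ℂ V)))
    (_ : IsGradedIdeal N I ∧ ∀ q ≤ 1, I q = ⊥), I p

end Universal

/-! ### The Borcherds-Kac-Moody superalgebra `ℬ` and the tensor hierarchy algebra

The Chevalley and Serre relations say that `ℬ₁` is the irreducible `𝔤`-module generated by the
lowest weight vector `e₀`, and that `ℬ₊` is the free Lie superalgebra on `ℬ₁` modulo the ideal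
`𝒞₊` generated by `{e₀, e₀}`. -/

/-- The extended Cartan matrix `A_{IJ}`, `I, J = 0, 1, …, r`, with `A₀₀ = 0` and
`A₀ᵢ = Aᵢ₀ = aᵢ`, where `A_{ij} e_j = [h_i, e_j]`. -/
def extendedCartanMatrix {𝔤 ι : Type*} [LieRing 𝔤] [LieAlgebra ℂ 𝔤] [Fintype ι]
    {H : LieSubalgebra ℂ 𝔤} (β : LieAlgebra.Basis ι H) (a : ι → ℤ) :
    Matrix (Unit ⊕ ι) (Unit ⊕ ι) ℤ :=
  Matrix.fromBlocks 0 (Matrix.of fun _ j => a j) (Matrix.of fun i _ => a i) β.A.transpose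

section Hierarchy

variable (𝔤 : Type*) [LieRing 𝔤] [LieAlgebra ℂ 𝔤]
variable {V : Type*} [AddCommGroup V] [Module ℂ V] [LieRingModule 𝔤 V] [LieModule ℂ 𝔤 V]

/-- `S` contains `{e₀, e₀}` and is closed under supercommutators with `𝔤` and with `V = ℬ₁`. -/
structure ContainsSerre (e₀ : V)
    (S : ℤ → Submodule ℂ (Module.End ℂ (TensorAlgebra ℂ V))) : Prop where
  serre_mem : superBracket 1 1 (actOne e₀) (actOne e₀) ∈ S 2
  zero_bracket_mem : ∀ (y : 𝔤) (q : ℤ), ∀ c ∈ S q,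
    superBracket 0 q (actZero (LieModule.toEnd ℂ 𝔤 V y)) c ∈ S q
  one_bracket_mem : ∀ (x : V) (q : ℤ), ∀ c ∈ S q, superBracket 1 q (actOne x) c ∈ S (1 + q)

/-- The degree `p` part of the ideal `𝒞₊` generated by `{e₀, e₀}`; thus
`ℬ₊ = U₊ / 𝒞₊`, where `U₊` is the free Lie superalgebra on `V = ℬ₁`. -/
def serreIdeal (e₀ : V) (p : ℤ) : Submodule ℂ (Module.End ℂ (TensorAlgebra ℂ V)) :=
  ⨅ (S : ℤ → Submodule ℂ (Module.End ℂ (TensorAlgebra ℂ V))) (_ : ContainsSerre 𝔤 e₀ S), S p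

/-- The conditions on a subspace `N = V₋₁` of `U₋₁` that enter the definition of `𝒯₋₁`. -/
structure IsAdmissible (e₀ : V) (N : Submodule ℂ (V →ₗ[ℂ] Module.End ℂ V)) : Prop where
  /-- `{V₋₁, ℬ₁} = 𝔤`, as a subspace of `U₀ = End ℬ₁`. -/
  bracket_eq : Submodule.span ℂ {A : Module.End ℂ V | ∃ Φ ∈ N, ∃ x : V, A = Φ x} =
    LinearMap.range (LieModule.toEnd ℂ 𝔤 V : 𝔤 →ₗ[ℂ] Module.End ℂ V)
  /-- `𝒱'(ℬ₁, V₋₁)₂ ⊆ ℬ₂`: both are quotients of the space `𝒱₂` spanned by all `{x, y}` with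
  `x, y ∈ ℬ₁`, by `(𝒟₊)₂` and `(𝒞₊)₂`, and the condition means `(𝒞₊)₂ ⊆ (𝒟₊)₂`. -/
  serre_le : serreIdeal 𝔤 e₀ 2 ≤ maxIdeal N 2
  /-- There is `Θ ∈ V₋₁` with `{Θ, Θ} = 0` such that `{Θ, ℬ₁}` is a non-abelian subalgebra
  of `𝔤`. -/
  exists_embedding : ∃ Θ ∈ N, superBracket (-1) (-1) (actNegOne Θ) (actNegOne Θ) = 0 ∧
    (∀ x y : V, ∃ z : V, ⁅Θ x, Θ y⁆ = Θ z) ∧ ∃ x y : V, ⁅Θ x, Θ y⁆ ≠ 0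

/-- `𝒯₋₁`, the sum of all admissible subspaces of `U₋₁`; its representation of `𝔤` is
`𝐭₋₁ = 𝐫₋₁`. -/
def tNegOne (e₀ : V) : Submodule ℂ (V →ₗ[ℂ] Module.End ℂ V) :=
  sSup {N | IsAdmissible 𝔤 e₀ N}

/-- The map `Φ : r̄₁ × adj → U₋₁`, `Φ(w, z)(x) = ⟨w, x⟩ z` (with `z` acting on `V`). -/
def embTensor : Module.Dual ℂ V ⊗[ℂ] 𝔤 →ₗ[ℂ] (V →ₗ[ℂ] Module.End ℂ V) :=
  dualTensorHom ℂ V (Module.End ℂ V) ∘ₗ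
    LinearMap.lTensor (Module.Dual ℂ V) (LieModule.toEnd ℂ 𝔤 V : 𝔤 →ₗ[ℂ] Module.End ℂ V)

end Hierarchy

/-! ### The components of `r̄₁ × adj` -/

section Components

variable (𝔤 : Type*) [LieRing 𝔤] [LieAlgebra ℂ 𝔤]
variable (M : Type*) [AddCommGroup M] [Module ℂ M] [LieRingModule 𝔤 M] [LieModule ℂ 𝔤 M]

/-- The contraction `m ⊗ z ↦ κ(y, z) m` with `y`, where `κ` is the Killing form. -/
def contract (y : 𝔤) : M ⊗[ℂ] 𝔤 →ₗ[ℂ] M :=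
  (TensorProduct.rid ℂ M).toLinearMap ∘ₗ LinearMap.lTensor M (killingForm ℂ 𝔤 y)

/-- The copy of `M` in `M × adj` that is embedded by the intertwiner `m ↦ ∑ (t_α m) ⊗ t^α`
(indices raised with the inverse of the Killing form), that is, by sending `m` to the tensor whose
contraction with any `y ∈ 𝔤` is `y m`. -/
def smallPart : Submodule ℂ (M ⊗[ℂ] 𝔤) where
  carrier := {τ | ∃ m : M, ∀ y : 𝔤, contract 𝔤 M y τ = ⁅y, m⁆}
  add_mem' := by
    rintro τ σ ⟨m, hm⟩ ⟨n, hn⟩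
    exact ⟨m + n, fun y => by rw [map_add, hm, hn, lie_add]⟩
  zero_mem' := ⟨0, fun y => by simp⟩
  smul_mem' := by
    rintro c τ ⟨m, hm⟩
    exact ⟨c • m, fun y => by rw [map_smul, hm, lie_smul]⟩

variable {𝔤}

/-- The component of `M × adj` generated by the tensor product of a highest weight vector of `M`
and a highest root vector of `𝔤`.  For irreducible `M` this is the irreducible component whose
highest weight is the sum of the highest weights of `M` and of `adj`. -/
def largePart {ι : Type*} [Fintype ι] {H : LieSubalgebra ℂ 𝔤} (β : LieAlgebra.Basis ι H) :
    Submodule ℂ (M ⊗[ℂ] 𝔤) :=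
  (LieSubmodule.lieSpan ℂ 𝔤 {τ : M ⊗[ℂ] 𝔤 | ∃ (m : M) (z : 𝔤),
    (∀ i, ⁅β.e i, m⁆ = 0) ∧ (∀ i, ⁅β.e i, z⁆ = 0) ∧ τ = m ⊗ₜ[ℂ] z}).toSubmodule

variable (V : Type*) [AddCommGroup V] [Module ℂ V] [LieRingModule 𝔤 V] [LieModule ℂ 𝔤 V]

variable (𝔤) in
/-- The invariant pairing `⟨w ⊗ z, v ⊗ y⟩ = w(v) κ(z, y)` between `r̄₁ × adj` and `r₁ × adj`. -/
def adjPairing : Module.Dual ℂ V ⊗[ℂ] 𝔤 →ₗ[ℂ] Module.Dual ℂ (V ⊗[ℂ] 𝔤) :=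
  TensorProduct.dualDistrib ℂ V 𝔤 ∘ₗ LinearMap.lTensor (Module.Dual ℂ V) (killingForm ℂ 𝔤)

variable {ι : Type*} [Fintype ι] {H : LieSubalgebra ℂ 𝔤} (β : LieAlgebra.Basis ι H)

variable (𝔤) in
/-- `r_S ⊆ r̄₁ × adj`. -/
def rS : Submodule ℂ (Module.Dual ℂ V ⊗[ℂ] 𝔤) := smallPart 𝔤 (Module.Dual ℂ V)

/-- `r_L ⊆ r̄₁ × adj`. -/
def rL : Submodule ℂ (Module.Dual ℂ V ⊗[ℂ] 𝔤) := largePart (Module.Dual ℂ V) β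

/-- `r_M ⊆ r̄₁ × adj`, the orthogonal complement of `r_S + r_L`: the tensors whose invariant
pairing with the conjugate components `r̄_S + r̄_L ⊆ r₁ × adj` vanishes. -/
def rM : Submodule ℂ (Module.Dual ℂ V ⊗[ℂ] 𝔤) where
  carrier := {τ | ∀ σ ∈ smallPart 𝔤 V ⊔ largePart V β, adjPairing 𝔤 V τ σ = 0}
  add_mem' := by
    intro τ τ' h h' σ hσ
    rw [map_add, LinearMap.add_apply, h σ hσ, h' σ hσ, add_zero]
  zero_mem' := by
    intro σ _
    simp
  smul_mem' := by
    intro c τ h σ hσ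
    rw [map_smul, LinearMap.smul_apply, h σ hσ, smul_zero]

variable {V}

/-- For `r₁ ≅ adj`, the symmetric part `(adj × adj)₊` of `adj × adj`, transported to
`r̄₁ × adj` by the isomorphism `ψ : r₁ ≅ adj` and the Killing form. -/
def symPart (ψ : V ≃ₗ⁅ℂ, 𝔤⁆ 𝔤) : Submodule ℂ (Module.Dual ℂ V ⊗[ℂ] 𝔤) :=
  (LinearMap.eqLocus (TensorProduct.comm ℂ 𝔤 𝔤).toLinearMap LinearMap.id).map
    (LinearMap.rTensor 𝔤
      (Module.Dual.transpose (R := ℂ) (ψ : V →ₗ[ℂ] 𝔤) ∘ₗ killingForm ℂ 𝔤))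

end Components

end

end TensorHierarchy

/-!
The supercommutator of an element `Φ` of an admissible space `V₋₁` with the degree two part of the
maximal ideal lies in the degree one part of that ideal, which is zero. So condition (ii) forces
`Φ(x) y + Φ(y) x` to vanish on the `𝔤`-submodule of `V ⊗ V` generated by `e₀ ⊗ e₀`
(`symApply_eq_zero`). As `Φ` takes values in `𝔤` by (i), all of `𝒯₋₁` comes from the `𝔤`-module
`serreHom` of maps `Ψ : V → 𝔤` with this property (`tNegOne_le`). Two consequences are used
throughout: `[Ψ(e₀), e₀] = 0` and `[Ψ(y e₀), e₀] = -[Ψ(e₀), y e₀]`.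

* The tensor `w ⊗ z` of highest weight vectors generating `r_L` has `Ψ(e₀) e₀ ≠ 0`, and for `r_S` the
  element `z = Ψ(e₀)` satisfies `κ(h_l, z) = -a_l`, which is incompatible with `z e₀ = 0` as the
  weight `a` has positive norm. This excludes both components (`not_rL_le`, `not_rS_le`).

* The conjugate large component is generated by `e₀ ⊗ z` with `z` a lowest root vector, because the
  principal `sl₂` raises a product of lowest weight vectors to the product of highest weight vectors
  (`tmul_highest_mem`). Such a `z` can be taken orthogonal to the annihilator of `e₀`, so the pairing
  with `Ψ` vanishes (`largePart_le_serreAnnihilator`).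

* The pairing of `Ψ` with the conjugate small component is `tr (y ↦ Ψ(y m))`. By irreducibility one
  may take `m = e₀`, and the Serre relation turns this trace into that of `-Ψ(e₀)` on `𝔤 e₀`. The
  remaining claim is that every `z` with `z e₀ = 0` has trace zero on `𝔤 e₀`
  (`mem_traceKer_of_lie_eq_zero`). Commutators in the stabilizer of the line `ℂ e₀` have trace zero,
  which deals with everything except combinations of the `h_k` with `a_k ≠ 0`. The determinant
  condition says that the norm of `a` in the normalization by the inverse Cartan matrix is
  `(D - 1) / (D - 2) ≤ 2`, and this leaves only weights supported on one node, where there is nothing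
  to do, and weights `-1` at two nodes with all column sums of the Cartan matrix equal to `-a`
  (`support_dichotomy`). In the second case the coweight dual to the difference of the two nodes has
  coefficients of sum zero (`exists_antisymmetric_coweight`), and its trace on `𝔤 e₀` is minus its
  trace on `𝔫₋`, that is, twice this sum (`sum_h_mem_traceKer`).

* If `V` is the adjoint module, let `ω` be the alternating part of `Ψ`. The relation gives
  `ω(e₀, z e₀) = 0`; applied to `z Ψ` and polarised, it gives `ω(e₀, y z e₀) = 0`, and the vectors
  `y z e₀` span. So `ω(e₀, ·) = 0` for all `Ψ` and hence `ω = 0` (`altPart_eq_zero`).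
-/

open scoped TensorProduct

namespace TensorHierarchy

/-! ### Symmetrizable Cartan matrices -/

/-- An indecomposable Cartan matrix `A` of finite type together with a positive definite
symmetrization `G`, normalized by `2 G_{kl} = G_{kk} A_{kl}`.  For a simple Lie algebra `G` is the
Gram matrix of the Killing form on the simple coroots. -/
structure IsCartanPair {ι : Type*} [Fintype ι] (A G : Matrix ι ι ℤ) : Prop where
  symm : ∀ k l, G k l = G l k
  pos : ∀ x : ι → ℚ, x ≠ 0 → 0 < ∑ k, ∑ l, x k * G k l * x l
  two_mul : ∀ k l, 2 * G k l = G k k * A k l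
  nonpos : ∀ k l, k ≠ l → A k l ≤ 0
  connected : ∀ S : Set ι, S.Nonempty → (∀ k ∈ S, ∀ l, A k l ≠ 0 → l ∈ S) → S = Set.univ

namespace IsCartanPair

variable {ι : Type*} [Fintype ι] {A G : Matrix ι ι ℤ} (h : IsCartanPair A G)

include h

theorem diag_pos (k : ι) : 0 < G k k := by
  classical
  have := h.pos (Pi.single k 1) (by simp)
  simpa [Pi.single_apply] using this

theorem diag_eq_two (k : ι) : A k k = 2 := by
  have h1 := h.two_mul k k
  have h2 := h.diag_pos k
  have : G k k * (A k k - 2) = 0 := by linarith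
  rcases mul_eq_zero.mp this with h3 | h3 <;> omega

theorem off_nonpos {k l : ι} (hkl : k ≠ l) : G k l ≤ 0 := by
  have h1 := h.two_mul k l
  have h2 := h.diag_pos k
  have h3 := h.nonpos k l hkl
  nlinarith

theorem ne_zero_symm {k l : ι} (hkl : A k l ≠ 0) : A l k ≠ 0 := by
  intro h0
  have h1 := h.two_mul k l
  have h2 := h.two_mul l k
  rw [h0, mul_zero, h.symm] at h2
  have h3 := h.diag_pos k
  have : G k k * A k l = 0 := by omega
  rcases mul_eq_zero.mp this with h4 | h4
  · omega
  · exact hkl h4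

/-- The rescaling that turns the symmetric matrix `G` into the transposed Cartan matrix. -/
theorem sum_mul_scaled (x u : ι → ℚ) :
    ∑ k, ∑ l, x k * G k l * (2 * u l / G l l) = ∑ k, x k * ∑ l, A l k * u l := by
  refine Finset.sum_congr rfl fun k _ => ?_
  rw [Finset.mul_sum]
  refine Finset.sum_congr rfl fun l _ => ?_
  have h1 : (2 : ℚ) * G l k = G l l * A l k := by exact_mod_cast h.two_mul l k
  have h2 : (G l l : ℚ) ≠ 0 := by exact_mod_cast (h.diag_pos l).ne'
  rw [h.symm k l]
  field_simp
  linear_combination x k * u l * h1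

/-- The inverse of a Cartan matrix of finite type has non-negative entries. -/
theorem nonneg_of_mulVec_nonneg (u : ι → ℚ) (hu : ∀ k, 0 ≤ ∑ l, A l k * u l) (k : ι) :
    0 ≤ u k := by
  classical
  -- Pair `u` with its own negative part (both rescaled) in the positive definite form.
  set w : ι → ℚ := fun k => 2 * u k / G k k with hw
  set x : ι → ℚ := fun k => max (-w k) 0 with hx
  have hG : ∀ k, (0 : ℚ) < G k k := fun k => by exact_mod_cast h.diag_pos k
  have h1 : 0 ≤ ∑ k, ∑ l, x k * G k l * w l := by
    rw [h.sum_mul_scaled]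
    exact Finset.sum_nonneg fun k _ => mul_nonneg (le_max_right _ _) (hu k)
  have h2 : ∑ k, ∑ l, x k * G k l * w l ≤ - ∑ k, ∑ l, x k * G k l * x l := by
    rw [← Finset.sum_neg_distrib]
    refine Finset.sum_le_sum fun k _ => ?_
    rw [← Finset.sum_neg_distrib]
    refine Finset.sum_le_sum fun l _ => ?_
    have hxk : 0 ≤ x k := le_max_right _ _
    rcases eq_or_ne k l with rfl | hkl
    · rcases le_total (w k) 0 with h3 | h3
      · have : x k = - w k := max_eq_left (by linarith)
        rw [this]; linarith
      · have : x k = 0 := max_eq_right (by linarith)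
        rw [this]; simp
    · have h3 : (G k l : ℚ) ≤ 0 := by exact_mod_cast h.off_nonpos hkl
      have h4 : 0 ≤ w l + x l := by
        have : - w l ≤ x l := le_max_left _ _
        linarith
      nlinarith [mul_nonneg (mul_nonneg hxk (neg_nonneg.mpr h3)) h4]
  have h3 : x = 0 := by
    by_contra h0
    have := h.pos x h0
    linarith
  have h4 : x k = 0 := congrFun h3 k
  have h5 : 0 ≤ w k := by
    have : - w k ≤ x k := le_max_left _ _
    linarith
  have h6 : u k = w k * G k k / 2 := by
    rw [hw]; field_simp [(hG k).ne']
  rw [h6]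
  have := hG k
  positivity

theorem eq_zero_of_mulVec_eq_zero (u : ι → ℚ) (hu : ∀ k, ∑ l, A l k * u l = 0) : u = 0 := by
  funext k
  have h1 := h.nonneg_of_mulVec_nonneg u (fun k => (hu k).ge) k
  have h2 := h.nonneg_of_mulVec_nonneg (-u) (fun k => by simp [hu k]) k
  simp only [Pi.neg_apply] at h2
  simp only [Pi.zero_apply]
  linarith

theorem eq_zero_of_mulVec_eq_zero' (u : ι → ℚ) (hu : ∀ k, ∑ l, A k l * u l = 0) : u = 0 := by
  by_contra h0
  have h1 := h.pos u h0
  have h2 : ∑ k, ∑ l, u k * G k l * u l = 0 := by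
    refine Finset.sum_eq_zero fun k _ => ?_
    have : ∑ l, u k * G k l * u l = u k * G k k / 2 * ∑ l, A k l * u l := by
      rw [Finset.mul_sum]
      refine Finset.sum_congr rfl fun l _ => ?_
      have h1 : (2 : ℚ) * G k l = G k k * A k l := by exact_mod_cast h.two_mul k l
      linear_combination u k * u l / 2 * h1
    rw [this, hu, mul_zero]
  linarith

theorem exists_mulVec_eq (b : ι → ℚ) : ∃ u : ι → ℚ, ∀ k, ∑ l, A l k * u l = b k := by
  let L : (ι → ℚ) →ₗ[ℚ] (ι → ℚ) := (A.transpose.map (Int.cast : ℤ → ℚ)).mulVecLin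
  have hL : ∀ u k, L u k = ∑ l, A l k * u l := fun u k => by
    simp [L, Matrix.mulVec, dotProduct]
  have hinj : Function.Injective L := by
    refine (injective_iff_map_eq_zero L).mpr fun u hu => h.eq_zero_of_mulVec_eq_zero u fun k => ?_
    rw [← hL, hu]; rfl
  obtain ⟨u, hu⟩ := LinearMap.injective_iff_surjective.mp hinj b
  exact ⟨u, fun k => by rw [← hL, hu]⟩

theorem exists_mulVec_eq' (b : ι → ℚ) : ∃ u : ι → ℚ, ∀ k, ∑ l, A k l * u l = b k := by
  let L : (ι → ℚ) →ₗ[ℚ] (ι → ℚ) := (A.map (Int.cast : ℤ → ℚ)).mulVecLin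
  have hL : ∀ u k, L u k = ∑ l, A k l * u l := fun u k => by
    simp [L, Matrix.mulVec, dotProduct]
  have hinj : Function.Injective L := by
    refine (injective_iff_map_eq_zero L).mpr fun u hu => h.eq_zero_of_mulVec_eq_zero' u fun k => ?_
    rw [← hL, hu]; rfl
  obtain ⟨u, hu⟩ := LinearMap.injective_iff_surjective.mp hinj b
  exact ⟨u, fun k => by rw [← hL, hu]⟩

/-- Solvability of `G s = a`, with the equivalent equation for `A`. -/
theorem exists_gram_mulVec_eq (a : ι → ℚ) : ∃ s : ι → ℚ,
    (∀ k, ∑ l, A k l * s l = 2 * a k / G k k) ∧ ∀ k, ∑ l, G k l * s l = a k := by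
  obtain ⟨s, hs⟩ := h.exists_mulVec_eq' fun k => 2 * a k / G k k
  refine ⟨s, hs, fun k => ?_⟩
  have h2 : ∀ l, (G k l : ℚ) = G k k / 2 * A k l := fun l => by
    have h3 : (2 : ℚ) * G k l = G k k * A k l := by exact_mod_cast h.two_mul k l
    linear_combination h3 / 2
  rw [Finset.sum_congr rfl fun l _ => by rw [h2 l, mul_assoc], ← Finset.mul_sum, hs]
  have : (G k k : ℚ) ≠ 0 := by exact_mod_cast (h.diag_pos k).ne'
  field_simp

/-- The Dynkin diagram, with multiplicities and arrows forgotten. -/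
def graph : SimpleGraph ι where
  Adj k l := k ≠ l ∧ A k l ≠ 0
  symm := ⟨fun _ _ hkl => ⟨hkl.1.symm, h.ne_zero_symm hkl.2⟩⟩
  loopless := ⟨fun _ hk => hk.1 rfl⟩

theorem graph_preconnected : h.graph.Preconnected := by
  intro i j
  have := h.connected {k | h.graph.Reachable i k} ⟨i, SimpleGraph.Reachable.refl i⟩ (by
    intro k hk l hl
    rcases eq_or_ne k l with rfl | hkl
    · exact hk
    · exact SimpleGraph.Reachable.trans hk (SimpleGraph.Adj.reachable ⟨hkl, hl⟩))
  have h2 : j ∈ {k | h.graph.Reachable i k} := by rw [this]; trivial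
  exact h2

theorem le_neg_one_of_adj {k l : ι} (hkl : h.graph.Adj k l) : A k l ≤ -1 := by
  have := h.nonpos k l hkl.1
  have := hkl.2
  omega

omit h in
theorem _root_.SimpleGraph.exists_adj_dist_succ {V : Type*} {Γ : SimpleGraph V} {k j : V}
    (hr : Γ.Reachable k j) (hkj : k ≠ j) :
    ∃ m, Γ.Adj k m ∧ Γ.dist m j + 1 = Γ.dist k j := by
  obtain ⟨p, hp⟩ := hr.exists_walk_length_eq_dist
  cases p with
  | nil => exact absurd rfl hkj
  | cons hadj q =>
    rename_i m
    refine ⟨m, hadj, le_antisymm ?_ ?_⟩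
    · rw [← hp, SimpleGraph.Walk.length_cons]
      exact Nat.add_le_add_right (SimpleGraph.dist_le q) 1
    · have h1 : Γ.Reachable m j := ⟨q⟩
      obtain ⟨q', hq'⟩ := h1.exists_walk_length_eq_dist
      rw [← hq', ← SimpleGraph.Walk.length_cons hadj]
      exact SimpleGraph.dist_le _

/-- Any two points of the support of a non-negative `b` lie on a geodesic (here: the union `P` of
all geodesics between them) of the Dynkin diagram whose indicator function `1_P` satisfies
`Aᵀ 1_P ≤ b`: an inner point of `P` has two neighbours in `P`, and an end point has one. -/
theorem exists_geodesic {b : ι → ℤ} (hb : ∀ k, 0 ≤ b k) {i j : ι} (hij : i ≠ j) (hi : b i ≠ 0)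
    (hj : b j ≠ 0) : ∃ P : Finset ι, i ∈ P ∧ j ∈ P ∧ ∀ k, ∑ l ∈ P, A l k ≤ b k := by
  classical
  let d := h.graph.dist
  have hr := h.graph_preconnected
  let P : Finset ι := Finset.univ.filter fun k => d i k + d k j = d i j
  have hP : ∀ k, k ∈ P ↔ d i k + d k j = d i j := fun k => by simp [P]
  have htri : ∀ a b c, d a c ≤ d a b + d b c := fun a b c => by
    obtain ⟨p, hp⟩ := (hr a b).exists_walk_length_eq_dist
    obtain ⟨q, hq⟩ := (hr b c).exists_walk_length_eq_dist
    have := SimpleGraph.dist_le (p.append q)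
    rw [SimpleGraph.Walk.length_append, hp, hq] at this
    exact this
  have hcomm : ∀ a b, d a b = d b a := fun a b => SimpleGraph.dist_comm
  have hself : ∀ a, d a a = 0 := fun a => SimpleGraph.dist_self
  -- Neighbours inside `P` in the direction of `j` and of `i`.
  have hfwd : ∀ k ∈ P, k ≠ j → ∃ m ∈ P, h.graph.Adj m k ∧ d m j + 1 = d k j := by
    intro k hk hkj
    obtain ⟨m, hm, hd⟩ := SimpleGraph.exists_adj_dist_succ (hr k j) hkj
    refine ⟨m, ?_, hm.symm, hd⟩
    rw [hP] at hk ⊢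
    have h1 := htri i m j
    have h2 := htri i k m
    have h3 : d k m ≤ 1 := by
      have := SimpleGraph.dist_le (SimpleGraph.Walk.cons hm SimpleGraph.Walk.nil)
      simpa using this
    have hd' : d m j + 1 = d k j := hd
    omega
  have hbwd : ∀ k ∈ P, k ≠ i → ∃ m ∈ P, h.graph.Adj m k ∧ d i m + 1 = d i k := by
    intro k hk hki
    obtain ⟨m, hm, hd⟩ := SimpleGraph.exists_adj_dist_succ (hr k i) hki
    refine ⟨m, ?_, hm.symm, ?_⟩
    · rw [hP] at hk ⊢
      have h1 := htri i m j
      have h2 := htri m k j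
      have h3 : d m k ≤ 1 := by
        have := SimpleGraph.dist_le (SimpleGraph.Walk.cons hm.symm SimpleGraph.Walk.nil)
        simpa using this
      have hd' : d m i + 1 = d k i := hd
      have h4 := hcomm m i
      have h5 := hcomm k i
      omega
    · have hd' : d m i + 1 = d k i := hd
      have h4 := hcomm m i
      have h5 := hcomm k i
      omega
  have hiP : i ∈ P := by rw [hP, hself, zero_add]
  have hjP : j ∈ P := by rw [hP, hself, add_zero]
  have hcol : ∀ k, ∑ l ∈ P, A l k ≤ b k := by
    intro k
    by_cases hk : k ∈ P
    · have hsplit : ∀ Q ⊆ P, k ∉ Q → ∑ l ∈ P, A l k ≤ 2 + ∑ l ∈ Q, A l k := by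
        intro Q hQ hkQ
        have h1 : ∑ l ∈ P, A l k ≤ ∑ l ∈ insert k Q, A l k := by
          rw [← Finset.sum_sdiff (Finset.insert_subset hk hQ)]
          refine add_le_of_nonpos_left (Finset.sum_nonpos fun l hl => h.nonpos l k ?_)
          rintro rfl
          simp at hl
        rwa [Finset.sum_insert hkQ, h.diag_eq_two] at h1
      have hone : ∀ m ∈ P, h.graph.Adj m k → ∑ l ∈ P, A l k ≤ 1 := by
        intro m hm hadj
        have h1 := hsplit {m} (by simpa using hm) (by simpa using hadj.1.symm)
        have h2 := h.le_neg_one_of_adj hadj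
        rw [Finset.sum_singleton] at h1
        omega
      rcases eq_or_ne k i with rfl | hki
      · obtain ⟨m, hm, hadj, -⟩ := hfwd k hk hij
        have := hone m hm hadj
        have := hb k
        omega
      rcases eq_or_ne k j with rfl | hkj
      · obtain ⟨m, hm, hadj, -⟩ := hbwd k hk hki
        have := hone m hm hadj
        have := hb k
        omega
      obtain ⟨m, hm, hadj, hd⟩ := hfwd k hk hkj
      obtain ⟨m', hm', hadj', hd'⟩ := hbwd k hk hki
      have hmm : m ≠ m' := by
        rintro rfl
        rw [hP] at hk hm
        omega
      have h1 := hsplit {m, m'} (by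
          intro l hl
          simp only [Finset.mem_insert, Finset.mem_singleton] at hl
          rcases hl with rfl | rfl
          exacts [hm, hm']) (by
        simp only [Finset.mem_insert, Finset.mem_singleton, not_or]
        exact ⟨hadj.1.symm, hadj'.1.symm⟩)
      rw [Finset.sum_pair hmm] at h1
      have h2 := h.le_neg_one_of_adj hadj
      have h3 := h.le_neg_one_of_adj hadj'
      have := hb k
      omega
    · refine le_trans (Finset.sum_nonpos fun l hl => h.nonpos l k ?_) (hb k)
      rintro rfl
      exact hk hl
  exact ⟨P, hiP, hjP, hcol⟩

theorem eq_zero_of_vanish {u : ι → ℚ} (hu : ∀ k, 0 ≤ ∑ l, A l k * u l) {i : ι} (hi : u i = 0) :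
    u = 0 := by
  classical
  have hnn := h.nonneg_of_mulVec_nonneg u hu
  have := h.connected {k | u k = 0} ⟨i, hi⟩ (by
    intro k hk l hl
    have hk' : u k = 0 := hk
    by_contra hne
    have hne' : u l ≠ 0 := hne
    have hlk : l ≠ k := fun h0 => hne' (h0 ▸ hk')
    have h1 := hu k
    have h2 : ∑ m, (A m k : ℚ) * u m < 0 := by
      refine Finset.sum_neg' (fun m _ => ?_) ⟨l, Finset.mem_univ _, ?_⟩
      · rcases eq_or_ne m k with rfl | hmk
        · simp [hk']
        · have : (A m k : ℚ) ≤ 0 := by exact_mod_cast h.nonpos m k hmk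
          nlinarith [hnn m]
      · have h3 : (A l k : ℚ) < 0 := by
          have := h.nonpos l k hlk
          have := h.ne_zero_symm hl
          exact_mod_cast lt_of_le_of_ne (by assumption) this
        have : 0 < u l := lt_of_le_of_ne (hnn l) (Ne.symm hne')
        nlinarith
    linarith)
  funext k
  have h2 : k ∈ {k | u k = 0} := by rw [this]; trivial
  exact h2

/-- For a dominant integral weight `y = (Aᵀ)⁻¹ b`, the bound `∑ b_k y_k ≤ 2` leaves a multiple of a
fundamental weight, or the highest root of a diagram of type `A_n` with `n ≥ 2`. -/
theorem support_dichotomy {b : ι → ℤ} (hb : ∀ k, 0 ≤ b k) {y : ι → ℚ}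
    (hy : ∀ k, ∑ l, A l k * y l = b k) (hsum : ∑ k, b k * y k ≤ 2) (hb0 : b ≠ 0) :
    (∃ i, ∀ k, k ≠ i → b k = 0) ∨
      ∃ i j, i ≠ j ∧ b i = 1 ∧ b j = 1 ∧ (∀ k, k ≠ i → k ≠ j → b k = 0) ∧
        ∀ k, ∑ l, A l k = b k := by
  classical
  obtain ⟨i, hi⟩ : ∃ i, b i ≠ 0 := by
    by_contra! h0
    exact hb0 (funext h0)
  by_cases hone : ∀ k, k ≠ i → b k = 0
  · exact Or.inl ⟨i, hone⟩
  push Not at hone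
  obtain ⟨j, hji, hj⟩ := hone
  have hy0 : ∀ k, 0 ≤ y k := h.nonneg_of_mulVec_nonneg y fun k => by
    rw [hy]; exact_mod_cast hb k
  have hnn : ∀ P : Finset ι, (∀ k, ∑ l ∈ P, A l k ≤ b k) → ∀ k,
      0 ≤ ∑ l, (A l k : ℚ) * (y l - if l ∈ P then 1 else 0) := by
    intro P hP k
    simp only [mul_sub, Finset.sum_sub_distrib, hy, mul_ite, mul_one, mul_zero,
      Finset.sum_ite_mem, Finset.univ_inter]
    have : (∑ l ∈ P, (A l k : ℚ)) ≤ b k := by exact_mod_cast hP k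
    linarith
  have hy1 : ∀ k l, k ≠ l → b k ≠ 0 → b l ≠ 0 → 1 ≤ y k := by
    intro k l hkl hk hl
    obtain ⟨P, hkP, -, hP⟩ := h.exists_geodesic hb hkl hk hl
    have := h.nonneg_of_mulVec_nonneg _ (hnn P hP) k
    simp only [hkP, if_true] at this
    linarith
  have hb1 : ∀ k, b k ≠ 0 → (1 : ℚ) ≤ b k := fun k hk => by
    have := hb k
    have : 1 ≤ b k := by omega
    exact_mod_cast this
  have hyi := hy1 i j hji.symm hi hj
  have hyj := hy1 j i hji hj hi
  have hbi := hb1 i hi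
  have hbj := hb1 j hj
  have hterm : ∀ k, 0 ≤ (b k : ℚ) * y k := fun k =>
    mul_nonneg (by exact_mod_cast hb k) (hy0 k)
  have hpair : (b i : ℚ) * y i + b j * y j ≤ 2 := by
    refine le_trans ?_ hsum
    rw [← Finset.sum_pair (f := fun k => (b k : ℚ) * y k) hji.symm]
    exact Finset.sum_le_sum_of_subset_of_nonneg (Finset.subset_univ _) fun k _ _ => hterm k
  have hyi' : y i = 1 := by nlinarith
  have hyj' : y j = 1 := by nlinarith
  have hbi' : (b i : ℚ) = 1 := by rw [hyi', hyj'] at hpair; linarith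
  have hbj' : (b j : ℚ) = 1 := by rw [hyi', hyj'] at hpair; linarith
  -- Minimality at `i` forces `y` to be the indicator of the geodesic, hence constant.
  obtain ⟨P, hiP, -, hP⟩ := h.exists_geodesic hb hji.symm hi hj
  have hyP := h.eq_zero_of_vanish (hnn P hP) (i := i) (by simp [hiP, hyi'])
  have hyall : ∀ k, y k = 1 := by
    intro k
    have h1 := congrFun hyP k
    by_cases hk : k ∈ P
    · simp only [hk, if_true, Pi.zero_apply] at h1
      linarith
    · simp only [hk, if_false, Pi.zero_apply, sub_zero] at h1
      have := h.eq_zero_of_vanish (u := y) (fun k => by rw [hy]; exact_mod_cast hb k) h1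
      rw [this] at hyi'
      simp at hyi'
  refine Or.inr ⟨i, j, hji.symm, by exact_mod_cast hbi', by exact_mod_cast hbj', ?_, ?_⟩
  · intro k hki hkj
    by_contra hk
    have h1 := hb1 k hk
    have h2 : (b i : ℚ) * y i + (b j * y j + b k * y k) ≤ 2 := by
      refine le_trans ?_ hsum
      rw [← Finset.sum_pair (f := fun k => (b k : ℚ) * y k) (Ne.symm hkj),
        ← Finset.sum_insert (f := fun k => (b k : ℚ) * y k)
          (by simp only [Finset.mem_insert, Finset.mem_singleton, not_or]
              exact ⟨hji.symm, hki.symm⟩)]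
      exact Finset.sum_le_sum_of_subset_of_nonneg (Finset.subset_univ _) fun k _ _ => hterm k
    rw [hbi', hbj', hyall, hyall, hyall] at h2
    linarith
  · intro k
    have := hy k
    simp only [hyall, mul_one] at this
    exact_mod_cast this

/-- If the column sums of `A` are `b = δ_i + δ_j`, the diagram is a chain with ends `i` and `j`.
The coefficients `r` of twice the Weyl vector are then equal at both ends, because
`(r_k - r_l)² + 2 (r_k + r_l)` takes the same value on all edges `{k, l}`. -/
theorem weylVector_ends_eq {b : ι → ℤ} (hb : ∀ k, 0 ≤ b k) {i j : ι} (hij : i ≠ j)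
    (hi : b i = 1) (hj : b j = 1) (hsum : ∀ k, ∑ l, A l k = b k) {r : ι → ℚ}
    (hr : ∀ k, ∑ l, A l k * r l = 2) : r i = r j := by
  classical
  have hr0 := h.nonneg_of_mulVec_nonneg r fun k => by rw [hr]; norm_num
  set E : ι → ι → ℚ := fun k l => (r k - r l) ^ 2 + 2 * (r k + r l) with hE
  -- A set `Q` of neighbours that exhausts the column sum contains all neighbours.
  have hzero : ∀ k, ∀ Q : Finset ι, k ∉ Q → 2 + ∑ l ∈ Q, A l k ≤ b k →
      ∀ m, m ≠ k → m ∉ Q → A m k = 0 := by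
    intro k Q hkQ hle m hmk hmQ
    have h1 := Finset.sum_sdiff (Finset.subset_univ (insert k Q)) (f := fun l => A l k)
    rw [hsum, Finset.sum_insert hkQ, h.diag_eq_two] at h1
    have h2 : A m k + ∑ l ∈ (Finset.univ \ insert k Q).erase m, A l k
        = ∑ l ∈ Finset.univ \ insert k Q, A l k := by
      exact Finset.add_sum_erase _ (fun l => A l k) (by simp [hmk, hmQ])
    have h3 : ∑ l ∈ (Finset.univ \ insert k Q).erase m, A l k ≤ 0 := by
      refine Finset.sum_nonpos fun l hl => h.nonpos l k ?_
      rintro rfl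
      simp at hl
    have h4 := h.nonpos m k hmk
    omega
  have hle2 : ∀ k, ∀ Q : Finset ι, k ∉ Q → b k ≤ 2 + ∑ l ∈ Q, A l k := by
    intro k Q hkQ
    have h1 := Finset.sum_sdiff (Finset.subset_univ (insert k Q)) (f := fun l => A l k)
    rw [hsum, Finset.sum_insert hkQ, h.diag_eq_two] at h1
    have h3 : ∑ l ∈ Finset.univ \ insert k Q, A l k ≤ 0 := by
      refine Finset.sum_nonpos fun l hl => h.nonpos l k ?_
      rintro rfl
      simp at hl
    omega
  have hsumQ : ∀ k, ∀ Q : Finset ι, k ∉ Q → (∀ m, m ≠ k → m ∉ Q → A m k = 0) →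
      2 * r k + ∑ l ∈ Q, A l k * r l = 2 := by
    intro k Q hkQ hz
    refine Eq.trans ?_ (hr k)
    rw [← Finset.sum_subset (Finset.subset_univ (insert k Q)), Finset.sum_insert hkQ,
      h.diag_eq_two]
    · norm_num
    · intro m _ hm
      simp only [Finset.mem_insert, not_or] at hm
      rw [hz m hm.1 hm.2]
      simp
  have hedge : ∀ k l m, h.graph.Adj k l → h.graph.Adj k m → E k l = E k m := by
    intro k l m hl hm
    rcases eq_or_ne l m with rfl | hlm
    · rfl
    have h1 := h.le_neg_one_of_adj hl.symm
    have h2 := h.le_neg_one_of_adj hm.symm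
    have hkQ : k ∉ ({l, m} : Finset ι) := by
      simp only [Finset.mem_insert, Finset.mem_singleton, not_or]
      exact ⟨hl.1, hm.1⟩
    have h3 := hle2 k {l, m} hkQ
    have h4 := hsumQ k {l, m} hkQ (by
      refine hzero k _ hkQ ?_
      rw [Finset.sum_pair hlm] at h3 ⊢
      have := hb k
      omega)
    rw [Finset.sum_pair hlm] at h3 h4
    have := hb k
    have h5 : A l k = -1 := by omega
    have h6 : A m k = -1 := by omega
    rw [h5, h6] at h4
    push_cast at h4
    simp only [hE]
    linear_combination (r m - r l) * h4
  have hend : ∀ k l, b k = 1 → h.graph.Adj k l → E k l = r k ^ 2 + 2 * r k := by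
    intro k l hk hl
    have h1 := h.le_neg_one_of_adj hl.symm
    have hkQ : k ∉ ({l} : Finset ι) := by simpa using hl.1
    have h3 := hle2 k {l} hkQ
    rw [Finset.sum_singleton] at h3
    have h4 := hsumQ k {l} hkQ (hzero k _ hkQ (by rw [Finset.sum_singleton]; omega))
    have h5 : A l k = -1 := by omega
    rw [Finset.sum_singleton, h5] at h4
    push_cast at h4
    have h6 : r l = 2 * r k - 2 := by linarith
    simp only [hE, h6]
    ring
  obtain ⟨l₀, hl₀, -⟩ := SimpleGraph.exists_adj_dist_succ (h.graph_preconnected i j) hij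
  obtain ⟨l₁, hl₁, -⟩ := SimpleGraph.exists_adj_dist_succ (h.graph_preconnected j i) hij.symm
  have hall := h.connected {k | ∀ l, h.graph.Adj k l → E k l = E i l₀}
    ⟨i, fun l hl => hedge i l l₀ hl hl₀⟩ (by
      intro k hk l hl m hm
      rcases eq_or_ne k l with rfl | hkl
      · exact hk m hm
      have hadj : h.graph.Adj k l := ⟨hkl, hl⟩
      rw [hedge l m k hm hadj.symm, ← hk l hadj]
      simp only [hE]
      ring)
  have hj' : j ∈ {k | ∀ l, h.graph.Adj k l → E k l = E i l₀} := by rw [hall]; trivial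
  have h1 := hj' l₁ hl₁
  rw [hend j l₁ hj hl₁, hend i l₀ hi hl₀] at h1
  have h2 : (r i - r j) * (r i + r j + 2) = 0 := by linear_combination -h1
  rcases mul_eq_zero.mp h2 with h3 | h3
  · linarith
  · linarith [hr0 i, hr0 j]

/-- On a chain with ends `i` and `j`, the coweight dual to `δ_i - δ_j` is antisymmetric. -/
theorem exists_antisymmetric_coweight {b : ι → ℤ} (hb : ∀ k, 0 ≤ b k) {i j : ι} (hij : i ≠ j)
    (hi : b i = 1) (hj : b j = 1) (hb0 : ∀ k, k ≠ i → k ≠ j → b k = 0)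
    (hsum : ∀ k, ∑ l, A l k = b k) :
    ∃ z : ι → ℚ, z i + z j = 0 ∧ z i ≠ 0 ∧ ∑ l, z l = 0 ∧
      ∀ k, k ≠ i → k ≠ j → ∑ l, A k l * z l = 0 := by
  classical
  obtain ⟨z, hz⟩ := h.exists_mulVec_eq' fun k => (if k = i then 1 else 0) - if k = j then 1 else 0
  obtain ⟨r, hr⟩ := h.exists_mulVec_eq fun _ => 2
  have hswap : ∀ x : ι → ℚ, ∑ l, z l * ∑ k, A k l * x k = x i - x j := by
    intro x
    have : ∑ l, z l * ∑ k, A k l * x k = ∑ k, x k * ∑ l, A k l * z l := by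
      simp only [Finset.mul_sum]
      rw [Finset.sum_comm]
      exact Finset.sum_congr rfl fun k _ => Finset.sum_congr rfl fun l _ => by ring
    rw [this]
    simp [hz, mul_sub]
  have h1 : ∑ l, z l = 0 := by
    have h2 := hswap r
    simp only [hr, h.weylVector_ends_eq hb hij hi hj hsum hr, sub_self] at h2
    rw [← Finset.sum_mul] at h2
    linarith
  have h2 : z i + z j = 0 := by
    have h3 := hswap fun _ => 1
    simp only [mul_one, sub_self] at h3
    have h4 : ∀ l, (∑ k, (A k l : ℚ)) = b l := fun l => by exact_mod_cast hsum l
    simp only [h4] at h3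
    rw [← Finset.sum_subset (Finset.subset_univ {i, j}), Finset.sum_pair hij, hi, hj] at h3
    · simpa using h3
    · intro k _ hk
      simp only [Finset.mem_insert, Finset.mem_singleton, not_or] at hk
      rw [hb0 k hk.1 hk.2]
      simp
  refine ⟨z, h2, ?_, h1, fun k hki hkj => by rw [hz]; simp [hki, hkj]⟩
  intro hzi
  have hzj : z j = 0 := by rw [hzi, zero_add] at h2; exact h2
  have hz0 : z = 0 := by
    by_contra h0
    have h3 := h.pos z h0
    have h4 : ∑ k, ∑ l, z k * G k l * z l = 0 := by
      refine Finset.sum_eq_zero fun k _ => ?_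
      have : ∑ l, z k * G k l * z l = G k k / 2 * (z k * ∑ l, A k l * z l) := by
        rw [Finset.mul_sum, Finset.mul_sum]
        refine Finset.sum_congr rfl fun l _ => ?_
        have h1 : (2 : ℚ) * G k l = G k k * A k l := by exact_mod_cast h.two_mul k l
        linear_combination z k * z l / 2 * h1
      rw [this, hz]
      rcases eq_or_ne k i with rfl | hki
      · simp [hzi]
      rcases eq_or_ne k j with rfl | hkj
      · simp [hzj]
      simp [hki, hkj]
    linarith
  have h3 := hz i
  simp [hz0, hij] at h3

end IsCartanPair

/-! ### Extremal vectors of irreducible modules -/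

section Extremal

open LieModule Module

variable {𝔤 : Type*} [LieRing 𝔤] [LieAlgebra ℂ 𝔤] {ι : Type*} [Fintype ι]
  {H : LieSubalgebra ℂ 𝔤} (β : LieAlgebra.Basis ι H)
variable {M : Type*} [AddCommGroup M] [Module ℂ M] [LieRingModule 𝔤 M] [LieModule ℂ 𝔤 M]

omit [Fintype ι] in
theorem lie_mem_of_lieSpan_eq_top {s : Set 𝔤} (hs : LieSubalgebra.lieSpan ℂ 𝔤 s = ⊤)
    (W : Submodule ℂ M) (hW : ∀ x ∈ s, ∀ m ∈ W, ⁅x, m⁆ ∈ W) (x : 𝔤) : ∀ m ∈ W, ⁅x, m⁆ ∈ W := by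
  have hx : x ∈ LieSubalgebra.lieSpan ℂ 𝔤 s := by rw [hs]; trivial
  induction hx using LieSubalgebra.lieSpan_induction with
  | mem u hu => exact hW u hu
  | zero => intro m _; rw [zero_lie]; exact W.zero_mem
  | add u v _ _ hu hv => intro m hm; rw [add_lie]; exact W.add_mem (hu m hm) (hv m hm)
  | smul t u _ hu => intro m hm; rw [smul_lie]; exact W.smul_mem t (hu m hm)
  | lie u v _ _ hu hv =>
    intro m hm
    rw [lie_lie]
    exact W.sub_mem (hu _ (hv m hm)) (hv _ (hu m hm))

/-- A non-zero subspace that is stable under the Chevalley generators is everything. -/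
theorem eq_top_of_generators_stable [LieModule.IsIrreducible ℂ 𝔤 M] (W : Submodule ℂ M)
    (h0 : W ≠ ⊥) (he : ∀ i, ∀ m ∈ W, ⁅β.e i, m⁆ ∈ W) (hf : ∀ i, ∀ m ∈ W, ⁅β.f i, m⁆ ∈ W) :
    W = ⊤ := by
  let N : LieSubmodule ℂ 𝔤 M :=
    { W with
      lie_mem := fun {x m} hm => lie_mem_of_lieSpan_eq_top β.span_ef W (by
        rintro x (⟨i, rfl⟩ | ⟨i, rfl⟩)
        exacts [he i, hf i]) x m hm }
  have hN : N = ⊤ := (IsSimpleOrder.eq_bot_or_eq_top N).resolve_left (by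
    intro hb
    apply h0
    have : N.toSubmodule = ⊥ := by rw [hb]; rfl
    exact this)
  have : N.toSubmodule = ⊤ := by rw [hN]; rfl
  exact this

/-- An irreducible module is generated by the lowering operators from any space of highest weight
vectors. -/
theorem eq_top_of_highest_le [LieModule.IsIrreducible ℂ 𝔤 M] {W P : Submodule ℂ M}
    (h0 : W ≠ ⊥) (he : ∀ i, ∀ m ∈ W, ⁅β.e i, m⁆ = 0) (hh : ∀ i, ∀ m ∈ W, ⁅β.h i, m⁆ ∈ W)
    (hP : ∀ i, ∀ m ∈ P, ⁅β.f i, m⁆ ∈ P) (hWP : W ≤ P) : P = ⊤ := by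
  let S : Submodule ℂ M := sInf {Q | W ≤ Q ∧ ∀ i, ∀ m ∈ Q, ⁅β.f i, m⁆ ∈ Q}
  have hWS : W ≤ S := le_sInf fun Q hQ => hQ.1
  have hSf : ∀ i, ∀ m ∈ S, ⁅β.f i, m⁆ ∈ S := by
    intro i m hm
    rw [Submodule.mem_sInf] at hm ⊢
    exact fun Q hQ => hQ.2 i m (hm Q hQ)
  have hSP : S ≤ P := sInf_le ⟨hWP, hP⟩
  -- The vectors of `S` that `e_j` and `h_j` map back into `S` form a competitor to `S`.
  let T : Submodule ℂ M :=
    { carrier := {m | m ∈ S ∧ ∀ j, ⁅β.e j, m⁆ ∈ S ∧ ⁅β.h j, m⁆ ∈ S}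
      add_mem' := fun {a b} ha hb => ⟨S.add_mem ha.1 hb.1, fun j => by
        rw [lie_add, lie_add]
        exact ⟨S.add_mem (ha.2 j).1 (hb.2 j).1, S.add_mem (ha.2 j).2 (hb.2 j).2⟩⟩
      zero_mem' := ⟨S.zero_mem, fun j => by simp⟩
      smul_mem' := fun c a ha => ⟨S.smul_mem c ha.1, fun j => by
        rw [lie_smul, lie_smul]
        exact ⟨S.smul_mem c (ha.2 j).1, S.smul_mem c (ha.2 j).2⟩⟩ }
  have hST : S ≤ T := by
    refine sInf_le ⟨fun m hm => ⟨hWS hm, fun j => ⟨?_, hWS (hh j m hm)⟩⟩, ?_⟩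
    · rw [he j m hm]; exact S.zero_mem
    · rintro i m ⟨hm, hm'⟩
      refine ⟨hSf i m hm, fun j => ⟨?_, ?_⟩⟩
      · rw [leibniz_lie]
        refine S.add_mem ?_ (hSf i _ (hm' j).1)
        rcases eq_or_ne j i with rfl | hji
        · rw [(β.sl2 j).lie_e_f]; exact (hm' j).2
        · rw [β.lie_e_f_ne j i hji, zero_lie]; exact S.zero_mem
      · rw [leibniz_lie]
        refine S.add_mem ?_ (hSf i _ (hm' j).2)
        rw [β.lie_h_f, smul_lie]
        exact zsmul_mem (hSf i m hm) _
  have hS0 : S ≠ ⊥ := fun hb => h0 (le_bot_iff.mp (hb ▸ hWS))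
  have := eq_top_of_generators_stable β S hS0 (fun i m hm => ((hST hm).2 i).1) hSf
  exact top_le_iff.mp (this ▸ hSP)

/-- An irreducible module is generated by the raising operators from any space of lowest weight
vectors. -/
theorem eq_top_of_lowest_le [LieModule.IsIrreducible ℂ 𝔤 M] {W P : Submodule ℂ M}
    (h0 : W ≠ ⊥) (hf : ∀ i, ∀ m ∈ W, ⁅β.f i, m⁆ = 0) (hh : ∀ i, ∀ m ∈ W, ⁅β.h i, m⁆ ∈ W)
    (hP : ∀ i, ∀ m ∈ P, ⁅β.e i, m⁆ ∈ P) (hWP : W ≤ P) : P = ⊤ :=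
  eq_top_of_highest_le β.symm h0 hf (fun i m hm => by
    change ⁅-β.h i, m⁆ ∈ W
    rw [neg_lie]
    exact W.neg_mem (hh i m hm)) hP hWP

/-- The sum of the eigenspaces of `x` on `M` with eigenvalues in `μ + ℝ_{>0}`. -/
def eigenAbove (M : Type*) [AddCommGroup M] [Module ℂ M] [LieRingModule 𝔤 M] [LieModule ℂ 𝔤 M]
    (x : 𝔤) (μ : ℂ) : Submodule ℂ M :=
  ⨆ (c : ℝ) (_ : 0 < c), (toEnd ℂ 𝔤 M x).eigenspace (μ + c)

theorem mem_eigenspace_toEnd {x : 𝔤} {μ : ℂ} {m : M} :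
    m ∈ (toEnd ℂ 𝔤 M x).eigenspace μ ↔ ⁅x, m⁆ = μ • m := by
  rw [Module.End.mem_eigenspace_iff, toEnd_apply_apply]

theorem mem_eigenAbove {x : 𝔤} {μ : ℂ} {m : M} {c : ℝ} (hc : 0 < c) (hm : ⁅x, m⁆ = (μ + c) • m) :
    m ∈ eigenAbove M x μ :=
  le_iSup₂ (f := fun (c : ℝ) (_ : 0 < c) => (toEnd ℂ 𝔤 M x).eigenspace (μ + c)) c hc
    (mem_eigenspace_toEnd.mpr hm)

theorem lie_eq_add_smul {x y : 𝔤} {a b : ℂ} {m : M} (hy : ⁅x, y⁆ = a • y) (hm : ⁅x, m⁆ = b • m) :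
    ⁅x, ⁅y, m⁆⁆ = (a + b) • ⁅y, m⁆ := by
  rw [leibniz_lie, hy, hm, smul_lie, lie_smul, add_smul]

theorem lie_mem_eigenAbove {x y : 𝔤} {μ : ℂ} {m : M} {a : ℝ} (ha : 0 ≤ a)
    (hy : ⁅x, y⁆ = (a : ℂ) • y) (hm : m ∈ eigenAbove M x μ) : ⁅y, m⁆ ∈ eigenAbove M x μ := by
  let P : Submodule ℂ M := (eigenAbove M x μ).comap (toEnd ℂ 𝔤 M y)
  have : eigenAbove M x μ ≤ P := by
    refine iSup₂_le fun c hc m hm => ?_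
    rw [mem_eigenspace_toEnd] at hm
    change ⁅y, m⁆ ∈ eigenAbove M x μ
    refine mem_eigenAbove (c := a + c) (by linarith) ?_
    rw [lie_eq_add_smul hy hm]
    congr 1
    push_cast
    ring
  exact this hm

theorem lie_mem_eigenAbove_of_mem {x y : 𝔤} {μ : ℂ} {m : M} (hy : y ∈ eigenAbove 𝔤 x 0)
    (hm : ⁅x, m⁆ = μ • m) : ⁅y, m⁆ ∈ eigenAbove M x μ := by
  let P : Submodule ℂ 𝔤 :=
    (eigenAbove M x μ).comap ((toEnd ℂ 𝔤 M : 𝔤 →ₗ[ℂ] Module.End ℂ M).flip m)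
  have : eigenAbove 𝔤 x 0 ≤ P := by
    refine iSup₂_le fun c hc y hy => ?_
    rw [mem_eigenspace_toEnd] at hy
    change ⁅y, m⁆ ∈ eigenAbove M x μ
    refine mem_eigenAbove hc ?_
    rw [lie_eq_add_smul hy hm]
    congr 1
    ring
  exact this hy

theorem lie_mem_eigenAbove_zero {x y z : 𝔤} (hy : y ∈ eigenAbove 𝔤 x 0)
    (hz : z ∈ eigenAbove 𝔤 x 0) : ⁅y, z⁆ ∈ eigenAbove 𝔤 x 0 := by
  let P : Submodule ℂ 𝔤 :=
    (eigenAbove 𝔤 x 0).comap ((toEnd ℂ 𝔤 𝔤 : 𝔤 →ₗ[ℂ] Module.End ℂ 𝔤).flip z)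
  have : eigenAbove 𝔤 x 0 ≤ P := by
    refine iSup₂_le fun c hc y hy => ?_
    rw [mem_eigenspace_toEnd, zero_add] at hy
    exact lie_mem_eigenAbove hc.le hy hz
  exact this hy

theorem eq_zero_of_mem_eigenAbove {x : 𝔤} {μ : ℂ} {m : M} (hm : m ∈ eigenAbove M x μ)
    (hm' : ⁅x, m⁆ = μ • m) : m = 0 := by
  have h1 := (toEnd ℂ 𝔤 M x).eigenspaces_iSupIndep μ
  have h2 : eigenAbove M x μ ≤ ⨆ (ν : ℂ) (_ : ν ≠ μ), (toEnd ℂ 𝔤 M x).eigenspace ν := by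
    refine iSup₂_le fun c hc => ?_
    refine le_iSup₂_of_le (μ + c) ?_ le_rfl
    intro h
    have : (c : ℂ) = 0 := by linear_combination h
    exact hc.ne' (by exact_mod_cast this)
  exact (Submodule.disjoint_def.mp h1) m (mem_eigenspace_toEnd.mpr hm') (h2 hm)

/-- An eigenvalue whose eigenvector lies in the span of the eigenspaces for `μ + ℝ_{≥0}` is itself
in `μ + ℝ_{≥0}`. -/
theorem exists_eq_add_of_mem {x : 𝔤} {μ ν : ℂ} {W : Submodule ℂ M}
    (hW : W ≤ (toEnd ℂ 𝔤 M x).eigenspace μ) {m : M} (hm : m ∈ W ⊔ eigenAbove M x μ) (hm0 : m ≠ 0)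
    (hm' : ⁅x, m⁆ = ν • m) : ∃ c : ℝ, 0 ≤ c ∧ ν = μ + c := by
  by_contra! hν
  have h1 := (toEnd ℂ 𝔤 M x).eigenspaces_iSupIndep ν
  have h2 : W ⊔ eigenAbove M x μ ≤ ⨆ (ν' : ℂ) (_ : ν' ≠ ν), (toEnd ℂ 𝔤 M x).eigenspace ν' := by
    refine sup_le (hW.trans (le_iSup₂_of_le μ ?_ le_rfl)) (iSup₂_le fun c hc => ?_)
    · exact fun h => hν 0 le_rfl (by simp [h])
    · exact le_iSup₂_of_le (μ + c) (fun h => hν c hc.le h.symm) le_rfl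
  exact hm0 ((Submodule.disjoint_def.mp h1) m (mem_eigenspace_toEnd.mpr hm') (h2 hm))

/-- A principal `sl₂`-triple adapted to the Chevalley generators: `e` and `f` are combinations of
the simple raising and lowering operators, all of which have `h`-eigenvalue `±2`. -/
structure IsPrincipalTriple (h e f : 𝔤) : Prop where
  sl2 : IsSl2Triple h e f
  h_mem : h ∈ Submodule.span ℂ (Set.range β.h)
  e_mem : e ∈ Submodule.span ℂ (Set.range β.e)
  f_mem : f ∈ Submodule.span ℂ (Set.range β.f)
  lie_e : ∀ k, ⁅h, β.e k⁆ = (2 : ℂ) • β.e k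
  lie_f : ∀ k, ⁅h, β.f k⁆ = -((2 : ℂ) • β.f k)

theorem IsPrincipalTriple.symm {β : LieAlgebra.Basis ι H} {h e f : 𝔤}
    (p : IsPrincipalTriple β h e f) :
    IsPrincipalTriple β.symm (-h) f e where
  sl2 := p.sl2.symm
  h_mem := by
    refine Submodule.neg_mem _ ?_
    have h1 : Submodule.span ℂ (Set.range β.h) ≤ Submodule.span ℂ (Set.range β.symm.h) := by
      refine Submodule.span_le.mpr ?_
      rintro _ ⟨k, rfl⟩
      have h2 : -(β.symm.h k) ∈ Submodule.span ℂ (Set.range β.symm.h) :=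
        Submodule.neg_mem _ (Submodule.subset_span ⟨k, rfl⟩)
      simpa using h2
    exact h1 p.h_mem
  e_mem := p.f_mem
  f_mem := p.e_mem
  lie_e k := by
    change ⁅-h, β.f k⁆ = (2 : ℂ) • β.f k
    rw [neg_lie, p.lie_f, neg_neg]
  lie_f k := by
    change ⁅-h, β.e k⁆ = -((2 : ℂ) • β.e k)
    rw [neg_lie, p.lie_e]

theorem exists_isPrincipalTriple [DecidableEq ι] [Nontrivial 𝔤] :
    ∃ h e f : 𝔤, IsPrincipalTriple β h e f := by
  have hne : Nonempty ι := by
    by_contra hemp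
    rw [not_nonempty_iff] at hemp
    have h1 := β.span_ef
    simp only [Set.range_eq_empty, Set.union_self, LieSubalgebra.span_empty] at h1
    obtain ⟨x, hx⟩ := exists_ne (0 : 𝔤)
    have h2 : x ∈ (⊥ : LieSubalgebra ℂ 𝔤) := h1 ▸ LieSubalgebra.mem_top x
    exact hx ((LieSubalgebra.mem_bot x).mp h2)
  let B : Matrix ι ι ℂ := β.A.map (Int.cast : ℤ → ℂ)
  have hdet : B.det ≠ 0 := by
    have h1 := β.nondegen.det_ne_zero
    have h2 : B.det = ((β.A.det : ℤ) : ℂ) := ((Int.castRingHom ℂ).map_det β.A).symm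
    rw [h2]
    exact_mod_cast h1
  obtain ⟨c, hc⟩ : ∃ c : ι → ℂ, ∀ k, ∑ l, (β.A k l : ℂ) * c l = 2 := by
    refine ⟨B⁻¹.mulVec fun _ => 2, fun k => ?_⟩
    have : B.mulVec (B⁻¹.mulVec fun _ => 2) = fun _ => 2 := by
      rw [Matrix.mulVec_mulVec, Matrix.mul_nonsing_inv _ (Ne.isUnit hdet), Matrix.one_mulVec]
    exact congrFun this k
  have hz : ∀ (n : ℤ) (x : 𝔤), n • x = (n : ℂ) • x := fun n x => (Int.cast_smul_eq_zsmul ℂ n x).symm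
  have he : ∀ k, ⁅∑ l, c l • β.h l, β.e k⁆ = (2 : ℂ) • β.e k := by
    intro k
    rw [sum_lie, ← hc k, Finset.sum_smul]
    refine Finset.sum_congr rfl fun l _ => ?_
    rw [smul_lie, β.lie_h_e, hz, smul_smul, mul_comm]
  have hf : ∀ k, ⁅∑ l, c l • β.h l, β.f k⁆ = -((2 : ℂ) • β.f k) := by
    intro k
    rw [sum_lie, ← hc k, Finset.sum_smul, ← Finset.sum_neg_distrib]
    refine Finset.sum_congr rfl fun l _ => ?_
    rw [smul_lie, β.lie_h_f, hz, smul_smul, ← neg_smul]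
    congr 1
    push_cast
    ring
  refine ⟨∑ l, c l • β.h l, ∑ l, c l • β.e l, ∑ l, β.f l, ⟨?_, ?_, ?_, ?_⟩, ?_, ?_, ?_, he, hf⟩
  · intro h0
    obtain ⟨k⟩ := hne
    have h1 := he k
    rw [h0, zero_lie] at h1
    exact (β.sl2 k).e_ne_zero ((smul_eq_zero.mp h1.symm).resolve_left two_ne_zero)
  · rw [sum_lie]
    refine Finset.sum_congr rfl fun l _ => ?_
    rw [lie_sum, Finset.sum_eq_single l]
    · rw [smul_lie, (β.sl2 l).lie_e_f]
    · intro m _ hm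
      rw [smul_lie, β.lie_e_f_ne l m hm.symm, smul_zero]
    · simp
  · rw [lie_sum, Finset.smul_sum]
    refine Finset.sum_congr rfl fun l _ => ?_
    rw [lie_smul, he, two_smul, two_smul, smul_add]
  · rw [lie_sum, Finset.smul_sum, ← Finset.sum_neg_distrib]
    refine Finset.sum_congr rfl fun l _ => ?_
    rw [hf, two_smul, two_smul]
  · exact Submodule.sum_mem _ fun l _ => Submodule.smul_mem _ _ (Submodule.subset_span ⟨l, rfl⟩)
  · exact Submodule.sum_mem _ fun l _ => Submodule.smul_mem _ _ (Submodule.subset_span ⟨l, rfl⟩)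
  · exact Submodule.sum_mem _ fun l _ => Submodule.subset_span ⟨l, rfl⟩

theorem IsPrincipalTriple.lie_h_h {β : LieAlgebra.Basis ι H} {h e f : 𝔤}
    (p : IsPrincipalTriple β h e f) (k : ι) : ⁅h, β.h k⁆ = 0 := by
  have h1 : Submodule.span ℂ (Set.range β.h) ≤
      LinearMap.ker ((toEnd ℂ 𝔤 𝔤 : 𝔤 →ₗ[ℂ] Module.End ℂ 𝔤).flip (β.h k)) := by
    refine Submodule.span_le.mpr ?_
    rintro _ ⟨l, rfl⟩
    exact β.lie_h_h l k
  exact h1 p.h_mem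

omit [Fintype ι] in
theorem lie_mem_of_mem_span {s : Set 𝔤} {W : Submodule ℂ M} {m : M} (hW : ∀ x ∈ s, ⁅x, m⁆ ∈ W)
    {x : 𝔤} (hx : x ∈ Submodule.span ℂ s) : ⁅x, m⁆ ∈ W := by
  have h1 : Submodule.span ℂ s ≤
      W.comap ((toEnd ℂ 𝔤 M : 𝔤 →ₗ[ℂ] Module.End ℂ M).flip m) :=
    Submodule.span_le.mpr hW
  exact h1 hx

/-- A highest weight vector: a non-zero common eigenvector of the `h_k` killed by all `e_k`.
Lowest weight vectors are the highest weight vectors for `β.symm`, which exchanges the `e_k` with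
the `f_k`. -/
structure IsHighest (v : M) : Prop where
  ne_zero : v ≠ 0
  e_eq_zero : ∀ k, ⁅β.e k, v⁆ = 0
  h_smul : ∀ k, ∃ c : ℂ, ⁅β.h k, v⁆ = c • v

theorem IsHighest.exists_smul {β : LieAlgebra.Basis ι H} {v : M} (hv : IsHighest β v) {x : 𝔤}
    (hx : x ∈ Submodule.span ℂ (Set.range β.h)) : ∃ c : ℂ, ⁅x, v⁆ = c • v := by
  have := lie_mem_of_mem_span (W := ℂ ∙ v) (m := v) (by
    rintro _ ⟨k, rfl⟩
    obtain ⟨c, hc⟩ := hv.h_smul k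
    exact Submodule.mem_span_singleton.mpr ⟨c, hc.symm⟩) hx
  obtain ⟨c, hc⟩ := Submodule.mem_span_singleton.mp this
  exact ⟨c, hc.symm⟩

variable [FiniteDimensional ℂ M]

/-- Every non-zero subspace stable under the Borel subalgebra contains a highest weight vector:
take an eigenvalue of a principal `h` of maximal real part, and a common eigenvector of the Cartan
subalgebra in its eigenspace. -/
theorem exists_isHighest_mem [FiniteDimensional ℂ 𝔤] {h e f : 𝔤} (p : IsPrincipalTriple β h e f)
    (U : Submodule ℂ M) (h0 : U ≠ ⊥)
    (hUe : ∀ k, ∀ m ∈ U, ⁅β.e k, m⁆ ∈ U) (hUh : ∀ k, ∀ m ∈ U, ⁅β.h k, m⁆ ∈ U) :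
    ∃ v ∈ U, IsHighest β v := by
  let T := toEnd ℂ 𝔤 M h
  have hUT : ∀ m ∈ U, T m ∈ U := fun m hm =>
    lie_mem_of_mem_span (W := U) (by rintro _ ⟨k, rfl⟩; exact hUh k m hm) p.h_mem
  let s : Set ℂ := {μ | U ⊓ T.eigenspace μ ≠ ⊥}
  have hsfin : s.Finite := by
    refine T.finite_hasEigenvalue.subset fun μ hμ => ?_
    intro hb
    exact hμ (le_bot_iff.mp (inf_le_right.trans hb.le))
  have hsne : s.Nonempty := by
    have : Nontrivial U := Submodule.nontrivial_iff_ne_bot.mpr h0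
    obtain ⟨μ, hμ⟩ := Module.End.exists_eigenvalue (T.restrict hUT)
    obtain ⟨⟨m, hm⟩, hm', hm0⟩ := hμ.exists_hasEigenvector
    refine ⟨μ, fun hb => hm0 ?_⟩
    have h1 : m ∈ U ⊓ T.eigenspace μ := by
      refine ⟨hm, mem_eigenspace_toEnd.mpr ?_⟩
      rw [Module.End.mem_eigenspace_iff] at hm'
      exact congrArg Subtype.val hm'
    rw [hb] at h1
    exact Subtype.ext ((Submodule.mem_bot ℂ).mp h1)
  obtain ⟨μ, hμ, hmax⟩ := hsfin.exists_maximalFor Complex.re s hsne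
  have hcomm : ∀ k, ∀ m ∈ U ⊓ T.eigenspace μ, ⁅β.h k, m⁆ ∈ U ⊓ T.eigenspace μ := by
    rintro k m ⟨hm, hm'⟩
    refine ⟨hUh k m hm, ?_⟩
    have h1 := mem_eigenspace_toEnd.mp hm'
    refine mem_eigenspace_toEnd.mpr ?_
    rw [lie_eq_add_smul (a := 0) (by rw [p.lie_h_h, zero_smul]) h1, zero_add]
  let E : LieSubmodule ℂ H M :=
    { U ⊓ T.eigenspace μ with
      lie_mem := fun {x m} hm => by
        have hx : (x : 𝔤) ∈ Submodule.span ℂ (Set.range β.h) := by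
          rw [← β.coe_cartan_eq_span]; exact x.2
        have hs : ∀ y ∈ Set.range β.h, ⁅y, m⁆ ∈ U ⊓ T.eigenspace μ := by
          rintro _ ⟨k, rfl⟩
          exact hcomm k m hm
        exact lie_mem_of_mem_span hs hx }
  have hE : Nontrivial E := Submodule.nontrivial_iff_ne_bot.mpr hμ
  have := β.isLieAbelian_cartan
  obtain ⟨χ, hχ⟩ := LieModule.exists_nontrivial_weightSpace_of_isSolvable ℂ H E
  obtain ⟨⟨y, hy⟩, hy0⟩ := exists_ne (0 : weightSpace E χ)
  obtain ⟨v, hvE⟩ := y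
  have hv := (mem_weightSpace _ _).mp hy
  have hvU : v ∈ U := hvE.1
  have hvT : ⁅h, v⁆ = μ • v := mem_eigenspace_toEnd.mp hvE.2
  have hv0' : v ≠ 0 := fun h0 => hy0 (Subtype.ext (Subtype.ext h0))
  refine ⟨v, hvU, hv0', fun k => ?_, fun k => ⟨χ (β.h' k), ?_⟩⟩
  · by_contra hne
    have h1 : μ + 2 ∈ s := by
      intro hb
      have h2 : ⁅β.e k, v⁆ ∈ U ⊓ T.eigenspace (μ + 2) := by
        refine ⟨hUe k v hvU, mem_eigenspace_toEnd.mpr ?_⟩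
        rw [lie_eq_add_smul (p.lie_e k) hvT, add_comm]
      rw [hb] at h2
      exact hne ((Submodule.mem_bot ℂ).mp h2)
    have h2 : (μ + 2).re ≤ μ.re := hmax h1 (by simp)
    simp at h2
    linarith
  · exact congrArg Subtype.val (hv (β.h' k))

variable [LieModule.IsIrreducible ℂ 𝔤 M]

omit [FiniteDimensional ℂ M] in
/-- A lowest weight vector `w` generates an irreducible module from below. -/
theorem span_sup_eigenAbove_eq_top {h e f : 𝔤} (p : IsPrincipalTriple β h e f) {w : M}
    (hw : IsHighest β.symm w) {μ : ℂ} (hμ : ⁅h, w⁆ = μ • w) :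
    (ℂ ∙ w) ⊔ eigenAbove M h μ = ⊤ := by
  refine eq_top_of_lowest_le β (W := ℂ ∙ w) ?_ ?_ ?_ ?_ le_sup_left
  · rw [Ne, Submodule.span_singleton_eq_bot]; exact hw.ne_zero
  · intro i m hm
    obtain ⟨c, rfl⟩ := Submodule.mem_span_singleton.mp hm
    rw [lie_smul]
    have : ⁅β.f i, w⁆ = 0 := hw.e_eq_zero i
    rw [this, smul_zero]
  · intro i m hm
    obtain ⟨c, rfl⟩ := Submodule.mem_span_singleton.mp hm
    obtain ⟨d, hd⟩ := hw.h_smul i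
    have hd' : ⁅-β.h i, w⁆ = d • w := hd
    rw [neg_lie, neg_eq_iff_eq_neg] at hd'
    rw [lie_smul, hd']
    exact Submodule.smul_mem _ _ (Submodule.neg_mem _ (Submodule.smul_mem _ _
      (Submodule.mem_span_singleton_self w)))
  · intro i m hm
    obtain ⟨a, ha, b, hb, rfl⟩ := Submodule.mem_sup.mp hm
    rw [lie_add]
    refine Submodule.mem_sup_right (Submodule.add_mem _ ?_ ?_)
    · obtain ⟨c, rfl⟩ := Submodule.mem_span_singleton.mp ha
      rw [lie_smul]
      refine Submodule.smul_mem _ _ (mem_eigenAbove (c := 2) (by norm_num) ?_)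
      rw [lie_eq_add_smul (p.lie_e i) hμ, add_comm]
      norm_num
    · exact lie_mem_eigenAbove (a := 2) (by norm_num) (by rw [p.lie_e]; norm_num) hb

omit [FiniteDimensional ℂ M] in
/-- The vectors of an irreducible module that are killed by all `f_k` form a line. -/
theorem mem_span_of_f_eq_zero {h e f : 𝔤} (p : IsPrincipalTriple β h e f) {w : M}
    (hw : IsHighest β.symm w) {v : M} (hv : ∀ k, ⁅β.f k, v⁆ = 0) : v ∈ ℂ ∙ w := by
  obtain ⟨μ, hμ⟩ := hw.exists_smul p.symm.h_mem
  rw [neg_lie, neg_eq_iff_eq_neg, ← neg_smul] at hμ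
  have htop := span_sup_eigenAbove_eq_top β p hw hμ
  have hmem : v ∈ (ℂ ∙ w) ⊔ eigenAbove M h (-μ) := by rw [htop]; trivial
  obtain ⟨a, ha, b, hb, rfl⟩ := Submodule.mem_sup.mp hmem
  obtain ⟨c, rfl⟩ := Submodule.mem_span_singleton.mp ha
  suffices hb0 : b = 0 by rw [hb0, add_zero]; exact ha
  by_contra hb0
  have hfw : ∀ k, ⁅β.f k, w⁆ = 0 := hw.e_eq_zero
  -- The lowest weight vectors above the bottom eigenvalue would generate a proper submodule.
  let W : Submodule ℂ M :=
    (⨅ k, LinearMap.ker (toEnd ℂ 𝔤 M (β.f k))) ⊓ eigenAbove M h (-μ)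
  have hWf : ∀ i, ∀ m ∈ W, ⁅β.f i, m⁆ = 0 := fun i m hm => (Submodule.mem_iInf _).mp hm.1 i
  have hWtop : eigenAbove M h (-μ) = ⊤ := by
    refine eq_top_of_lowest_le β (W := W) ?_ hWf ?_ ?_ inf_le_right
    · intro hbot
      have h1 : b ∈ W := by
        refine ⟨(Submodule.mem_iInf _).mpr fun k => ?_, hb⟩
        have h2 := hv k
        rw [lie_add, lie_smul, hfw, smul_zero, zero_add] at h2
        exact h2
      rw [hbot] at h1
      exact hb0 ((Submodule.mem_bot ℂ).mp h1)
    · intro i m hm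
      refine ⟨(Submodule.mem_iInf _).mpr fun k => ?_, ?_⟩
      · change ⁅β.f k, ⁅β.h i, m⁆⁆ = 0
        rw [leibniz_lie, ← lie_skew, β.lie_h_f, hWf k m hm, lie_zero, add_zero, neg_lie, smul_lie,
          hWf k m hm, smul_zero, neg_zero]
      · exact lie_mem_eigenAbove (a := 0) le_rfl
          (by rw [p.lie_h_h]; simp) hm.2
    · intro i m hm
      exact lie_mem_eigenAbove (a := 2) (by norm_num) (by rw [p.lie_e]; norm_num) hm
  have h1 : w ∈ eigenAbove M h (-μ) := by rw [hWtop]; trivial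
  exact hw.ne_zero (eq_zero_of_mem_eigenAbove h1 hμ)

/-- Raising a lowest weight vector `w` by the highest non-vanishing power of the principal `e`
gives the highest weight line. -/
theorem exists_pow_principal {h e f : 𝔤} [FiniteDimensional ℂ 𝔤]
    (p : IsPrincipalTriple β h e f) {w : M} (hw : IsHighest β.symm w) :
    ∃ n : ℕ, (toEnd ℂ 𝔤 M e ^ n) w ≠ 0 ∧ (toEnd ℂ 𝔤 M e ^ (n + 1)) w = 0 ∧
      ∀ v : M, (∀ k, ⁅β.e k, v⁆ = 0) → v ∈ ℂ ∙ (toEnd ℂ 𝔤 M e ^ n) w := by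
  obtain ⟨v, -, hv⟩ := exists_isHighest_mem β p (⊤ : Submodule ℂ M)
    (by
      intro hb
      have h1 : w ∈ (⊤ : Submodule ℂ M) := trivial
      rw [hb] at h1
      exact hw.ne_zero ((Submodule.mem_bot ℂ).mp h1)) (fun _ _ _ => trivial) (fun _ _ _ => trivial)
  obtain ⟨ν, hν⟩ := hv.exists_smul p.h_mem
  obtain ⟨μ, hμ⟩ := hw.exists_smul p.symm.h_mem
  have hPv : IsSl2Triple.HasPrimitiveVectorWith p.sl2 v ν :=
    ⟨hv.ne_zero, hν, (Submodule.mem_bot ℂ).mp (lie_mem_of_mem_span (W := ⊥)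
      (by rintro _ ⟨k, rfl⟩; exact hv.e_eq_zero k) p.e_mem)⟩
  have hPw : IsSl2Triple.HasPrimitiveVectorWith p.sl2.symm w μ :=
    ⟨hw.ne_zero, hμ, (Submodule.mem_bot ℂ).mp (lie_mem_of_mem_span (W := ⊥)
      (by rintro _ ⟨k, rfl⟩; exact hw.e_eq_zero k) p.f_mem)⟩
  obtain ⟨N, hN⟩ := hPv.exists_nat
  obtain ⟨n, hn⟩ := hPw.exists_nat
  have htopw := span_sup_eigenAbove_eq_top β p hw (μ := -μ) (by
    rw [neg_lie, neg_eq_iff_eq_neg, ← neg_smul] at hμ; exact hμ)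
  have htopv := span_sup_eigenAbove_eq_top β.symm p.symm (w := v) (by simpa using hv) (μ := -ν)
    (by rw [neg_lie, hν, neg_smul])
  have hew := hPw.pow_toEnd_f_ne_zero_of_eq_nat (i := n) hn le_rfl
  have hfv := hPv.pow_toEnd_f_ne_zero_of_eq_nat (i := N) hN le_rfl
  have hew' := hPw.lie_h_pow_toEnd_f n
  have hfv' := hPv.lie_h_pow_toEnd_f N
  -- The eigenvalues of `h` lie above `-n` and below `N`, so the two `sl₂`-strings force `n = N`.
  obtain ⟨c, hc, hc'⟩ := exists_eq_add_of_mem (x := h) (W := ℂ ∙ w) (μ := -μ) (by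
      rw [Submodule.span_singleton_le_iff_mem]
      refine mem_eigenspace_toEnd.mpr ?_
      rw [neg_lie, neg_eq_iff_eq_neg, ← neg_smul] at hμ; exact hμ)
    (m := (toEnd ℂ 𝔤 M f ^ N) v) (by rw [htopw]; trivial) hfv hfv'
  obtain ⟨d, hd, hd'⟩ := exists_eq_add_of_mem (x := -h) (W := ℂ ∙ v) (μ := -ν) (by
      rw [Submodule.span_singleton_le_iff_mem]
      refine mem_eigenspace_toEnd.mpr ?_
      rw [neg_lie, hν, neg_smul])
    (m := (toEnd ℂ 𝔤 M e ^ n) w) (by rw [htopv]; trivial) hew hew'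
  have hNn : (N : ℝ) ≤ n := by
    rw [hN, hn] at hc'
    have h1 : (n : ℂ) - N = (c : ℂ) := by linear_combination hc'
    have h2 : (n : ℝ) - N = c := by exact_mod_cast h1
    linarith
  have hnN : (n : ℝ) ≤ N := by
    rw [hN, hn] at hd'
    have h1 : (N : ℂ) - n = (d : ℂ) := by linear_combination hd'
    have h2 : (N : ℝ) - n = d := by exact_mod_cast h1
    linarith
  have hnN' : n = N := by exact_mod_cast le_antisymm hnN hNn
  have hline : (toEnd ℂ 𝔤 M e ^ n) w ∈ ℂ ∙ v := by
    have hmem : (toEnd ℂ 𝔤 M e ^ n) w ∈ (ℂ ∙ v) ⊔ eigenAbove M (-h) (-ν) := by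
      rw [htopv]; trivial
    obtain ⟨a, ha, b, hb, hab⟩ := Submodule.mem_sup.mp hmem
    obtain ⟨c, rfl⟩ := Submodule.mem_span_singleton.mp ha
    have hb' : b = (toEnd ℂ 𝔤 M e ^ n) w - c • v := by rw [← hab]; abel
    have hb0 : b = 0 := by
      refine eq_zero_of_mem_eigenAbove hb ?_
      rw [hb', lie_sub, hew', lie_smul, neg_lie, hν, hN, hn, hnN']
      module
    rw [← hab, hb0, add_zero]
    exact ha
  refine ⟨n, hew, hPw.pow_toEnd_f_eq_zero_of_eq_nat hn, fun u hu => ?_⟩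
  have h1 : u ∈ ℂ ∙ v := mem_span_of_f_eq_zero β.symm p.symm (by simpa using hv) hu
  obtain ⟨c, hc⟩ := Submodule.mem_span_singleton.mp hline
  have hc0 : c ≠ 0 := by rintro rfl; rw [zero_smul] at hc; exact hew hc.symm
  obtain ⟨c', rfl⟩ := Submodule.mem_span_singleton.mp h1
  rw [← hc]
  refine Submodule.mem_span_singleton.mpr ⟨c' * c⁻¹, ?_⟩
  rw [smul_smul, mul_assoc, inv_mul_cancel₀ hc0, mul_one]

/-- A submodule of a tensor product of irreducible modules that contains the product of lowest
weight vectors also contains the product of highest weight vectors. -/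
theorem tmul_highest_mem [FiniteDimensional ℂ 𝔤] {M' : Type*} [AddCommGroup M'] [Module ℂ M']
    [LieRingModule 𝔤 M'] [LieModule ℂ 𝔤 M'] [FiniteDimensional ℂ M']
    [LieModule.IsIrreducible ℂ 𝔤 M'] {h e f : 𝔤} (p : IsPrincipalTriple β h e f)
    {w : M} (hw : IsHighest β.symm w) {w' : M'} (hw' : IsHighest β.symm w')
    (R : LieSubmodule ℂ 𝔤 (M ⊗[ℂ] M')) (hR : w ⊗ₜ[ℂ] w' ∈ R)
    {v : M} (hv : ∀ k, ⁅β.e k, v⁆ = 0) {v' : M'} (hv' : ∀ k, ⁅β.e k, v'⁆ = 0) :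
    v ⊗ₜ[ℂ] v' ∈ R := by
  obtain ⟨n, hn0, hn1, hn⟩ := exists_pow_principal β p hw
  obtain ⟨n', hn0', hn1', hn'⟩ := exists_pow_principal β p hw'
  set X : Module.End ℂ (M ⊗[ℂ] M') := LinearMap.rTensor M' (toEnd ℂ 𝔤 M e) with hX
  set Y : Module.End ℂ (M ⊗[ℂ] M') := LinearMap.lTensor M (toEnd ℂ 𝔤 M' e) with hY
  have hXY : toEnd ℂ 𝔤 (M ⊗[ℂ] M') e = X + Y := by
    ext a b
    simp [hX, hY, TensorProduct.LieModule.lie_tmul_right]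
  have hcomm : Commute X Y := by
    refine TensorProduct.ext' fun a b => ?_
    simp [hX, hY]
  have hXp : ∀ k a b, (X ^ k) (a ⊗ₜ[ℂ] b) = ((toEnd ℂ 𝔤 M e ^ k) a) ⊗ₜ[ℂ] b := by
    intro k a b
    induction k with
    | zero => rfl
    | succ k ih =>
      rw [pow_succ', Module.End.mul_apply, ih, pow_succ', Module.End.mul_apply, hX,
        LinearMap.rTensor_tmul]
  have hYp : ∀ k a b, (Y ^ k) (a ⊗ₜ[ℂ] b) = a ⊗ₜ[ℂ] ((toEnd ℂ 𝔤 M' e ^ k) b) := by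
    intro k a b
    induction k with
    | zero => rfl
    | succ k ih =>
      rw [pow_succ', Module.End.mul_apply, ih, pow_succ', Module.End.mul_apply, hY,
        LinearMap.lTensor_tmul]
  have hmem : ∀ k, (toEnd ℂ 𝔤 (M ⊗[ℂ] M') e ^ k) (w ⊗ₜ[ℂ] w') ∈ R := by
    intro k
    induction k with
    | zero => simpa using hR
    | succ k ih =>
      rw [pow_succ']
      exact R.lie_mem ih
  have hz : ∀ {m m' : ℕ} {a : Module.End ℂ M} {x : M}, (a ^ (m + 1)) x = 0 → m < m' →
      (a ^ m') x = 0 := by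
    intro m m' a x h0 hlt
    obtain ⟨d, rfl⟩ := Nat.exists_eq_add_of_le (Nat.succ_le_of_lt hlt)
    rw [show m.succ + d = d + (m + 1) by omega, pow_add, Module.End.mul_apply, h0, map_zero]
  have hz' : ∀ {m m' : ℕ} {a : Module.End ℂ M'} {x : M'}, (a ^ (m + 1)) x = 0 → m < m' →
      (a ^ m') x = 0 := by
    intro m m' a x h0 hlt
    obtain ⟨d, rfl⟩ := Nat.exists_eq_add_of_le (Nat.succ_le_of_lt hlt)
    rw [show m.succ + d = d + (m + 1) by omega, pow_add, Module.End.mul_apply, h0, map_zero]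
  have hmain : (toEnd ℂ 𝔤 (M ⊗[ℂ] M') e ^ (n + n')) (w ⊗ₜ[ℂ] w') =
      ((n + n').choose n : ℂ) •
        (((toEnd ℂ 𝔤 M e ^ n) w) ⊗ₜ[ℂ] ((toEnd ℂ 𝔤 M' e ^ n') w')) := by
    have hterm : ∀ m k : ℕ, (X ^ m * Y ^ (n + n' - m) * (k : Module.End ℂ (M ⊗[ℂ] M')))
        (w ⊗ₜ[ℂ] w') = (k : ℂ) •
          (((toEnd ℂ 𝔤 M e ^ m) w) ⊗ₜ[ℂ] ((toEnd ℂ 𝔤 M' e ^ (n + n' - m)) w')) := by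
      intro m k
      rw [← Nat.cast_comm, Module.End.mul_apply, Module.End.mul_apply, hYp, hXp,
        Module.End.natCast_apply, Nat.cast_smul_eq_nsmul]
    rw [hXY, hcomm.add_pow, LinearMap.sum_apply, Finset.sum_eq_single n]
    · rw [hterm, Nat.add_sub_cancel_left]
    · intro m hm hmn
      rw [hterm]
      rcases lt_or_gt_of_ne hmn with hlt | hlt
      · rw [hz' hn1' (by omega), TensorProduct.tmul_zero, smul_zero]
      · rw [hz hn1 hlt, TensorProduct.zero_tmul, smul_zero]
    · intro hm
      simp only [Finset.mem_range, not_lt] at hm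
      omega
  have h1 := hmem (n + n')
  rw [hmain] at h1
  have hch : ((n + n').choose n : ℂ) ≠ 0 := by
    exact_mod_cast (Nat.choose_pos (Nat.le_add_right n n')).ne'
  have h2 := R.smul_mem ((n + n').choose n : ℂ)⁻¹ h1
  rw [smul_smul, inv_mul_cancel₀ hch, one_smul] at h2
  obtain ⟨a, rfl⟩ := Submodule.mem_span_singleton.mp (hn v hv)
  obtain ⟨b, rfl⟩ := Submodule.mem_span_singleton.mp (hn' v' hv')
  rw [TensorProduct.smul_tmul_smul]
  exact R.smul_mem _ h2

end Extremal

/-! ### The Killing form and the triangular decomposition -/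

section Killing

open LieModule Module LieAlgebra

variable {𝔤 : Type*} [LieRing 𝔤] [LieAlgebra ℂ 𝔤] {ι : Type*} [Fintype ι]
  {H : LieSubalgebra ℂ 𝔤} (β : LieAlgebra.Basis ι H)

omit [Fintype ι] in
theorem zsmul_eq_intCast_smul {M : Type*} [AddCommGroup M] [Module ℂ M] (n : ℤ) (x : M) :
    n • x = (n : ℂ) • x :=
  (Int.cast_smul_eq_zsmul ℂ n x).symm

omit [Fintype ι] in
theorem killingForm_lie (x y z : 𝔤) : killingForm ℂ 𝔤 ⁅x, y⁆ z = killingForm ℂ 𝔤 x ⁅y, z⁆ :=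
  LieModule.traceForm_apply_lie_apply ℂ 𝔤 𝔤 x y z

omit [Fintype ι] in
theorem killingForm_comm (x y : 𝔤) : killingForm ℂ 𝔤 x y = killingForm ℂ 𝔤 y x :=
  LieModule.traceForm_comm ℂ 𝔤 𝔤 x y

theorem killingForm_h_h (k l : ι) :
    killingForm ℂ 𝔤 (β.h k) (β.h l) = β.A k l * killingForm ℂ 𝔤 (β.e k) (β.f k) := by
  rw [← (β.sl2 k).lie_e_f, killingForm_lie, ← lie_skew, β.lie_h_f, neg_smul, neg_neg,
    zsmul_eq_intCast_smul, map_smul, smul_eq_mul]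

theorem lie_sum_h_e (s : ι → ℂ) (k : ι) :
    ⁅∑ l, s l • β.h l, β.e k⁆ = (∑ l, β.A k l * s l) • β.e k := by
  rw [sum_lie, Finset.sum_smul]
  refine Finset.sum_congr rfl fun l _ => ?_
  rw [smul_lie, β.lie_h_e, zsmul_eq_intCast_smul, smul_smul, mul_comm]

omit [Fintype ι] in
theorem killingForm_eq_zero_of_eigen {h x y : 𝔤} {a b : ℂ} (hx : ⁅h, x⁆ = a • x)
    (hy : ⁅h, y⁆ = b • y) (hab : a + b ≠ 0) : killingForm ℂ 𝔤 x y = 0 := by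
  have h1 : killingForm ℂ 𝔤 ⁅x, h⁆ y = killingForm ℂ 𝔤 x ⁅h, y⁆ := killingForm_lie x h y
  rw [← lie_skew, hx, hy, map_neg, LinearMap.neg_apply, map_smul, LinearMap.smul_apply, map_smul,
    smul_eq_mul, smul_eq_mul] at h1
  have h2 : (a + b) * killingForm ℂ 𝔤 x y = 0 := by linear_combination -h1
  exact (mul_eq_zero.mp h2).resolve_left hab

omit [Fintype ι] in
theorem killingForm_eq_zero_of_above {h x y : 𝔤} {b : ℝ} (hb : 0 ≤ b)
    (hx : x ∈ eigenAbove 𝔤 h 0) (hy : ⁅h, y⁆ = (b : ℂ) • y) : killingForm ℂ 𝔤 x y = 0 := by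
  have : eigenAbove 𝔤 h 0 ≤ LinearMap.ker ((killingForm ℂ 𝔤).flip y) := by
    refine iSup₂_le fun c hc x hx => ?_
    rw [mem_eigenspace_toEnd, zero_add] at hx
    refine killingForm_eq_zero_of_eigen hx hy ?_
    have : c + b ≠ 0 := by linarith
    exact_mod_cast this
  exact this hx

omit [Fintype ι] in
theorem killingForm_eq_zero_of_above_above {h x y : 𝔤} (hx : x ∈ eigenAbove 𝔤 h 0)
    (hy : y ∈ eigenAbove 𝔤 h 0) : killingForm ℂ 𝔤 x y = 0 := by
  have : eigenAbove 𝔤 h 0 ≤ LinearMap.ker (killingForm ℂ 𝔤 x) := by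
    refine iSup₂_le fun c hc y hy => ?_
    rw [mem_eigenspace_toEnd, zero_add] at hy
    exact killingForm_eq_zero_of_above hc.le hx hy
  exact this hy

/-- The nilpotent subalgebra `𝔫₊` generated by the `e_k`; `𝔫₋` is `upper β.symm`. -/
def upper : LieSubalgebra ℂ 𝔤 := LieSubalgebra.lieSpan ℂ 𝔤 (Set.range β.e)

theorem lie_h_mem_upper (k : ι) {x : 𝔤} (hx : x ∈ upper β) : ⁅β.h k, x⁆ ∈ upper β :=
  β.borelUpper.lie_mem (x := β.h' k) hx

theorem lie_mem_upper_of_mem_span {t x : 𝔤} (ht : t ∈ Submodule.span ℂ (Set.range β.h))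
    (hx : x ∈ upper β) : ⁅t, x⁆ ∈ upper β := by
  have hs : ∀ y ∈ Set.range β.h, ⁅y, x⁆ ∈ (upper β).toSubmodule := by
    rintro _ ⟨k, rfl⟩
    exact lie_h_mem_upper β k hx
  exact lie_mem_of_mem_span hs ht

theorem exists_triangular (z : 𝔤) : ∃ a ∈ upper β.symm,
    ∃ b ∈ Submodule.span ℂ (Set.range β.h), ∃ c ∈ upper β, z = a + b + c := by
  have h1 : H.toLieSubmodule ⊔ β.borelLower ⊔ β.borelUpper = ⊤ := by
    simpa using β.iSup_cartan_borelLower_borelUpper_eq_top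
  have hz : z ∈ H.toLieSubmodule ⊔ β.borelLower ⊔ β.borelUpper := by rw [h1]; trivial
  obtain ⟨y, hy, c, hc, rfl⟩ := (LieSubmodule.mem_sup _ _ _).mp hz
  obtain ⟨b, hb, a, ha, rfl⟩ := (LieSubmodule.mem_sup _ _ _).mp hy
  refine ⟨a, ha, b, ?_, c, hc, by abel⟩
  rw [← β.coe_cartan_eq_span]
  exact hb

theorem upper_le_eigenAbove {x : 𝔤} (hx : ∀ k, ∃ c : ℝ, 0 < c ∧ ⁅x, β.e k⁆ = (c : ℂ) • β.e k)
    {u : 𝔤} (hu : u ∈ upper β) : u ∈ eigenAbove 𝔤 x 0 := by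
  induction hu using LieSubalgebra.lieSpan_induction with
  | mem u hu =>
    obtain ⟨k, rfl⟩ := hu
    obtain ⟨c, hc, hc'⟩ := hx k
    exact mem_eigenAbove hc (by rw [hc', zero_add])
  | zero => exact Submodule.zero_mem _
  | add u v _ _ hu hv => exact Submodule.add_mem _ hu hv
  | smul t u _ hu => exact Submodule.smul_mem _ t hu
  | lie u v _ _ hu hv => exact lie_mem_eigenAbove_zero hu hv

variable {β} in
theorem IsPrincipalTriple.upper_le {h e f : 𝔤} (p : IsPrincipalTriple β h e f) {u : 𝔤}
    (hu : u ∈ upper β) : u ∈ eigenAbove 𝔤 h 0 :=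
  upper_le_eigenAbove β (fun k => ⟨2, by norm_num, by rw [p.lie_e]; norm_num⟩) hu

variable {β} in
theorem IsPrincipalTriple.lie_span {h e f : 𝔤} (p : IsPrincipalTriple β h e f) {t : 𝔤}
    (ht : t ∈ Submodule.span ℂ (Set.range β.h)) : ⁅h, t⁆ = 0 := by
  have h1 : Submodule.span ℂ (Set.range β.h) ≤ LinearMap.ker (toEnd ℂ 𝔤 𝔤 h) := by
    refine Submodule.span_le.mpr ?_
    rintro _ ⟨k, rfl⟩
    exact p.lie_h_h k
  exact h1 ht

theorem lie_lie_eq_zero_of_span {t t' : 𝔤} (ht : t ∈ Submodule.span ℂ (Set.range β.h))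
    (ht' : t' ∈ Submodule.span ℂ (Set.range β.h)) : ⁅t, t'⁆ = 0 := by
  have h1 : Submodule.span ℂ (Set.range β.h) ≤ LinearMap.ker (toEnd ℂ 𝔤 𝔤 t) := by
    refine Submodule.span_le.mpr ?_
    rintro _ ⟨k, rfl⟩
    have h2 : Submodule.span ℂ (Set.range β.h) ≤
        LinearMap.ker ((toEnd ℂ 𝔤 𝔤 : 𝔤 →ₗ[ℂ] Module.End ℂ 𝔤).flip (β.h k)) := by
      refine Submodule.span_le.mpr ?_
      rintro _ ⟨l, rfl⟩
      exact β.lie_h_h l k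
    exact h2 ht
  exact h1 ht'

variable [FiniteDimensional ℂ 𝔤]

theorem cartanMatrix_nonpos {k l : ι} (hkl : k ≠ l) : β.A k l ≤ 0 := by
  have hP : IsSl2Triple.HasPrimitiveVectorWith (β.sl2 l).symm (β.e k) (-(β.A k l : ℂ)) :=
    ⟨(β.sl2 k).e_ne_zero, by rw [neg_lie, β.lie_h_e, neg_smul, zsmul_eq_intCast_smul],
      by rw [← lie_skew, β.lie_e_f_ne k l hkl, neg_zero]⟩
  obtain ⟨n, hn⟩ := hP.exists_nat
  have : -(β.A k l) = (n : ℤ) := by exact_mod_cast hn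
  omega

theorem lie_e_e_eq_zero {k l : ι} (hkl : k ≠ l) (h0 : β.A k l = 0) : ⁅β.e l, β.e k⁆ = 0 := by
  have hP : IsSl2Triple.HasPrimitiveVectorWith (β.sl2 l).symm (β.e k) (0 : ℂ) :=
    ⟨(β.sl2 k).e_ne_zero, by rw [neg_lie, β.lie_h_e, h0, zero_smul, neg_zero, zero_smul],
      by rw [← lie_skew, β.lie_e_f_ne k l hkl, neg_zero]⟩
  simpa using hP.pow_toEnd_f_eq_zero_of_eq_nat (n := 0) (by simp)

variable [LieAlgebra.IsSimple ℂ 𝔤]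

/-- The Dynkin diagram of a simple Lie algebra is connected: the generators attached to a union of
components commute with the others. -/
theorem eq_univ_of_adjacency_closed (S : Set ι) (hS : S.Nonempty)
    (hcl : ∀ k ∈ S, ∀ l, β.A k l ≠ 0 → l ∈ S) : S = Set.univ := by
  by_contra hne
  obtain ⟨j, hj⟩ := (Set.ne_univ_iff_exists_notMem S).mp hne
  have hA : ∀ k ∈ S, ∀ l, l ∉ S → β.A k l = 0 := fun k hk l hl => by
    by_contra h0
    exact hl (hcl k hk l h0)
  let N : LieSubalgebra ℂ 𝔤 := LieSubalgebra.lieSpan ℂ 𝔤 (β.e '' S ∪ β.f '' S)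
  have hcomm : ∀ x ∈ N, ∀ l, l ∉ S → ⁅β.e l, x⁆ = 0 ∧ ⁅β.f l, x⁆ = 0 := by
    intro x hx l hl
    induction hx using LieSubalgebra.lieSpan_induction with
    | mem u hu =>
      rcases hu with ⟨k, hk, rfl⟩ | ⟨k, hk, rfl⟩
      · have hkl : k ≠ l := fun h0 => hl (h0 ▸ hk)
        exact ⟨lie_e_e_eq_zero β hkl (hA k hk l hl),
          by rw [← lie_skew, β.lie_e_f_ne k l hkl, neg_zero]⟩
      · have hkl : k ≠ l := fun h0 => hl (h0 ▸ hk)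
        exact ⟨β.lie_e_f_ne l k hkl.symm, lie_e_e_eq_zero β.symm hkl (hA k hk l hl)⟩
    | zero => simp
    | add u v _ _ hu hv => simp [hu.1, hu.2, hv.1, hv.2]
    | smul t u _ hu => simp [hu.1, hu.2]
    | lie u v _ _ hu hv => simp [leibniz_lie, hu.1, hu.2, hv.1, hv.2]
  obtain ⟨k₀, hk₀⟩ := hS
  have hk₀N : β.e k₀ ∈ N := LieSubalgebra.subset_lieSpan (Or.inl ⟨k₀, hk₀, rfl⟩)
  have htop : N.toSubmodule = ⊤ := by
    refine eq_top_of_generators_stable β _ ?_ ?_ ?_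
    · intro hb
      have : β.e k₀ ∈ N.toSubmodule := hk₀N
      rw [hb] at this
      exact (β.sl2 k₀).e_ne_zero ((Submodule.mem_bot ℂ).mp this)
    · intro i m hm
      by_cases hi : i ∈ S
      · exact N.lie_mem (LieSubalgebra.subset_lieSpan (Or.inl ⟨i, hi, rfl⟩)) hm
      · rw [(hcomm m hm i hi).1]; exact N.zero_mem
    · intro i m hm
      by_cases hi : i ∈ S
      · exact N.lie_mem (LieSubalgebra.subset_lieSpan (Or.inr ⟨i, hi, rfl⟩)) hm
      · rw [(hcomm m hm i hi).2]; exact N.zero_mem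
  have hjN : β.f j ∈ N.toSubmodule := by rw [htop]; trivial
  have h1 := (hcomm _ hjN j hj).1
  rw [(β.sl2 j).lie_e_f] at h1
  exact (β.sl2 j).h_ne_zero h1

/-- The Gram matrix of the simple coroots for the Killing form, a positive definite
symmetrization of the Cartan matrix. -/
theorem exists_isCartanPair :
    ∃ G : Matrix ι ι ℤ, IsCartanPair β.A G ∧
      ∀ k l, killingForm ℂ 𝔤 (β.h k) (β.h l) = G k l := by
  classical
  have := β.isCartanSubalgebra
  have hint : ∀ (χ : Weight ℂ H 𝔤) (k : ι), ∃ n : ℤ, χ (β.h' k) = n := by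
    intro χ k
    rw [← β.coroot_eq_h' k]
    exact ⟨_, LieAlgebra.IsKilling.apply_coroot_eq_cast (β.baseSupportEquiv k).1.1 χ⟩
  choose n hn using hint
  set G : Matrix ι ι ℤ := Matrix.of fun k l =>
    ∑ χ : Weight ℂ H 𝔤, (finrank ℂ (genWeightSpace 𝔤 χ) : ℤ) * (n χ k * n χ l) with hG
  have hGκ : ∀ k l, killingForm ℂ 𝔤 (β.h k) (β.h l) = G k l := by
    intro k l
    have h1 : killingForm ℂ 𝔤 (β.h k) (β.h l) = traceForm ℂ H 𝔤 (β.h' k) (β.h' l) := rfl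
    rw [h1, traceForm_eq_sum_finrank_nsmul_mul]
    simp [hG, hn]
  refine ⟨G, ⟨?_, ?_, ?_, fun k l => cartanMatrix_nonpos β, eq_univ_of_adjacency_closed β⟩, hGκ⟩
  · intro k l
    simp only [hG, Matrix.of_apply]
    exact Finset.sum_congr rfl fun χ _ => by ring
  · intro x hx
    have hsq : ∑ k, ∑ l, x k * G k l * x l = ∑ χ : Weight ℂ H 𝔤,
        (finrank ℂ (genWeightSpace 𝔤 χ) : ℚ) * (∑ k, n χ k * x k) ^ 2 := by
      have h1 : ∀ χ : Weight ℂ H 𝔤, (finrank ℂ (genWeightSpace 𝔤 χ) : ℚ) * (∑ k, n χ k * x k) ^ 2 =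
          ∑ k, ∑ l, x k * ((finrank ℂ (genWeightSpace 𝔤 χ) : ℚ) * (n χ k * n χ l)) * x l := by
        intro χ
        rw [sq, Finset.sum_mul_sum, Finset.mul_sum]
        refine Finset.sum_congr rfl fun k _ => ?_
        rw [Finset.mul_sum]
        exact Finset.sum_congr rfl fun l _ => by ring
      simp only [h1]
      refine Eq.trans (Finset.sum_congr rfl fun k _ => ?_) Finset.sum_comm
      refine Eq.trans ?_ Finset.sum_comm
      refine Finset.sum_congr rfl fun l _ => ?_
      rw [← Finset.sum_mul, ← Finset.mul_sum]
      simp [hG]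
    rw [hsq]
    have hpos : ∀ χ : Weight ℂ H 𝔤, 0 < (finrank ℂ (genWeightSpace 𝔤 χ) : ℚ) := by
      intro χ
      have : Nontrivial (genWeightSpace 𝔤 χ) :=
        (LieSubmodule.nontrivial_iff_ne_bot ℂ H 𝔤).mpr χ.genWeightSpace_ne_bot
      exact_mod_cast finrank_pos
    refine lt_of_le_of_ne (Finset.sum_nonneg fun χ _ => mul_nonneg (hpos χ).le (sq_nonneg _)) ?_
    intro h0
    have h1 := (Finset.sum_eq_zero_iff_of_nonneg
      (fun χ _ => mul_nonneg (hpos χ).le (sq_nonneg _))).mp h0.symm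
    have h2 : ∀ j, ∑ k, (β.A j k : ℚ) * x k = 0 := by
      intro j
      have h3 := h1 (β.baseSupp' j).1 (Finset.mem_univ _)
      have h4 := pow_eq_zero_iff (two_ne_zero) |>.mp
        ((mul_eq_zero.mp h3).resolve_left (hpos _).ne')
      rw [← h4]
      refine Finset.sum_congr rfl fun k _ => ?_
      have h5 : (β.A j k : ℂ) = n (β.baseSupp' j).1 k := by
        rw [← hn]
        exact (β.baseSupp_apply_h' j k).symm
      have h6 : β.A j k = n (β.baseSupp' j).1 k := by exact_mod_cast h5
      rw [h6]
    have hdet : (β.A.map (Int.cast : ℤ → ℚ)).det ≠ 0 := by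
      have h1 := β.nondegen.det_ne_zero
      have h2 : (β.A.map (Int.cast : ℤ → ℚ)).det = ((β.A.det : ℤ) : ℚ) :=
        ((Int.castRingHom ℚ).map_det β.A).symm
      rw [h2]
      exact_mod_cast h1
    exact hx (Matrix.eq_zero_of_mulVec_eq_zero hdet (funext h2))
  · intro k l
    have h1 := killingForm_h_h β k l
    have h2 := killingForm_h_h β k k
    have hd : (β.A k k : ℂ) = 2 := by
      have := IsAddTorsionFree.of_isTorsionFree ℂ 𝔤
      have := β.A_diag_eq_two k
      exact_mod_cast this
    rw [hGκ] at h1 h2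
    rw [hd] at h2
    have : (2 : ℂ) * G k l = G k k * β.A k l := by
      rw [h1, h2]; ring
    exact_mod_cast this

end Killing

/-! ### Traces over the space `𝔤 e₀` -/

section Trace

open LieModule Module LieAlgebra

variable {𝔤 : Type*} [LieRing 𝔤] [LieAlgebra ℂ 𝔤] {ι : Type*} [Fintype ι]
  {H : LieSubalgebra ℂ 𝔤} (β : LieAlgebra.Basis ι H)

omit [Fintype ι] in
theorem trace_smulRight' {M : Type*} [AddCommGroup M] [Module ℂ M] [FiniteDimensional ℂ M]
    (φ : M →ₗ[ℂ] ℂ) (v : M) : LinearMap.trace ℂ M (φ.smulRight v) = φ v := by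
  have h1 : φ.smulRight v = LinearMap.toSpanSingleton ℂ M v ∘ₗ φ := by ext; simp
  rw [h1, LinearMap.trace_comp_comm']
  have h2 : φ ∘ₗ LinearMap.toSpanSingleton ℂ M v = (φ v) • (LinearMap.id : ℂ →ₗ[ℂ] ℂ) := by
    ext; simp
  rw [h2]
  simp

omit [Fintype ι] in
theorem trace_toEnd_lie {L M : Type*} [LieRing L] [LieAlgebra ℂ L] [AddCommGroup M] [Module ℂ M]
    [LieRingModule L M] [LieModule ℂ L M] (x y : L) :
    LinearMap.trace ℂ M (toEnd ℂ L M ⁅x, y⁆) = 0 := by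
  have h1 : toEnd ℂ L M ⁅x, y⁆ = ⁅toEnd ℂ L M x, toEnd ℂ L M y⁆ := by
    ext m
    rw [Ring.lie_def]
    exact lie_lie x y m
  rw [h1, LinearMap.trace_lie]

/-- If `f` intertwines `T` with `S` and `T` maps the kernel of the surjective map `f` into `L`, then
`tr T = tr S + tr_L T`. -/
theorem trace_eq_add_trace_restrict {M N : Type*} [AddCommGroup M] [Module ℂ M]
    [FiniteDimensional ℂ M] [AddCommGroup N] [Module ℂ N] [FiniteDimensional ℂ N]
    (f : M →ₗ[ℂ] N) (hf : Function.Surjective f) (T : Module.End ℂ M) (S : Module.End ℂ N)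
    (hTS : f ∘ₗ T = S ∘ₗ f) (L : Submodule ℂ M) (hL : L ≤ LinearMap.ker f)
    (hT : ∀ x ∈ LinearMap.ker f, T x ∈ L) :
    LinearMap.trace ℂ M T =
      LinearMap.trace ℂ N S + LinearMap.trace ℂ L (T.restrict fun x hx => hT x (hL hx)) := by
  obtain ⟨s, hs⟩ := f.exists_rightInverse_of_surjective (LinearMap.range_eq_top.mpr hf)
  have h1 : LinearMap.trace ℂ N S = LinearMap.trace ℂ M (T ∘ₗ (s ∘ₗ f)) := by
    rw [← LinearMap.comp_assoc, LinearMap.trace_comp_comm', ← LinearMap.comp_assoc, hTS,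
      LinearMap.comp_assoc, hs, LinearMap.comp_id]
  have hfs : ∀ x, f (s x) = x := fun x => congrArg (fun g => g x) hs
  have h2 : ∀ x, (T - T ∘ₗ (s ∘ₗ f)) x ∈ L := by
    intro x
    have : (T - T ∘ₗ (s ∘ₗ f)) x = T (x - s (f x)) := by simp
    rw [this]
    refine hT _ ?_
    rw [LinearMap.mem_ker, map_sub, hfs, sub_self]
  have h3 := LinearMap.trace_restrict_eq_of_forall_mem L _ h2
  have h4 : (T - T ∘ₗ (s ∘ₗ f)).restrict (fun x (_ : x ∈ L) => h2 x) =
      T.restrict fun x hx => hT x (hL hx) := by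
    ext ⟨x, hx⟩
    have : f x = 0 := hL hx
    simp [this]
  rw [h1, ← h4, h3, map_sub]
  ring

theorem lie_f_e_mem {k : ι} {u : 𝔤} (hu : u ∈ upper β) :
    ⁅β.f k, u⁆ ∈ (upper β).toSubmodule ⊔ ℂ ∙ β.h k := by
  have hlie : ∀ x ∈ (upper β).toSubmodule ⊔ ℂ ∙ β.h k, ∀ v ∈ upper β, ⁅x, v⁆ ∈ upper β := by
    intro x hx v hv
    obtain ⟨a, ha, b, hb, rfl⟩ := Submodule.mem_sup.mp hx
    obtain ⟨c, rfl⟩ := Submodule.mem_span_singleton.mp hb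
    rw [add_lie, smul_lie]
    exact add_mem ((upper β).lie_mem ha hv) ((upper β).smul_mem c (lie_h_mem_upper β k hv))
  induction hu using LieSubalgebra.lieSpan_induction with
  | mem u hu =>
    obtain ⟨l, rfl⟩ := hu
    rw [← lie_skew]
    refine Submodule.neg_mem _ ?_
    rcases eq_or_ne l k with rfl | hlk
    · rw [(β.sl2 l).lie_e_f]
      exact Submodule.mem_sup_right (Submodule.mem_span_singleton_self _)
    · rw [β.lie_e_f_ne l k hlk]
      exact Submodule.zero_mem _
  | zero => rw [lie_zero]; exact Submodule.zero_mem _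
  | add u v _ _ hu hv => rw [lie_add]; exact Submodule.add_mem _ hu hv
  | smul t u _ hu => rw [lie_smul]; exact Submodule.smul_mem _ t hu
  | lie u v hu' hv' hu hv =>
    rw [leibniz_lie, ← lie_skew u]
    exact Submodule.mem_sup_left (add_mem (hlie _ hu v hv') (neg_mem (hlie _ hv u hu')))

theorem trace_sum_h [FiniteDimensional ℂ 𝔤] (s : ι → ℂ) :
    LinearMap.trace ℂ 𝔤 (toEnd ℂ 𝔤 𝔤 (∑ l, s l • β.h l)) = 0 := by
  rw [map_sum, map_sum]
  refine Finset.sum_eq_zero fun l _ => ?_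
  rw [map_smul, map_smul, ← (β.sl2 l).lie_e_f, trace_toEnd_lie, smul_zero]

variable [FiniteDimensional ℂ 𝔤] [LieAlgebra.IsSimple ℂ 𝔤]

theorem killingForm_e_f_ne_zero (k : ι) : killingForm ℂ 𝔤 (β.e k) (β.f k) ≠ 0 := by
  obtain ⟨G, hG, hκ⟩ := exists_isCartanPair β
  intro h0
  have h1 := killingForm_h_h β k k
  rw [h0, mul_zero, hκ] at h1
  have := hG.diag_pos k
  have h2 : G k k = 0 := by exact_mod_cast h1
  omega

/-- The simple coroot `h_k` has trace `2` on the nilpotent subalgebra `𝔫₊`: its trace vanishes on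
the span of `𝔫₊`, `h_k` and `f_k`, being that of the commutator of `e_k` with `f_k`. -/
theorem trace_h_upper [DecidableEq ι] (k : ι) :
    LinearMap.trace ℂ (upper β).toSubmodule
      ((toEnd ℂ 𝔤 𝔤 (β.h k)).restrict fun _ hx => lie_h_mem_upper β k hx) = 2 := by
  have := LieModule.nontrivial_of_isIrreducible ℂ 𝔤 𝔤
  obtain ⟨h, e, f, p⟩ := exists_isPrincipalTriple β
  let n : Submodule ℂ 𝔤 := (upper β).toSubmodule
  let P : Submodule ℂ 𝔤 := n ⊔ ℂ ∙ β.h k ⊔ ℂ ∙ β.f k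
  have hnP : n ≤ P := le_sup_left.trans le_sup_left
  have hfP : β.f k ∈ P := Submodule.mem_sup_right (Submodule.mem_span_singleton_self _)
  have hhP : β.h k ∈ P :=
    Submodule.mem_sup_left (Submodule.mem_sup_right (Submodule.mem_span_singleton_self _))
  have hek : β.e k ∈ n := LieSubalgebra.subset_lieSpan ⟨k, rfl⟩
  have hcases : ∀ Q : Submodule ℂ 𝔤, ∀ T : Module.End ℂ 𝔤, (∀ x ∈ n, T x ∈ Q) →
      T (β.h k) ∈ Q → T (β.f k) ∈ Q → ∀ x ∈ P, T x ∈ Q := by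
    intro Q T h1 h2 h3 x hx
    have : P ≤ Q.comap T := by
      refine sup_le (sup_le h1 ?_) ?_
      · rw [Submodule.span_singleton_le_iff_mem]; exact h2
      · rw [Submodule.span_singleton_le_iff_mem]; exact h3
    exact this hx
  have hE : ∀ x ∈ P, toEnd ℂ 𝔤 𝔤 (β.e k) x ∈ P := by
    refine hcases P _ (fun x hx => hnP ((upper β).lie_mem hek hx)) ?_ ?_
    · rw [toEnd_apply_apply, ← lie_skew, β.lie_h_e]
      exact Submodule.neg_mem _ (zsmul_mem (hnP hek) _)
    · rw [toEnd_apply_apply, (β.sl2 k).lie_e_f]; exact hhP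
  have hF : ∀ x ∈ P, toEnd ℂ 𝔤 𝔤 (β.f k) x ∈ P := by
    refine hcases P _ (fun x hx => ?_) ?_ ?_
    · exact Submodule.mem_sup_left (lie_f_e_mem β hx)
    · rw [toEnd_apply_apply, ← lie_skew, β.lie_h_f, neg_smul, neg_neg]
      exact zsmul_mem hfP _
    · rw [toEnd_apply_apply, lie_self]; exact Submodule.zero_mem _
  have hH : ∀ x ∈ P, toEnd ℂ 𝔤 𝔤 (β.h k) x ∈ P := by
    refine hcases P _ (fun x hx => hnP (lie_h_mem_upper β k hx)) ?_ ?_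
    · rw [toEnd_apply_apply, lie_self]; exact Submodule.zero_mem _
    · rw [toEnd_apply_apply, β.lie_h_f]; exact zsmul_mem hfP _
  have htr : LinearMap.trace ℂ P ((toEnd ℂ 𝔤 𝔤 (β.h k)).restrict hH) = 0 := by
    have h1 : (toEnd ℂ 𝔤 𝔤 (β.h k)).restrict hH =
        ⁅(toEnd ℂ 𝔤 𝔤 (β.e k)).restrict hE, (toEnd ℂ 𝔤 𝔤 (β.f k)).restrict hF⁆ := by
      ext ⟨x, hx⟩
      rw [Ring.lie_def]
      change ⁅β.h k, x⁆ = ⁅β.e k, ⁅β.f k, x⁆⁆ - ⁅β.f k, ⁅β.e k, x⁆⁆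
      rw [← (β.sl2 k).lie_e_f, lie_lie]
    rw [h1, LinearMap.trace_lie]
  -- Correct `ad h_k` by a rank one map of trace `2`, so that the image of `P` lies in `𝔫₊`.
  let φ : 𝔤 →ₗ[ℂ] ℂ := (killingForm ℂ 𝔤 (β.e k) (β.f k))⁻¹ • killingForm ℂ 𝔤 (β.e k)
  have hκ := killingForm_e_f_ne_zero β k
  have hφf : φ (β.f k) = 1 := by simp [φ, hκ]
  have hea : β.e k ∈ eigenAbove 𝔤 h 0 := p.upper_le hek
  have hφn : ∀ x ∈ n, φ x = 0 := fun x hx => by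
    simp [φ, killingForm_eq_zero_of_above_above hea (p.upper_le hx)]
  have hφh : φ (β.h k) = 0 := by
    have := killingForm_eq_zero_of_above (b := 0) le_rfl hea
      (by rw [p.lie_h_h, Complex.ofReal_zero, zero_smul] : ⁅h, β.h k⁆ = _)
    simp [φ, this]
  let T' : Module.End ℂ 𝔤 := toEnd ℂ 𝔤 𝔤 (β.h k) + (2 : ℂ) • φ.smulRight (β.f k)
  have hT' : ∀ x ∈ P, T' x ∈ n := by
    refine hcases n T' (fun x hx => ?_) ?_ ?_
    · have : T' x = ⁅β.h k, x⁆ := by simp [T', hφn x hx]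
      rw [this]
      exact lie_h_mem_upper β k hx
    · have : T' (β.h k) = 0 := by simp [T', hφh]
      rw [this]; exact n.zero_mem
    · have : T' (β.f k) = 0 := by
        have h2 : ⁅β.h k, β.f k⁆ = -((2 : ℂ) • β.f k) := by
          rw [(β.sl2 k).lie_h_f_nsmul, two_smul, two_smul]
        simp [T', hφf, h2]
      rw [this]; exact n.zero_mem
  have hT'P : ∀ x ∈ P, T' x ∈ P := fun x hx => hnP (hT' x hx)
  have h1 : T'.restrict hT'P = (toEnd ℂ 𝔤 𝔤 (β.h k)).restrict hH +
      (2 : ℂ) • (φ ∘ₗ P.subtype).smulRight (⟨β.f k, hfP⟩ : P) := by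
    ext ⟨x, hx⟩
    simp [T']
  have h2 : LinearMap.trace ℂ P (T'.restrict hT'P) = 2 := by
    rw [h1, map_add, htr, map_smul, trace_smulRight']
    simp [hφf]
  -- Compare the trace on `P` with that on its subspace `𝔫₊`.
  let n' : Submodule ℂ P := n.comap P.subtype
  have h3 := LinearMap.trace_restrict_eq_of_forall_mem n' (T'.restrict hT'P)
    (fun x => hT' x.1 x.2)
  rw [h2] at h3
  let E : n' ≃ₗ[ℂ] n := Submodule.comapSubtypeEquivOfLe hnP
  rw [← h3, ← LinearMap.trace_conj' _ E]
  congr 1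
  refine LinearMap.ext fun x => Subtype.ext ?_
  change ⁅β.h k, (x : 𝔤)⁆ = T' x.1
  simp [T', hφn x.1 x.2]

end Trace

section Orbit

theorem sum_eq_add_add_sum_erase {ι M : Type*} [Fintype ι] [DecidableEq ι] [AddCommGroup M]
    {i j : ι} (hij : i ≠ j) (F : ι → M) :
    ∑ k, F k = F i + F j + ∑ k ∈ (Finset.univ.erase i).erase j, F k := by
  rw [← Finset.add_sum_erase _ _ (Finset.mem_univ i),
    ← Finset.add_sum_erase (Finset.univ.erase i) _
      (Finset.mem_erase.mpr ⟨hij.symm, Finset.mem_univ j⟩), add_assoc]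

open LieModule Module LieAlgebra

variable {𝔤 : Type*} [LieRing 𝔤] [LieAlgebra ℂ 𝔤]
variable {V : Type*} [AddCommGroup V] [Module ℂ V] [LieRingModule 𝔤 V] [LieModule ℂ 𝔤 V]

variable (𝔤) in
/-- The stabilizer of the line `ℂ e₀`. -/
def lineStabilizer (e₀ : V) : LieSubalgebra ℂ 𝔤 where
  carrier := {z | ∃ c : ℂ, ⁅z, e₀⁆ = c • e₀}
  add_mem' := by
    rintro x y ⟨c, hc⟩ ⟨d, hd⟩
    exact ⟨c + d, by rw [add_lie, hc, hd, add_smul]⟩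
  zero_mem' := ⟨0, by simp⟩
  smul_mem' := by
    rintro t x ⟨c, hc⟩
    exact ⟨t * c, by rw [smul_lie, hc, smul_smul]⟩
  lie_mem' := by
    rintro x y ⟨c, hc⟩ ⟨d, hd⟩
    exact ⟨0, by rw [lie_lie, hd, hc, lie_smul, lie_smul, hc, hd, smul_comm, sub_self, zero_smul]⟩

variable (𝔤) in
/-- The evaluation `y ↦ y e₀`. -/
def evalAt (e₀ : V) : 𝔤 →ₗ[ℂ] V := (toEnd ℂ 𝔤 V : 𝔤 →ₗ[ℂ] Module.End ℂ V).flip e₀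

@[simp]
theorem evalAt_apply (e₀ : V) (y : 𝔤) : evalAt 𝔤 e₀ y = ⁅y, e₀⁆ := rfl

variable (𝔤) in
/-- The space `𝔤 e₀`, as a module over the stabilizer of the line `ℂ e₀`. -/
def orbitSpace (e₀ : V) : LieSubmodule ℂ (lineStabilizer 𝔤 e₀) V :=
  { LinearMap.range (evalAt 𝔤 e₀) with
    lie_mem := by
      rintro ⟨z, c, hc⟩ _ ⟨y, rfl⟩
      refine ⟨⁅z, y⁆ + c • y, ?_⟩
      change ⁅⁅z, y⁆ + c • y, e₀⁆ = ⁅z, ⁅y, e₀⁆⁆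
      rw [leibniz_lie, hc, add_lie, smul_lie, lie_smul] }

variable (𝔤) in
/-- The elements of the stabilizer of the line `ℂ e₀` that have trace zero on `𝔤 e₀`. -/
noncomputable def traceKer (e₀ : V) : Submodule ℂ 𝔤 :=
  (LinearMap.ker (LinearMap.trace ℂ (orbitSpace 𝔤 e₀) ∘ₗ
    (toEnd ℂ (lineStabilizer 𝔤 e₀) (orbitSpace 𝔤 e₀) :
      lineStabilizer 𝔤 e₀ →ₗ[ℂ] Module.End ℂ (orbitSpace 𝔤 e₀)))).map
    (lineStabilizer 𝔤 e₀).toSubmodule.subtype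

theorem mem_lineStabilizer_of_mem_traceKer {e₀ : V} {z : 𝔤} (hz : z ∈ traceKer 𝔤 e₀) :
    z ∈ lineStabilizer 𝔤 e₀ := by
  obtain ⟨z, -, rfl⟩ := hz
  exact z.2

theorem lie_mem_traceKer {e₀ : V} {x y : 𝔤} (hx : x ∈ lineStabilizer 𝔤 e₀)
    (hy : y ∈ lineStabilizer 𝔤 e₀) : ⁅x, y⁆ ∈ traceKer 𝔤 e₀ :=
  ⟨⁅⟨x, hx⟩, ⟨y, hy⟩⁆, LinearMap.mem_ker.mpr (trace_toEnd_lie _ _), rfl⟩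

theorem mem_traceKer_iff {e₀ : V} {z : 𝔤} (hz : z ∈ lineStabilizer 𝔤 e₀) :
    z ∈ traceKer 𝔤 e₀ ↔ LinearMap.trace ℂ (orbitSpace 𝔤 e₀)
      (toEnd ℂ (lineStabilizer 𝔤 e₀) (orbitSpace 𝔤 e₀) ⟨z, hz⟩) = 0 := by
  constructor
  · rintro ⟨z', hz', rfl⟩
    exact hz'
  · intro h
    exact ⟨⟨z, hz⟩, h, rfl⟩

variable {ι : Type*} [Fintype ι] {H : LieSubalgebra ℂ 𝔤} {β : LieAlgebra.Basis ι H}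

theorem f_mem_traceKer {e₀ : V} (he₀ : IsHighest β.symm e₀) (k : ι) :
    β.f k ∈ traceKer 𝔤 e₀ := by
  have hf : β.f k ∈ lineStabilizer 𝔤 e₀ := ⟨0, by rw [zero_smul]; exact he₀.e_eq_zero k⟩
  have hh : β.h k ∈ lineStabilizer 𝔤 e₀ := by
    obtain ⟨c, hc⟩ := he₀.h_smul k
    refine ⟨-c, ?_⟩
    have : ⁅-β.h k, e₀⁆ = c • e₀ := hc
    rw [neg_smul, ← this, neg_lie, neg_neg]
  have h1 : β.f k = (-(1 / 2 : ℂ)) • ⁅β.h k, β.f k⁆ := by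
    rw [(β.sl2 k).lie_h_f_nsmul]
    module
  rw [h1]
  exact Submodule.smul_mem _ _ (lie_mem_traceKer hh hf)

theorem lower_le_traceKer {e₀ : V} (he₀ : IsHighest β.symm e₀) {z : 𝔤} (hz : z ∈ upper β.symm) :
    z ∈ traceKer 𝔤 e₀ := by
  induction hz using LieSubalgebra.lieSpan_induction with
  | mem u hu =>
    obtain ⟨k, rfl⟩ := hu
    exact f_mem_traceKer he₀ k
  | zero => exact Submodule.zero_mem _
  | add u v _ _ hu hv => exact Submodule.add_mem _ hu hv
  | smul t u _ hu => exact Submodule.smul_mem _ t hu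
  | lie u v _ _ hu hv =>
    exact lie_mem_traceKer (mem_lineStabilizer_of_mem_traceKer hu)
      (mem_lineStabilizer_of_mem_traceKer hv)

theorem lower_lie_eq_zero {e₀ : V} (he₀ : IsHighest β.symm e₀) {z : 𝔤} (hz : z ∈ upper β.symm) :
    ⁅z, e₀⁆ = 0 := by
  induction hz using LieSubalgebra.lieSpan_induction with
  | mem u hu =>
    obtain ⟨k, rfl⟩ := hu
    exact he₀.e_eq_zero k
  | zero => exact zero_lie _
  | add u v _ _ hu hv => rw [add_lie, hu, hv, add_zero]
  | smul t u _ hu => rw [smul_lie, hu, smul_zero]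
  | lie u v _ _ hu hv => rw [lie_lie, hu, hv, lie_zero, lie_zero, sub_zero]

/-- The annihilator of a lowest weight vector is compatible with the triangular decomposition. -/
theorem exists_triangular_of_lie_eq_zero {h e f : 𝔤} (p : IsPrincipalTriple β h e f) {e₀ : V}
    (he₀ : IsHighest β.symm e₀) {z : 𝔤} (hz : ⁅z, e₀⁆ = 0) :
    ∃ a ∈ upper β.symm, ∃ t : ι → ℂ, ∃ c ∈ upper β, z = a + ∑ k, t k • β.h k + c ∧
      ⁅a, e₀⁆ = 0 ∧ ⁅∑ k, t k • β.h k, e₀⁆ = 0 ∧ ⁅c, e₀⁆ = 0 := by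
  obtain ⟨a, ha, b, hb, c, hc, rfl⟩ := exists_triangular β z
  obtain ⟨t, rfl⟩ := (Submodule.mem_span_range_iff_exists_fun ℂ).mp hb
  have ha0 := lower_lie_eq_zero he₀ ha
  have hspan : Submodule.span ℂ (Set.range β.h) ≤ Submodule.span ℂ (Set.range β.symm.h) := by
    refine Submodule.span_le.mpr ?_
    rintro _ ⟨k, rfl⟩
    have h2 : -(β.symm.h k) ∈ Submodule.span ℂ (Set.range β.symm.h) :=
      Submodule.neg_mem _ (Submodule.subset_span ⟨k, rfl⟩)
    simpa using h2
  obtain ⟨s, hs⟩ := he₀.exists_smul (hspan hb)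
  obtain ⟨μ, hμ⟩ := he₀.exists_smul (hspan p.h_mem)
  rw [add_lie, add_lie, ha0, zero_add, hs] at hz
  have hc' : ⁅c, e₀⁆ = -(s • e₀) := (neg_eq_of_add_eq_zero_right hz).symm
  have hc0 : ⁅c, e₀⁆ = 0 := by
    refine eq_zero_of_mem_eigenAbove (lie_mem_eigenAbove_of_mem (p.upper_le hc) hμ) ?_
    rw [hc', lie_neg, lie_smul, hμ, smul_neg, smul_comm]
  exact ⟨a, ha, t, c, hc, rfl, ha0, by rw [hs, ← neg_eq_zero, ← hc', hc0], hc0⟩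

variable [FiniteDimensional ℂ 𝔤]

/-- Elements of `𝔫₊` that kill `e₀` are commutators `[h, u]` with `u` of the same kind. -/
theorem upper_mem_traceKer {h e f : 𝔤} (p : IsPrincipalTriple β h e f) {e₀ : V}
    (he₀ : IsHighest β.symm e₀) {z : 𝔤} (hz : z ∈ upper β) (hz0 : ⁅z, e₀⁆ = 0) :
    z ∈ traceKer 𝔤 e₀ := by
  obtain ⟨μ, hμ⟩ := he₀.exists_smul p.symm.h_mem
  have hμ' : ⁅h, e₀⁆ = (-μ) • e₀ := by rw [neg_smul, ← hμ, neg_lie, neg_neg]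
  let U : Submodule ℂ 𝔤 := (upper β).toSubmodule ⊓ LinearMap.ker (evalAt 𝔤 e₀)
  have hU : ∀ u ∈ U, toEnd ℂ 𝔤 𝔤 h u ∈ U := by
    rintro u ⟨hu, hu0⟩
    have hu0' : ⁅u, e₀⁆ = 0 := hu0
    refine ⟨lie_mem_upper_of_mem_span β p.h_mem hu, ?_⟩
    change ⁅⁅h, u⁆, e₀⁆ = 0
    rw [lie_lie, hu0', hμ', lie_smul, hu0', lie_zero, smul_zero, sub_zero]
  have hinj : Function.Injective ((toEnd ℂ 𝔤 𝔤 h).restrict hU) := by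
    refine (injective_iff_map_eq_zero _).mpr ?_
    rintro ⟨u, hu⟩ hu'
    have h1 : ⁅h, u⁆ = 0 := congrArg Subtype.val hu'
    exact Subtype.ext (eq_zero_of_mem_eigenAbove (p.upper_le hu.1) (by rw [h1, zero_smul]))
  obtain ⟨⟨u, hu⟩, hu'⟩ := LinearMap.surjective_of_injective hinj ⟨z, hz, hz0⟩
  have h1 : ⁅h, u⁆ = z := congrArg Subtype.val hu'
  rw [← h1]
  exact lie_mem_traceKer ⟨-μ, hμ'⟩ ⟨0, by rw [zero_smul]; exact hu.2⟩

omit [FiniteDimensional ℂ 𝔤] in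
theorem h_mem_traceKer [FiniteDimensional ℂ V] {e₀ : V} (he₀ : IsHighest β.symm e₀) {k : ι}
    (hk : ⁅β.h k, e₀⁆ = 0) : β.h k ∈ traceKer 𝔤 e₀ := by
  have hP : IsSl2Triple.HasPrimitiveVectorWith (β.sl2 k).symm e₀ (0 : ℂ) :=
    ⟨he₀.ne_zero, by rw [neg_lie, hk, neg_zero, zero_smul], he₀.e_eq_zero k⟩
  have he : ⁅β.e k, e₀⁆ = 0 := by simpa using hP.pow_toEnd_f_eq_zero_of_eq_nat (n := 0) (by simp)
  rw [← (β.sl2 k).lie_e_f]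
  exact lie_mem_traceKer ⟨0, by rw [he, zero_smul]⟩ ⟨0, by rw [zero_smul]; exact he₀.e_eq_zero k⟩

variable [LieAlgebra.IsSimple ℂ 𝔤]

/-- The coweight `t` with `κ(t, h_k) = a_k` is orthogonal to the annihilator of `e₀`, hence
commutes with the part of the annihilator in `𝔫₊`; as the eigenvalues of `t` on the `e_k` are
non-positive multiples of `a_k`, that part is generated by the `e_k` with `a_k = 0`. -/
theorem mem_lieSpan_of_lie_eq_zero {h e f : 𝔤} (p : IsPrincipalTriple β h e f) {e₀ : V}
    (he₀ : IsHighest β.symm e₀) {a : ι → ℤ} (ha : ∀ i, a i ≤ 0)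
    (hh : ∀ i, ⁅β.h i, e₀⁆ = a i • e₀) {u : 𝔤} (hu : u ∈ upper β) (hu0 : ⁅u, e₀⁆ = 0) :
    u ∈ LieSubalgebra.lieSpan ℂ 𝔤 {x | ∃ k, a k = 0 ∧ x = β.e k} := by
  obtain ⟨G, hG, hκ⟩ := exists_isCartanPair β
  obtain ⟨s, hs, hGs⟩ := hG.exists_gram_mulVec_eq fun k => (a k : ℚ)
  have hs' : ∀ k, ∑ l, (β.A k l : ℂ) * (s l : ℂ) = ((2 * a k / G k k : ℝ) : ℂ) := by
    intro k
    have := congrArg (Rat.cast : ℚ → ℂ) (hs k)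
    push_cast at this ⊢
    exact this
  set t : 𝔤 := ∑ l, (s l : ℂ) • β.h l with ht
  have htm : t ∈ Submodule.span ℂ (Set.range β.h) :=
    Submodule.sum_mem _ fun l _ => Submodule.smul_mem _ _ (Submodule.subset_span ⟨l, rfl⟩)
  have hte : ∀ k, ⁅t, β.e k⁆ = ((2 * a k / G k k : ℝ) : ℂ) • β.e k := fun k => by
    rw [ht, lie_sum_h_e, hs']
  have htκ : ∀ k, killingForm ℂ 𝔤 t (β.h k) = a k := by
    intro k
    have h2 : killingForm ℂ 𝔤 t (β.h k) = ∑ l, (G k l : ℂ) * s l := by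
      rw [ht, map_sum, LinearMap.sum_apply]
      refine Finset.sum_congr rfl fun l _ => ?_
      rw [map_smul, LinearMap.smul_apply, hκ, hG.symm l k, smul_eq_mul, mul_comm]
    rw [h2]
    exact_mod_cast congrArg (Rat.cast : ℚ → ℂ) (hGs k)
  have hlow : ∀ x ∈ upper β.symm, killingForm ℂ 𝔤 t x = 0 := fun x hx => by
    rw [killingForm_comm]
    exact killingForm_eq_zero_of_above (h := -h) (b := 0) le_rfl (p.symm.upper_le hx)
      (by rw [neg_lie, p.lie_span htm]; simp)
  have hupp : ∀ x ∈ upper β, killingForm ℂ 𝔤 t x = 0 := fun x hx => by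
    rw [killingForm_comm]
    exact killingForm_eq_zero_of_above (h := h) (b := 0) le_rfl (p.upper_le hx)
      (by rw [p.lie_span htm]; simp)
  have htp : ∀ z : 𝔤, ⁅z, e₀⁆ = 0 → killingForm ℂ 𝔤 t z = 0 := by
    intro z hz
    obtain ⟨x, hx, r, y, hy, rfl, -, hr, -⟩ := exists_triangular_of_lie_eq_zero p he₀ hz
    rw [map_add, map_add, hlow x hx, hupp y hy, zero_add, add_zero, map_sum]
    have h1 : (∑ k, r k * a k) • e₀ = 0 := by
      rw [← hr, sum_lie, Finset.sum_smul]
      refine Finset.sum_congr rfl fun k _ => ?_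
      rw [smul_lie, hh, zsmul_eq_intCast_smul, smul_smul]
    rw [← (smul_eq_zero.mp h1).resolve_right he₀.ne_zero]
    refine Finset.sum_congr rfl fun k _ => ?_
    rw [map_smul, htκ, smul_eq_mul]
  have htu : ⁅t, u⁆ = 0 := by
    have hnd := LieAlgebra.IsKilling.ker_killingForm_eq_bot ℂ 𝔤
    have h1 : ⁅t, u⁆ ∈ LinearMap.ker (killingForm ℂ 𝔤) := by
      refine LinearMap.mem_ker.mpr (LinearMap.ext fun y => ?_)
      rw [LinearMap.zero_apply, killingForm_lie]
      obtain ⟨x, hx, b, hb, c, hc, rfl⟩ := exists_triangular β y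
      rw [lie_add, lie_add, map_add, map_add]
      have h2 : killingForm ℂ 𝔤 t ⁅u, x⁆ = 0 := htp _ (by
        rw [lie_lie, lower_lie_eq_zero he₀ hx, hu0, lie_zero, lie_zero, sub_zero])
      have h3 : killingForm ℂ 𝔤 t ⁅u, b⁆ = 0 := by
        rw [← lie_skew, map_neg, hupp _ (lie_mem_upper_of_mem_span β hb hu), neg_zero]
      rw [h2, h3, hupp _ ((upper β).lie_mem hu hc), add_zero, add_zero]
    rw [hnd] at h1
    exact (Submodule.mem_bot ℂ).mp h1
  set N := LieSubalgebra.lieSpan ℂ 𝔤 {x | ∃ k, a k = 0 ∧ x = β.e k} with hN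
  have hNt : ∀ x ∈ N, ⁅t, x⁆ = 0 := by
    intro x hx
    induction hx using LieSubalgebra.lieSpan_induction with
    | mem x hx =>
      obtain ⟨k, hk, rfl⟩ := hx
      rw [hte, hk]
      simp
    | zero => exact lie_zero _
    | add u v _ _ hu hv => rw [lie_add, hu, hv, add_zero]
    | smul t u _ hu => rw [lie_smul, hu, smul_zero]
    | lie u v _ _ hu hv => rw [leibniz_lie, hu, hv, lie_zero, zero_lie, add_zero]
  have hdec : ∀ x ∈ upper β, x ∈ N.toSubmodule ⊔ eigenAbove 𝔤 (-t) 0 := by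
    intro x hx
    induction hx using LieSubalgebra.lieSpan_induction with
    | mem x hx =>
      obtain ⟨k, rfl⟩ := hx
      by_cases hk : a k = 0
      · exact Submodule.mem_sup_left (LieSubalgebra.subset_lieSpan ⟨k, hk, rfl⟩)
      · refine Submodule.mem_sup_right (mem_eigenAbove (c := -(2 * a k / G k k)) ?_ ?_)
        · have h1 : (0 : ℝ) < G k k := by exact_mod_cast hG.diag_pos k
          have h2 : (a k : ℝ) < 0 := by exact_mod_cast lt_of_le_of_ne (ha k) hk
          rw [neg_pos]
          exact div_neg_of_neg_of_pos (by linarith) h1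
        · rw [neg_lie, hte, zero_add, Complex.ofReal_neg, neg_smul]
    | zero => exact Submodule.zero_mem _
    | add u v _ _ hu hv => exact Submodule.add_mem _ hu hv
    | smul t u _ hu => exact Submodule.smul_mem _ t hu
    | lie u v _ _ hu hv =>
      obtain ⟨n₁, hn₁, p₁, hp₁, rfl⟩ := Submodule.mem_sup.mp hu
      obtain ⟨n₂, hn₂, p₂, hp₂, rfl⟩ := Submodule.mem_sup.mp hv
      have hNP : ∀ n ∈ N, ∀ q ∈ eigenAbove 𝔤 (-t) 0, ⁅n, q⁆ ∈ eigenAbove 𝔤 (-t) 0 :=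
        fun n hn q hq => lie_mem_eigenAbove (a := 0) le_rfl
          (by rw [neg_lie, hNt n hn]; simp) hq
      rw [add_lie, lie_add, lie_add, add_assoc]
      refine Submodule.add_mem _ (Submodule.mem_sup_left (N.lie_mem hn₁ hn₂))
        (Submodule.mem_sup_right (Submodule.add_mem _ (hNP _ hn₁ _ hp₂)
          (Submodule.add_mem _ ?_ (lie_mem_eigenAbove_zero hp₁ hp₂))))
      rw [← lie_skew]
      exact Submodule.neg_mem _ (hNP _ hn₂ _ hp₁)
  obtain ⟨n, hn, q, hq, rfl⟩ := Submodule.mem_sup.mp (hdec u hu)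
  rw [lie_add, hNt n hn, zero_add] at htu
  have hq0 : q = 0 := eq_zero_of_mem_eigenAbove hq (by rw [neg_lie, htu, neg_zero, zero_smul])
  rw [hq0, add_zero]
  exact hn

/-- A coweight that kills `e₀`, commutes with the `e_k` for which `a_k = 0`, and has coefficients
of sum zero has trace zero on `𝔤 e₀`. -/
theorem sum_h_mem_traceKer [DecidableEq ι] [FiniteDimensional ℂ V]
    {h e f : 𝔤} (p : IsPrincipalTriple β h e f) {e₀ : V}
    (he₀ : IsHighest β.symm e₀) {a : ι → ℤ} (ha : ∀ i, a i ≤ 0)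
    (hh : ∀ i, ⁅β.h i, e₀⁆ = a i • e₀) (z : ι → ℂ) (hz : ∑ l, z l = 0)
    (hza : ∑ l, z l * a l = 0) (hz' : ∀ k, a k = 0 → ∑ l, β.A k l * z l = 0) :
    ∑ l, z l • β.h l ∈ traceKer 𝔤 e₀ := by
  set x : 𝔤 := ∑ l, z l • β.h l with hx
  have hxm : x ∈ Submodule.span ℂ (Set.range β.h) :=
    Submodule.sum_mem _ fun l _ => Submodule.smul_mem _ _ (Submodule.subset_span ⟨l, rfl⟩)
  have hx0 : ⁅x, e₀⁆ = 0 := by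
    have : ⁅x, e₀⁆ = (∑ l, z l * a l) • e₀ := by
      rw [hx, sum_lie, Finset.sum_smul]
      refine Finset.sum_congr rfl fun k _ => ?_
      rw [smul_lie, hh, zsmul_eq_intCast_smul, smul_smul]
    rw [this, hza, zero_smul]
  have hxq : x ∈ lineStabilizer 𝔤 e₀ := ⟨0, by rw [hx0, zero_smul]⟩
  rw [mem_traceKer_iff hxq]
  have hxN : ∀ u ∈ LieSubalgebra.lieSpan ℂ 𝔤 {x | ∃ k, a k = 0 ∧ x = β.e k}, ⁅x, u⁆ = 0 := by
    intro u hu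
    induction hu using LieSubalgebra.lieSpan_induction with
    | mem u hu =>
      obtain ⟨k, hk, rfl⟩ := hu
      rw [hx, lie_sum_h_e, hz' k hk, zero_smul]
    | zero => exact lie_zero _
    | add u v _ _ hu hv => rw [lie_add, hu, hv, add_zero]
    | smul t u _ hu => rw [lie_smul, hu, smul_zero]
    | lie u v _ _ hu hv => rw [leibniz_lie, hu, hv, lie_zero, zero_lie, add_zero]
  have hxl : ∀ u ∈ upper β.symm, ⁅x, u⁆ ∈ upper β.symm := by
    intro u hu
    refine lie_mem_upper_of_mem_span β.symm ?_ hu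
    rw [hx]
    refine Submodule.sum_mem _ fun l _ => ?_
    have h2 : -(β.symm.h l) ∈ Submodule.span ℂ (Set.range β.symm.h) :=
      Submodule.neg_mem _ (Submodule.subset_span ⟨l, rfl⟩)
    exact Submodule.smul_mem _ _ (by simpa using h2)
  let ev : 𝔤 →ₗ[ℂ] orbitSpace 𝔤 e₀ := (evalAt 𝔤 e₀).codRestrict (orbitSpace 𝔤 e₀).toSubmodule
    fun y => ⟨y, rfl⟩
  have hev : ∀ y, y ∈ LinearMap.ker ev ↔ ⁅y, e₀⁆ = 0 := fun y =>
    ⟨fun hy => congrArg Subtype.val (LinearMap.mem_ker.mp hy), fun hy => Subtype.ext hy⟩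
  have h1 := trace_eq_add_trace_restrict ev (by rintro ⟨_, y, rfl⟩; exact ⟨y, rfl⟩)
    (toEnd ℂ 𝔤 𝔤 x) (toEnd ℂ (lineStabilizer 𝔤 e₀) (orbitSpace 𝔤 e₀) ⟨x, hxq⟩)
    (by
      refine LinearMap.ext fun y => Subtype.ext ?_
      change ⁅⁅x, y⁆, e₀⁆ = ⁅x, ⁅y, e₀⁆⁆
      rw [lie_lie, hx0, lie_zero, sub_zero])
    (upper β.symm).toSubmodule (fun y hy => (hev y).mpr (lower_lie_eq_zero he₀ hy))
    (by
      intro y hy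
      obtain ⟨b, hb, r, c, hc, rfl, -, -, hc0⟩ :=
        exists_triangular_of_lie_eq_zero p he₀ ((hev y).mp hy)
      have h2 : ⁅x, ∑ k, r k • β.h k⁆ = 0 := lie_lie_eq_zero_of_span β hxm
        (Submodule.sum_mem _ fun l _ => Submodule.smul_mem _ _ (Submodule.subset_span ⟨l, rfl⟩))
      rw [toEnd_apply_apply, lie_add, lie_add, h2,
        hxN c (mem_lieSpan_of_lie_eq_zero p he₀ ha hh hc hc0), add_zero, add_zero]
      exact hxl b hb)
  rw [show LinearMap.trace ℂ 𝔤 (toEnd ℂ 𝔤 𝔤 x) = 0 from trace_sum_h β z] at h1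
  -- Each `h_l` has trace `-2` on `𝔫₋`.
  have h2 : (toEnd ℂ 𝔤 𝔤 x).restrict hxl = ∑ l, (-z l) •
      ((toEnd ℂ 𝔤 𝔤 (β.symm.h l)).restrict fun _ hy => lie_h_mem_upper β.symm l hy :
        Module.End ℂ (upper β.symm).toSubmodule) := by
    refine LinearMap.ext fun y => Subtype.ext ?_
    rw [LinearMap.sum_apply, AddSubmonoidClass.coe_finsetSum]
    change ⁅x, (y : 𝔤)⁆ = ∑ l, (-z l) • ⁅-β.h l, (y : 𝔤)⁆
    rw [hx, sum_lie]
    refine Finset.sum_congr rfl fun l _ => ?_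
    rw [smul_lie, neg_lie, smul_neg, neg_smul, neg_neg]
  have h3 : LinearMap.trace ℂ (upper β.symm).toSubmodule ((toEnd ℂ 𝔤 𝔤 x).restrict hxl) = 0 := by
    rw [h2, map_sum]
    have h4 : ∀ l, LinearMap.trace ℂ (upper β.symm).toSubmodule ((-z l) •
        ((toEnd ℂ 𝔤 𝔤 (β.symm.h l)).restrict fun _ hy => lie_h_mem_upper β.symm l hy :
          Module.End ℂ (upper β.symm).toSubmodule)) = -2 * z l := fun l => by
      rw [map_smul, trace_h_upper β.symm l, smul_eq_mul]
      ring
    rw [Finset.sum_congr rfl fun l _ => h4 l, ← Finset.mul_sum, hz, mul_zero]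
  have h5 : (0 : ℂ) = _ + 0 := h1.trans (congrArg _ h3)
  rw [add_zero] at h5
  exact h5.symm

/-- For a lowest weight `a` of small norm, every element of the annihilator of `e₀` has trace zero
on `𝔤 e₀`. The only elements not covered by commutators are the combinations of the `h_k`
with `a_k ≠ 0`; there are none unless `a` is supported on two nodes `i`, `j`, when a coweight
antisymmetric in `i`, `j` settles `h_i - h_j`. -/
theorem mem_traceKer_of_lie_eq_zero [DecidableEq ι] [FiniteDimensional ℂ V]
    {h e f : 𝔤} (p : IsPrincipalTriple β h e f) {e₀ : V}
    (he₀ : IsHighest β.symm e₀) {a : ι → ℤ} (ha : ∀ i, a i ≤ 0)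
    (hh : ∀ i, ⁅β.h i, e₀⁆ = a i • e₀) (ha0 : a ≠ 0) {y : ι → ℚ}
    (hy : ∀ k, ∑ l, β.A l k * y l = -a k) (hsum : ∑ k, -a k * y k ≤ 2) {z : 𝔤}
    (hz : ⁅z, e₀⁆ = 0) : z ∈ traceKer 𝔤 e₀ := by
  obtain ⟨x, hx, t, u, hu, rfl, -, ht0, hu0⟩ := exists_triangular_of_lie_eq_zero p he₀ hz
  refine Submodule.add_mem _ (Submodule.add_mem _ (lower_le_traceKer he₀ hx) ?_)
    (upper_mem_traceKer p he₀ hu hu0)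
  have hta : ∑ k, t k * a k = 0 := by
    have : ⁅∑ k, t k • β.h k, e₀⁆ = (∑ l, t l * a l) • e₀ := by
      rw [sum_lie, Finset.sum_smul]
      refine Finset.sum_congr rfl fun k _ => ?_
      rw [smul_lie, hh, zsmul_eq_intCast_smul, smul_smul]
    rw [this] at ht0
    exact (smul_eq_zero.mp ht0).resolve_right he₀.ne_zero
  have hmem : ∀ k, a k = 0 → β.h k ∈ traceKer 𝔤 e₀ := fun k hk =>
    h_mem_traceKer he₀ (by rw [hh, hk, zero_smul])
  obtain ⟨G, hG, -⟩ := exists_isCartanPair β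
  have hb : ∀ k, 0 ≤ (-a) k := fun k => by simpa using ha k
  rcases hG.support_dichotomy hb (y := y) (by simpa using hy) (by simpa using hsum)
    (neg_ne_zero.mpr ha0) with ⟨i, hi⟩ | ⟨i, j, hij, hi, hj, hk, hA⟩
  · have hi' : ∀ k, k ≠ i → a k = 0 := fun k hk => by simpa using hi k hk
    have hai : a i ≠ 0 := fun h0 => ha0 (funext fun k => by
      rcases eq_or_ne k i with rfl | hk
      exacts [h0, hi' k hk])
    refine Submodule.sum_mem _ fun k _ => ?_
    rcases eq_or_ne k i with rfl | hk
    · rw [Finset.sum_eq_single k (fun l _ hl => by rw [hi' l hl]; simp) (by simp)] at hta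
      rw [(mul_eq_zero.mp hta).resolve_right (by exact_mod_cast hai), zero_smul]
      exact Submodule.zero_mem _
    · exact Submodule.smul_mem _ _ (hmem k (hi' k hk))
  · have hai : a i = -1 := by
      have : -a i = 1 := hi
      omega
    have haj : a j = -1 := by
      have : -a j = 1 := hj
      omega
    have hak : ∀ k, k ≠ i → k ≠ j → a k = 0 := fun k h1 h2 => by simpa using hk k h1 h2
    obtain ⟨z, hzij, hzi, hzsum, hzk⟩ :=
      hG.exists_antisymmetric_coweight hb hij hi hj hk hA
    have hrest : ∀ r : ι → ℂ, ∑ k ∈ (Finset.univ.erase i).erase j, r k • β.h k ∈ traceKer 𝔤 e₀ :=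
      fun r => Submodule.sum_mem _ fun k hk' => by
        rw [Finset.mem_erase, Finset.mem_erase] at hk'
        exact Submodule.smul_mem _ _ (hmem k (hak k hk'.2.1 hk'.1))
    have hr0 : ∀ r : ι → ℂ, ∑ k, r k * (a k : ℂ) = -(r i + r j) := by
      intro r
      rw [sum_eq_add_add_sum_erase hij, Finset.sum_eq_zero fun k hk' => ?_, hai, haj]
      · push_cast; ring
      · rw [Finset.mem_erase, Finset.mem_erase] at hk'
        rw [hak k hk'.2.1 hk'.1]; simp
    have hzj : (z j : ℂ) = -(z i : ℂ) := by
      have : z j = -z i := by linear_combination hzij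
      rw [this]; push_cast; ring
    have hstar := sum_h_mem_traceKer p he₀ ha hh (fun l => (z l : ℂ)) (by exact_mod_cast hzsum)
      (by rw [hr0, hzj]; ring) (by
        intro k hk'
        have h1 : k ≠ i := by rintro rfl; omega
        have h2 : k ≠ j := by rintro rfl; omega
        exact_mod_cast hzk k h1 h2)
    rw [sum_eq_add_add_sum_erase hij, hzj] at hstar
    have hd : β.h i - β.h j ∈ traceKer 𝔤 e₀ := by
      have h1 := (Submodule.add_mem_iff_left _ (hrest fun l => (z l : ℂ))).mp hstar
      have h2 : (z i : ℂ) ≠ 0 := by exact_mod_cast hzi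
      have h3 := Submodule.smul_mem _ (z i : ℂ)⁻¹ h1
      have h4 : (z i : ℂ)⁻¹ • ((z i : ℂ) • β.h i + -(z i : ℂ) • β.h j) = β.h i - β.h j := by
        rw [neg_smul, smul_add, smul_neg, smul_smul, smul_smul, inv_mul_cancel₀ h2, one_smul,
          one_smul, sub_eq_add_neg]
      rwa [h4] at h3
    have htj : t j = -t i := by
      have := hr0 t
      rw [hta] at this
      linear_combination this
    rw [sum_eq_add_add_sum_erase hij, htj]
    refine Submodule.add_mem _ ?_ (hrest t)
    have h4 : t i • β.h i + -t i • β.h j = t i • (β.h i - β.h j) := by module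
    rw [h4]
    exact Submodule.smul_mem _ _ hd

theorem trace_orbitSpace_eq_zero [DecidableEq ι] [FiniteDimensional ℂ V]
    {h e f : 𝔤} (p : IsPrincipalTriple β h e f) {e₀ : V}
    (he₀ : IsHighest β.symm e₀) {a : ι → ℤ} (ha : ∀ i, a i ≤ 0)
    (hh : ∀ i, ⁅β.h i, e₀⁆ = a i • e₀) (ha0 : a ≠ 0) {y : ι → ℚ}
    (hy : ∀ k, ∑ l, β.A l k * y l = -a k) (hsum : ∑ k, -a k * y k ≤ 2) {z : 𝔤}
    (hz : ⁅z, e₀⁆ = 0) (hW : ∀ w ∈ LinearMap.range (evalAt 𝔤 e₀),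
      toEnd ℂ 𝔤 V z w ∈ LinearMap.range (evalAt 𝔤 e₀)) :
    LinearMap.trace ℂ (LinearMap.range (evalAt 𝔤 e₀)) ((toEnd ℂ 𝔤 V z).restrict hW) = 0 :=
  (mem_traceKer_iff ⟨0, by rw [hz, zero_smul]⟩).mp
    (mem_traceKer_of_lie_eq_zero p he₀ ha hh ha0 hy hsum hz)

end Orbit

/-! ### The determinant condition -/

section Determinant

variable {𝔤 : Type*} [LieRing 𝔤] [LieAlgebra ℂ 𝔤] {ι : Type*} [Fintype ι] [DecidableEq ι]
  {H : LieSubalgebra ℂ 𝔤} (β : LieAlgebra.Basis ι H)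

/-- The determinant condition bounds the norm of the lowest weight `a`. -/
theorem exists_of_det_extendedCartanMatrix {a : ι → ℤ} {D : ℕ} (hD : 3 ≤ D)
    (hdet : ((extendedCartanMatrix β a).det : ℚ) =
      -(((D : ℚ) - 1) / ((D : ℚ) - 2)) * (β.A.det : ℚ)) :
    a ≠ 0 ∧ ∃ y : ι → ℚ, (∀ k, ∑ l, β.A l k * y l = -a k) ∧ ∑ k, -a k * y k ≤ 2 := by
  let B : Matrix ι ι ℚ := β.A.transpose.map (Int.cast : ℤ → ℚ)
  have hB : B.det = β.A.det := by
    rw [← Matrix.det_transpose β.A]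
    exact ((Int.castRingHom ℚ).map_det β.A.transpose).symm
  have hA0 : (β.A.det : ℚ) ≠ 0 := by exact_mod_cast β.nondegen.det_ne_zero
  have hunit : IsUnit B.det := by rw [hB]; exact hA0.isUnit
  let _ : Invertible B := Matrix.invertibleOfIsUnitDet B hunit
  let v : ι → ℚ := fun k => a k
  have h1 : ((extendedCartanMatrix β a).det : ℚ) =
      (Matrix.fromBlocks 0 (Matrix.of fun (_ : Unit) j => v j)
        (Matrix.of fun i (_ : Unit) => v i) B).det := by
    refine ((Int.castRingHom ℚ).map_det _).trans (congrArg _ ?_)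
    ext (i | i) (j | j) <;> simp [extendedCartanMatrix, B, v]
  rw [Matrix.det_fromBlocks₂₂, hB, Matrix.det_unique (n := Unit)] at h1
  have h2 : ((0 : Matrix Unit Unit ℚ) - (Matrix.of fun (_ : Unit) j => v j) * ⅟B *
      (Matrix.of fun i (_ : Unit) => v i)) default default = -∑ k, v k * (⅟B).mulVec v k := by
    rw [Matrix.mul_assoc, Matrix.sub_apply, Matrix.zero_apply, zero_sub, Matrix.mul_apply]
    rfl
  rw [h2] at h1
  have hD3 : (3 : ℚ) ≤ D := by exact_mod_cast hD
  have hq : ∑ k, v k * (⅟B).mulVec v k = ((D : ℚ) - 1) / ((D : ℚ) - 2) := by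
    have h3 : (β.A.det : ℚ) * (∑ k, v k * (⅟B).mulVec v k) =
        (β.A.det : ℚ) * (((D : ℚ) - 1) / ((D : ℚ) - 2)) := by
      linear_combination h1 - hdet
    exact mul_left_cancel₀ hA0 h3
  have hpos : (0 : ℚ) < ((D : ℚ) - 1) / ((D : ℚ) - 2) := div_pos (by linarith) (by linarith)
  refine ⟨?_, fun k => -(⅟B).mulVec v k, ?_, ?_⟩
  · rintro rfl
    have : ∑ k, v k * (⅟B).mulVec v k = 0 := Finset.sum_eq_zero fun k _ => by simp [v]
    rw [this] at hq
    exact hpos.ne hq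
  · intro k
    have h3 : B.mulVec ((⅟B).mulVec v) = v := by
      rw [Matrix.mulVec_mulVec, mul_invOf_self, Matrix.one_mulVec]
    have h4 : ∑ l, (β.A l k : ℚ) * (⅟B).mulVec v l = a k := congrFun h3 k
    simp only [mul_neg, Finset.sum_neg_distrib, h4]
  · have h3 : ∑ k, -(a k : ℚ) * -(⅟B).mulVec v k = ∑ k, v k * (⅟B).mulVec v k :=
      Finset.sum_congr rfl fun k _ => by rw [neg_mul_neg]
    rw [h3, hq, div_le_iff₀ (by linarith)]
    linarith

end Determinant

/-! ### The constraint from the Serre relation -/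

section Serre

open LieModule Module LieAlgebra

variable {𝔤 : Type*} [LieRing 𝔤] [LieAlgebra ℂ 𝔤]
variable {V : Type*} [AddCommGroup V] [Module ℂ V] [LieRingModule 𝔤 V] [LieModule ℂ 𝔤 V]

/-- The map `x ⊗ y ↦ {x, y}` from `V ⊗ V` to the degree two part of the free Lie superalgebra. -/
noncomputable def actTwo : V ⊗[ℂ] V →ₗ[ℂ] Module.End ℂ (TensorAlgebra ℂ V) :=
  TensorProduct.lift ((LinearMap.mul ℂ (Module.End ℂ (TensorAlgebra ℂ V))).compl₁₂ actOne actOne +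
    ((LinearMap.mul ℂ (Module.End ℂ (TensorAlgebra ℂ V))).compl₁₂ actOne actOne).flip)

@[simp]
theorem actTwo_tmul (x y : V) :
    actTwo (x ⊗ₜ[ℂ] y) = actOne x * actOne y + actOne y * actOne x := rfl

/-- The map `x ⊗ y ↦ [Φ, {x, y}] = Φ(x) y + Φ(y) x`. -/
noncomputable def symApply (Φ : V →ₗ[ℂ] Module.End ℂ V) : V ⊗[ℂ] V →ₗ[ℂ] V :=
  TensorProduct.lift (Φ + Φ.flip)

@[simp]
theorem symApply_tmul (Φ : V →ₗ[ℂ] Module.End ℂ V) (x y : V) :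
    symApply Φ (x ⊗ₜ[ℂ] y) = Φ x y + Φ y x := rfl

variable (𝔤) in
/-- The `𝔤`-submodule of `V ⊗ V` generated by `e₀ ⊗ e₀`. -/
def serreSquare (e₀ : V) : LieSubmodule ℂ 𝔤 (V ⊗[ℂ] V) :=
  LieSubmodule.lieSpan ℂ 𝔤 {e₀ ⊗ₜ[ℂ] e₀}

theorem actOne_injective : Function.Injective (actOne : V →ₗ[ℂ] _) := by
  refine (injective_iff_map_eq_zero _).mpr fun x hx => ?_
  have h1 : (actOne x) 1 = 0 := by rw [hx]; rfl
  have h2 : TensorAlgebra.ι ℂ x = 0 := by simpa [actOne] using h1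
  exact (TensorAlgebra.ι_eq_zero_iff ℂ x).mp h2

theorem superBracket_of_odd {p q : ℤ} (h : (-1 : ℂ) ^ (p * q) = -1)
    (a b : Module.End ℂ (TensorAlgebra ℂ V)) : superBracket p q a b = a * b + b * a := by
  ext1 w
  simp [superBracket, h]

theorem superBracket_one_one (x y : V) :
    superBracket 1 1 (actOne x) (actOne y) = actTwo (x ⊗ₜ[ℂ] y) := by
  rw [superBracket_of_odd (by norm_num), actTwo_tmul]

theorem superBracket_actZero_actTwo (z : 𝔤) (s : V ⊗[ℂ] V) :
    superBracket 0 2 (actZero (toEnd ℂ 𝔤 V z)) (actTwo s) = actTwo ⁅z, s⁆ := by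
  have hA : ∀ x : V, actZero (toEnd ℂ 𝔤 V z) * actOne x =
      actOne x * actZero (toEnd ℂ 𝔤 V z) + actOne ⁅z, x⁆ := fun x => by
    have h := superBracket_actZero_actOne (toEnd ℂ 𝔤 V z) x
    simp only [superBracket, zero_mul, zpow_zero, one_smul, toEnd_apply_apply] at h
    rw [← h]; abel
  simp only [superBracket, zero_mul, zpow_zero, one_smul]
  induction s with
  | zero => simp
  | add s t hs ht => rw [lie_add, map_add, map_add, mul_add, add_mul, ← hs, ← ht]; abel
  | tmul x y =>
    rw [TensorProduct.LieModule.lie_tmul_right, map_add, actTwo_tmul, actTwo_tmul, actTwo_tmul,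
      mul_add, ← mul_assoc, ← mul_assoc, hA, hA, add_mul, add_mul, mul_assoc, mul_assoc, hA, hA]
    noncomm_ring

theorem superBracket_actNegOne_actTwo (Φ : V →ₗ[ℂ] Module.End ℂ V) (s : V ⊗[ℂ] V) :
    superBracket (-1) 2 (actNegOne Φ) (actTwo s) = actOne (symApply Φ s) := by
  have hP : ∀ x : V, actNegOne Φ * actOne x = actZero (Φ x) - actOne x * actNegOne Φ := fun x => by
    have h := superBracket_actNegOne_actOne Φ x
    rw [superBracket_of_odd (by norm_num)] at h
    rw [← h]; abel
  have hA : ∀ (A : Module.End ℂ V) (x : V), actZero A * actOne x =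
      actOne x * actZero A + actOne (A x) := fun A x => by
    have h := superBracket_actZero_actOne A x
    simp only [superBracket, zero_mul, zpow_zero, one_smul] at h
    rw [← h]; abel
  have h1 : ((-1 : ℂ) ^ ((-1 : ℤ) * 2)) = 1 := by norm_num
  simp only [superBracket, h1, one_smul]
  induction s with
  | zero => simp
  | add s t hs ht => rw [map_add, map_add, map_add, mul_add, add_mul, ← hs, ← ht]; abel
  | tmul x y =>
    rw [actTwo_tmul, symApply_tmul, map_add, mul_add, ← mul_assoc, ← mul_assoc, hP, hP, sub_mul,
      sub_mul, mul_assoc, mul_assoc, hP, hP, hA, hA]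
    simp only [mul_sub, add_mul, mul_assoc]
    abel

theorem actTwo_mem_serreIdeal {e₀ : V} {s : V ⊗[ℂ] V} (hs : s ∈ serreSquare 𝔤 e₀) :
    actTwo s ∈ serreIdeal 𝔤 e₀ 2 := by
  simp only [serreIdeal, Submodule.mem_iInf]
  intro S hS
  let N : LieSubmodule ℂ 𝔤 (V ⊗[ℂ] V) :=
    { (S 2).comap actTwo with
      lie_mem := by
        intro z s hs
        change actTwo ⁅z, s⁆ ∈ S 2
        rw [← superBracket_actZero_actTwo]
        exact hS.zero_bracket_mem z 2 _ hs }
  have hN : serreSquare 𝔤 e₀ ≤ N := by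
    refine LieSubmodule.lieSpan_le.mpr ?_
    rintro _ rfl
    change actTwo (e₀ ⊗ₜ[ℂ] e₀) ∈ S 2
    rw [← superBracket_one_one]
    exact hS.serre_mem
  exact hN hs

/-- An element of `N` annihilates the degree two part of the maximal ideal: the result has degree
one, where the ideal vanishes. -/
theorem superBracket_eq_zero_of_mem_maxIdeal {N : Submodule ℂ (V →ₗ[ℂ] Module.End ℂ V)}
    {Φ : V →ₗ[ℂ] Module.End ℂ V} (hΦ : Φ ∈ N) {c : Module.End ℂ (TensorAlgebra ℂ V)}
    (hc : c ∈ maxIdeal N 2) : superBracket (-1) 2 (actNegOne Φ) c = 0 := by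
  let L : Module.End ℂ (TensorAlgebra ℂ V) →ₗ[ℂ] Module.End ℂ (TensorAlgebra ℂ V) :=
    LinearMap.mulLeft ℂ (actNegOne Φ) -
      ((-1 : ℂ) ^ ((-1 : ℤ) * 2)) • LinearMap.mulRight ℂ (actNegOne Φ)
  have hL : maxIdeal N 2 ≤ LinearMap.ker L := by
    refine iSup₂_le fun I hI c hc => ?_
    have h1 : actNegOne Φ ∈ subalg N (-1) := by
      simp only [subalg, Submodule.mem_iInf]
      exact fun S hS => hS.negOne_mem Φ hΦ
    have h2 := hI.1.bracket_mem (-1) 2 _ h1 c hc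
    rw [hI.2 _ (by norm_num)] at h2
    exact (Submodule.mem_bot ℂ).mp h2
  exact hL hc

theorem symApply_eq_zero {e₀ : V} {N : Submodule ℂ (V →ₗ[ℂ] Module.End ℂ V)}
    (hN : IsAdmissible 𝔤 e₀ N) {Φ : V →ₗ[ℂ] Module.End ℂ V} (hΦ : Φ ∈ N) {s : V ⊗[ℂ] V}
    (hs : s ∈ serreSquare 𝔤 e₀) : symApply Φ s = 0 := by
  refine actOne_injective ?_
  rw [map_zero, ← superBracket_actNegOne_actTwo]
  exact superBracket_eq_zero_of_mem_maxIdeal hΦ (hN.serre_le (actTwo_mem_serreIdeal hs))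

theorem symApply_lie (Ψ : V →ₗ[ℂ] 𝔤) (z : 𝔤) (s : V ⊗[ℂ] V) :
    symApply ((toEnd ℂ 𝔤 V : 𝔤 →ₗ[ℂ] Module.End ℂ V) ∘ₗ ⁅z, Ψ⁆) s =
      ⁅z, symApply ((toEnd ℂ 𝔤 V : 𝔤 →ₗ[ℂ] Module.End ℂ V) ∘ₗ Ψ) s⁆ -
        symApply ((toEnd ℂ 𝔤 V : 𝔤 →ₗ[ℂ] Module.End ℂ V) ∘ₗ Ψ) ⁅z, s⁆ := by
  induction s with
  | zero => simp
  | add s t hs ht => rw [lie_add, map_add, map_add, map_add, lie_add, hs, ht]; abel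
  | tmul x y =>
    rw [TensorProduct.LieModule.lie_tmul_right, map_add]
    simp only [symApply_tmul, LinearMap.comp_apply, LieHom.coe_toLinearMap, toEnd_apply_apply,
      LieHom.lie_apply, sub_lie, lie_add, lie_lie]
    abel

variable (𝔤) in
/-- The maps `Ψ : V → 𝔤` for which `[Ψ(x), y] + [Ψ(y), x]` vanishes on the submodule of `V ⊗ V`
generated by `e₀ ⊗ e₀`, a `𝔤`-submodule of `Hom(V, 𝔤)`. -/
noncomputable def serreHom (e₀ : V) : LieSubmodule ℂ 𝔤 (V →ₗ[ℂ] 𝔤) where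
  carrier := {Ψ | ∀ s ∈ serreSquare 𝔤 e₀,
    symApply ((toEnd ℂ 𝔤 V : 𝔤 →ₗ[ℂ] Module.End ℂ V) ∘ₗ Ψ) s = 0}
  add_mem' := by
    intro Ψ Ψ' h h' s hs
    have : symApply ((toEnd ℂ 𝔤 V : 𝔤 →ₗ[ℂ] Module.End ℂ V) ∘ₗ (Ψ + Ψ')) =
        symApply ((toEnd ℂ 𝔤 V : 𝔤 →ₗ[ℂ] Module.End ℂ V) ∘ₗ Ψ) +
          symApply ((toEnd ℂ 𝔤 V : 𝔤 →ₗ[ℂ] Module.End ℂ V) ∘ₗ Ψ') := by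
      refine TensorProduct.ext' fun x y => ?_
      simp only [symApply_tmul, LinearMap.comp_apply, LinearMap.add_apply, map_add]
      abel
    rw [this, LinearMap.add_apply, h s hs, h' s hs, add_zero]
  zero_mem' := by
    intro s _
    have : symApply ((toEnd ℂ 𝔤 V : 𝔤 →ₗ[ℂ] Module.End ℂ V) ∘ₗ (0 : V →ₗ[ℂ] 𝔤)) = 0 := by
      refine TensorProduct.ext' fun x y => ?_
      simp
    rw [this, LinearMap.zero_apply]
  smul_mem' := by
    intro c Ψ h s hs
    have : symApply ((toEnd ℂ 𝔤 V : 𝔤 →ₗ[ℂ] Module.End ℂ V) ∘ₗ (c • Ψ)) =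
        c • symApply ((toEnd ℂ 𝔤 V : 𝔤 →ₗ[ℂ] Module.End ℂ V) ∘ₗ Ψ) := by
      refine TensorProduct.ext' fun x y => ?_
      simp
    rw [this, LinearMap.smul_apply, h s hs, smul_zero]
  lie_mem := by
    intro z Ψ h s hs
    rw [symApply_lie, h s hs, h _ ((serreSquare 𝔤 e₀).lie_mem hs), lie_zero, sub_zero]

theorem lie_apply_self_eq_zero {e₀ : V} {Ψ : V →ₗ[ℂ] 𝔤} (hΨ : Ψ ∈ serreHom 𝔤 e₀) :
    ⁅Ψ e₀, e₀⁆ = 0 := by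
  have h1 := hΨ _ (LieSubmodule.subset_lieSpan (Set.mem_singleton _))
  have h2 : ⁅Ψ e₀, e₀⁆ + ⁅Ψ e₀, e₀⁆ = 0 := h1
  rw [← two_smul ℂ] at h2
  exact (smul_eq_zero.mp h2).resolve_left two_ne_zero

theorem lie_apply_lie_self {e₀ : V} {Ψ : V →ₗ[ℂ] 𝔤} (hΨ : Ψ ∈ serreHom 𝔤 e₀) (y : 𝔤) :
    ⁅Ψ ⁅y, e₀⁆, e₀⁆ = -⁅Ψ e₀, ⁅y, e₀⁆⁆ := by
  have h1 := hΨ _ ((serreSquare 𝔤 e₀).lie_mem (x := y)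
    (LieSubmodule.subset_lieSpan (Set.mem_singleton _)))
  rw [TensorProduct.LieModule.lie_tmul_right, map_add] at h1
  have h2 : (⁅Ψ ⁅y, e₀⁆, e₀⁆ + ⁅Ψ e₀, ⁅y, e₀⁆⁆) + (⁅Ψ e₀, ⁅y, e₀⁆⁆ + ⁅Ψ ⁅y, e₀⁆, e₀⁆) = 0 := h1
  rw [add_comm ⁅Ψ e₀, ⁅y, e₀⁆⁆, ← two_smul ℂ] at h2
  exact eq_neg_of_add_eq_zero_left ((smul_eq_zero.mp h2).resolve_left two_ne_zero)

theorem toEnd_injective [LieAlgebra.IsSimple ℂ 𝔤] {e₀ : V} {z : 𝔤} (hz : ⁅z, e₀⁆ ≠ 0) :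
    Function.Injective (toEnd ℂ 𝔤 V) := by
  have h1 : LieModule.ker ℂ 𝔤 V = ⊥ := by
    refine (LieAlgebra.IsSimple.eq_bot_or_eq_top (R := ℂ) (LieModule.ker ℂ 𝔤 V)).resolve_right ?_
    intro htop
    have h2 : z ∈ LieModule.ker ℂ 𝔤 V := by rw [htop]; trivial
    exact hz ((LieModule.mem_ker ℂ 𝔤 V _).mp h2 e₀)
  refine (injective_iff_map_eq_zero (toEnd ℂ 𝔤 V : 𝔤 →ₗ[ℂ] Module.End ℂ V)).mpr fun x hx => ?_
  have h2 : x ∈ LieModule.ker ℂ 𝔤 V := (LieModule.mem_ker ℂ 𝔤 V _).mpr fun m =>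
    congrArg (fun T : Module.End ℂ V => T m) hx
  rw [h1] at h2
  exact (LieSubmodule.mem_bot x).mp h2

/-- The elements of `𝒯₋₁` come from maps to `𝔤` that respect the Serre relation. -/
theorem tNegOne_le [LieAlgebra.IsSimple ℂ 𝔤] {e₀ : V} {z : 𝔤} (hz : ⁅z, e₀⁆ ≠ 0) :
    tNegOne 𝔤 e₀ ≤ (serreHom 𝔤 e₀).toSubmodule.map
      (LinearMap.compRight ℂ (toEnd ℂ 𝔤 V : 𝔤 →ₗ[ℂ] Module.End ℂ V)) := by
  refine sSup_le fun N hN Φ hΦ => ?_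
  have hrange : ∀ x, Φ x ∈ LinearMap.range (toEnd ℂ 𝔤 V : 𝔤 →ₗ[ℂ] Module.End ℂ V) := by
    intro x
    have hN' : IsAdmissible 𝔤 e₀ N := hN
    rw [← hN'.bracket_eq]
    exact Submodule.subset_span ⟨Φ, hΦ, x, rfl⟩
  let E := LinearEquiv.ofInjective (toEnd ℂ 𝔤 V : 𝔤 →ₗ[ℂ] Module.End ℂ V) (toEnd_injective hz)
  let Ψ : V →ₗ[ℂ] 𝔤 := E.symm.toLinearMap ∘ₗ Φ.codRestrict _ hrange
  have hΨ : (toEnd ℂ 𝔤 V : 𝔤 →ₗ[ℂ] Module.End ℂ V) ∘ₗ Ψ = Φ := by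
    refine LinearMap.ext fun x => ?_
    exact congrArg Subtype.val (E.apply_symm_apply ⟨Φ x, hrange x⟩)
  refine ⟨Ψ, fun s hs => ?_, hΨ⟩
  rw [hΨ]
  exact symApply_eq_zero hN hΦ hs

end Serre

/-! ### Orthogonality to the small and the large component -/

section Orthogonal

open LieModule Module LieAlgebra

variable {𝔤 : Type*} [LieRing 𝔤] [LieAlgebra ℂ 𝔤]
variable {V : Type*} [AddCommGroup V] [Module ℂ V] [LieRingModule 𝔤 V] [LieModule ℂ 𝔤 V]

/-- The pairing `v ⊗ y ↦ κ(Ψ(v), y)` with a map `Ψ : V → 𝔤`. -/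
noncomputable def homPairing (Ψ : V →ₗ[ℂ] 𝔤) : V ⊗[ℂ] 𝔤 →ₗ[ℂ] ℂ :=
  TensorProduct.lift (killingForm ℂ 𝔤 ∘ₗ Ψ)

omit [LieRingModule 𝔤 V] [LieModule ℂ 𝔤 V] in
@[simp]
theorem homPairing_tmul (Ψ : V →ₗ[ℂ] 𝔤) (v : V) (y : 𝔤) :
    homPairing Ψ (v ⊗ₜ[ℂ] y) = killingForm ℂ 𝔤 (Ψ v) y := rfl

omit [LieRingModule 𝔤 V] [LieModule ℂ 𝔤 V] in
theorem adjPairing_eq_homPairing (τ : Module.Dual ℂ V ⊗[ℂ] 𝔤) :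
    adjPairing 𝔤 V τ = homPairing (dualTensorHom ℂ V 𝔤 τ) := by
  induction τ with
  | zero =>
    refine TensorProduct.ext' fun v y => ?_
    simp
  | add s t hs ht =>
    refine TensorProduct.ext' fun v y => ?_
    rw [map_add, hs, ht, map_add]
    simp
  | tmul w z =>
    refine TensorProduct.ext' fun v y => ?_
    simp [adjPairing]

theorem embTensor_eq_comp (τ : Module.Dual ℂ V ⊗[ℂ] 𝔤) :
    embTensor 𝔤 τ = (toEnd ℂ 𝔤 V : 𝔤 →ₗ[ℂ] Module.End ℂ V) ∘ₗ dualTensorHom ℂ V 𝔤 τ := by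
  induction τ with
  | zero => simp
  | add s t hs ht => rw [map_add, hs, ht, map_add, LinearMap.comp_add]
  | tmul w z =>
    refine LinearMap.ext fun v => ?_
    simp [embTensor]

omit [LieRingModule 𝔤 V] [LieModule ℂ 𝔤 V] in
theorem contract_eq (τ : Module.Dual ℂ V ⊗[ℂ] 𝔤) (y : 𝔤) (v : V) :
    contract 𝔤 (Module.Dual ℂ V) y τ v = killingForm ℂ 𝔤 y (dualTensorHom ℂ V 𝔤 τ v) := by
  induction τ with
  | zero => simp
  | add s t hs ht => rw [map_add, map_add, LinearMap.add_apply, LinearMap.add_apply, map_add, hs, ht]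
  | tmul w z => simp [contract, mul_comm]

theorem homPairing_lie (Ψ : V →ₗ[ℂ] 𝔤) (z : 𝔤) (σ : V ⊗[ℂ] 𝔤) :
    homPairing Ψ ⁅z, σ⁆ = -homPairing ⁅z, Ψ⁆ σ := by
  induction σ with
  | zero => simp
  | add s t hs ht => rw [lie_add, map_add, map_add, hs, ht]; ring
  | tmul v y =>
    rw [TensorProduct.LieModule.lie_tmul_right, map_add, homPairing_tmul, homPairing_tmul,
      homPairing_tmul, LieHom.lie_apply, map_sub, LinearMap.sub_apply, ← killingForm_lie,
      ← lie_skew z, map_neg, LinearMap.neg_apply]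
    ring

variable (𝔤) in
/-- The annihilator in `V ⊗ 𝔤` of the maps that respect the Serre relation. -/
noncomputable def serreAnnihilator (e₀ : V) : LieSubmodule ℂ 𝔤 (V ⊗[ℂ] 𝔤) where
  carrier := {σ | ∀ Ψ ∈ serreHom 𝔤 e₀, homPairing Ψ σ = 0}
  add_mem' := fun h h' Ψ hΨ => by rw [map_add, h Ψ hΨ, h' Ψ hΨ, add_zero]
  zero_mem' := fun Ψ _ => map_zero _
  smul_mem' := fun c σ h Ψ hΨ => by rw [map_smul, h Ψ hΨ, smul_zero]
  lie_mem := fun {z σ} h Ψ hΨ => by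
    rw [homPairing_lie, h _ ((serreHom 𝔤 e₀).lie_mem hΨ), neg_zero]

variable [FiniteDimensional ℂ 𝔤]

theorem homPairing_eq_trace (Ψ : V →ₗ[ℂ] 𝔤) (σ : V ⊗[ℂ] 𝔤) {m : V}
    (hσ : ∀ y : 𝔤, contract 𝔤 V y σ = ⁅y, m⁆) :
    homPairing Ψ σ = LinearMap.trace ℂ 𝔤 (Ψ ∘ₗ evalAt 𝔤 m) := by
  have key : ∀ σ : V ⊗[ℂ] 𝔤, ∃ T : 𝔤 →ₗ[ℂ] V, (∀ y, T y = contract 𝔤 V y σ) ∧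
      homPairing Ψ σ = LinearMap.trace ℂ 𝔤 (Ψ ∘ₗ T) := by
    intro σ
    induction σ with
    | zero => exact ⟨0, by simp, by simp⟩
    | add s t hs ht =>
      obtain ⟨S, hS, hS'⟩ := hs
      obtain ⟨T, hT, hT'⟩ := ht
      exact ⟨S + T, fun y => by rw [LinearMap.add_apply, hS, hT, map_add],
        by rw [map_add, hS', hT', LinearMap.comp_add, map_add]⟩
    | tmul v z =>
      refine ⟨((killingForm ℂ 𝔤).flip z).smulRight v, fun y => by simp [contract], ?_⟩
      have h1 : Ψ ∘ₗ ((killingForm ℂ 𝔤).flip z).smulRight v =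
          ((killingForm ℂ 𝔤).flip z).smulRight (Ψ v) := by
        ext; simp
      rw [h1, trace_smulRight', homPairing_tmul]
      rfl
  obtain ⟨T, hT, hT'⟩ := key σ
  rw [hT']
  congr 2
  ext y
  rw [hT, hσ, evalAt_apply]

variable [FiniteDimensional ℂ V] [LieModule.IsIrreducible ℂ 𝔤 V]

/-- The trace `tr (y ↦ Ψ(y m))` vanishes for all `m` as soon as it does for `m = e₀`, where the
Serre relation turns it into the trace of `-Ψ(e₀)` on `𝔤 e₀`. -/
theorem trace_comp_evalAt_eq_zero {e₀ : V} (he₀ : e₀ ≠ 0)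
    (htr : ∀ z : 𝔤, ⁅z, e₀⁆ = 0 → ∀ hW : ∀ w ∈ LinearMap.range (evalAt 𝔤 e₀),
      toEnd ℂ 𝔤 V z w ∈ LinearMap.range (evalAt 𝔤 e₀),
      LinearMap.trace ℂ (LinearMap.range (evalAt 𝔤 e₀)) ((toEnd ℂ 𝔤 V z).restrict hW) = 0)
    (m : V) {Ψ : V →ₗ[ℂ] 𝔤} (hΨ : Ψ ∈ serreHom 𝔤 e₀) :
    LinearMap.trace ℂ 𝔤 (Ψ ∘ₗ evalAt 𝔤 m) = 0 := by
  have hadd : ∀ m m' : V, evalAt 𝔤 (m + m') = evalAt 𝔤 m + evalAt 𝔤 m' := fun m m' => by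
    ext; simp
  have hsmul : ∀ (c : ℂ) (m : V), evalAt 𝔤 (c • m) = c • evalAt 𝔤 m := fun c m => by
    ext; simp
  let R : LieSubmodule ℂ 𝔤 V :=
    { carrier := {m | ∀ Ψ ∈ serreHom 𝔤 e₀, LinearMap.trace ℂ 𝔤 (Ψ ∘ₗ evalAt 𝔤 m) = 0}
      add_mem' := fun h h' Ψ hΨ => by
        rw [hadd, LinearMap.comp_add, map_add, h Ψ hΨ, h' Ψ hΨ, add_zero]
      zero_mem' := fun Ψ _ => by
        have : evalAt 𝔤 (0 : V) = 0 := by ext; simp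
        rw [this, LinearMap.comp_zero, map_zero]
      smul_mem' := fun c m h Ψ hΨ => by
        rw [hsmul, LinearMap.comp_smul, map_smul, h Ψ hΨ, smul_zero]
      lie_mem := by
        intro z m h Ψ hΨ
        have h1 : Ψ ∘ₗ evalAt 𝔤 ⁅z, m⁆ = ⁅toEnd ℂ 𝔤 𝔤 z, Ψ ∘ₗ evalAt 𝔤 m⁆ -
            (⁅z, Ψ⁆ : V →ₗ[ℂ] 𝔤) ∘ₗ evalAt 𝔤 m := by
          refine LinearMap.ext fun y => ?_
          rw [Ring.lie_def]
          change Ψ ⁅y, ⁅z, m⁆⁆ =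
            ⁅z, Ψ ⁅y, m⁆⁆ - Ψ ⁅⁅z, y⁆, m⁆ - (⁅z, Ψ⁆ : V →ₗ[ℂ] 𝔤) ⁅y, m⁆
          rw [LieHom.lie_apply, lie_lie, map_sub]
          abel
        rw [h1, map_sub, LinearMap.trace_lie, h _ ((serreHom 𝔤 e₀).lie_mem hΨ), sub_zero] }
  have hmem : e₀ ∈ R := by
    intro Ψ hΨ
    have hz := lie_apply_self_eq_zero hΨ
    have hW : ∀ w ∈ LinearMap.range (evalAt 𝔤 e₀),
        toEnd ℂ 𝔤 V (Ψ e₀) w ∈ LinearMap.range (evalAt 𝔤 e₀) := by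
      rintro _ ⟨y, rfl⟩
      exact ⟨-Ψ ⁅y, e₀⁆, by
        rw [evalAt_apply, neg_lie, lie_apply_lie_self hΨ, neg_neg]; rfl⟩
    rw [LinearMap.trace_comp_comm', ← LinearMap.trace_restrict_eq_of_forall_mem
      (LinearMap.range (evalAt 𝔤 e₀)) (evalAt 𝔤 e₀ ∘ₗ Ψ)
      (fun v => LinearMap.mem_range_self (evalAt 𝔤 e₀) (Ψ v))]
    have h1 : (evalAt 𝔤 e₀ ∘ₗ Ψ).restrict
        (fun v (_ : v ∈ LinearMap.range (evalAt 𝔤 e₀)) =>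
          LinearMap.mem_range_self (evalAt 𝔤 e₀) (Ψ v)) =
        -((toEnd ℂ 𝔤 V (Ψ e₀)).restrict hW) := by
      ext ⟨_, y, rfl⟩
      exact lie_apply_lie_self hΨ y
    rw [h1, map_neg, htr _ hz hW, neg_zero]
  have hR : R = ⊤ := (IsSimpleOrder.eq_bot_or_eq_top R).resolve_left (by
    intro hb
    rw [hb] at hmem
    exact he₀ ((LieSubmodule.mem_bot e₀).mp hmem))
  have hm : m ∈ R := by rw [hR]; trivial
  exact hm Ψ hΨ

variable [LieAlgebra.IsSimple ℂ 𝔤]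

omit [FiniteDimensional ℂ V] [LieModule.IsIrreducible ℂ 𝔤 V] in
variable (𝔤) in
theorem killingForm_bijective : Function.Bijective (killingForm ℂ 𝔤) := by
  have h1 : Function.Injective (killingForm ℂ 𝔤) :=
    LinearMap.ker_eq_bot.mp (LieAlgebra.IsKilling.ker_killingForm_eq_bot ℂ 𝔤)
  refine ⟨h1, ?_⟩
  exact (LinearMap.injective_iff_surjective_of_finrank_eq_finrank
    (Subspace.dual_finrank_eq (K := ℂ) (V := 𝔤)).symm).mp h1

variable {ι : Type*} [Fintype ι] {H : LieSubalgebra ℂ 𝔤} {β : LieAlgebra.Basis ι H}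

/-- The large component is generated from `e₀ ⊗ z` with `z` a lowest root vector; such a `z` is
orthogonal to the annihilator of `e₀`, which contains `Ψ(e₀)`. -/
theorem largePart_le_serreAnnihilator {h e f : 𝔤} (p : IsPrincipalTriple β h e f) {e₀ : V}
    (he₀ : IsHighest β.symm e₀) {a : ι → ℤ} (hh : ∀ i, ⁅β.h i, e₀⁆ = a i • e₀) {k : ι}
    (hk : a k ≠ 0) : largePart V β ≤ (serreAnnihilator 𝔤 e₀).toSubmodule := by
  have hf : ∀ i, ⁅β.f i, e₀⁆ = 0 := he₀.e_eq_zero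
  let U : Submodule ℂ 𝔤 :=
    { carrier := {z | ∀ y : 𝔤, ⁅y, e₀⁆ = 0 → killingForm ℂ 𝔤 y z = 0}
      add_mem' := fun h h' y hy => by rw [map_add, h y hy, h' y hy, add_zero]
      zero_mem' := fun y _ => map_zero _
      smul_mem' := fun c z h y hy => by rw [map_smul, h y hy, smul_zero] }
  have hU0 : U ≠ ⊥ := by
    intro hb
    obtain ⟨m, hm⟩ : ∃ m : Module.Dual ℂ V, m e₀ ≠ 0 := by
      by_contra! h0
      exact he₀.ne_zero ((Module.forall_dual_apply_eq_zero_iff ℂ e₀).mp h0)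
    obtain ⟨z, hz⟩ := (killingForm_bijective 𝔤).2 (m ∘ₗ evalAt 𝔤 e₀)
    have hz' : ∀ y, killingForm ℂ 𝔤 z y = m ⁅y, e₀⁆ := fun y => by rw [hz]; rfl
    have h1 : z ∈ U := fun y hy => by rw [killingForm_comm, hz', hy, map_zero]
    rw [hb, Submodule.mem_bot] at h1
    have h2 := hz' (β.h k)
    rw [h1, map_zero, LinearMap.zero_apply, hh, zsmul_eq_intCast_smul, map_smul, smul_eq_mul] at h2
    exact mul_ne_zero (by exact_mod_cast hk) hm h2.symm
  obtain ⟨z, hzU, hz⟩ := exists_isHighest_mem β.symm p.symm U hU0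
    (by
      intro i z hz y hy
      change killingForm ℂ 𝔤 y ⁅β.f i, z⁆ = 0
      rw [← killingForm_lie]
      exact hz _ (by rw [lie_lie, hf, hy, lie_zero, lie_zero, sub_zero]))
    (by
      intro i z hz y hy
      change killingForm ℂ 𝔤 y ⁅-β.h i, z⁆ = 0
      rw [← killingForm_lie]
      refine hz _ ?_
      rw [lie_neg, neg_lie, lie_lie, hh, hy, lie_zero, zsmul_eq_intCast_smul, lie_smul, hy,
        smul_zero, sub_zero, neg_zero])
  refine (LieSubmodule.lieSpan_le (N := serreAnnihilator 𝔤 e₀)).mpr ?_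
  rintro _ ⟨v, y, hv, hy, rfl⟩
  refine tmul_highest_mem β p he₀ hz _ ?_ hv hy
  intro Ψ hΨ
  exact hzU _ (lie_apply_self_eq_zero hΨ)

omit [LieModule.IsIrreducible ℂ 𝔤 V] in
/-- No intertwiner copy of the dual respects the Serre relation: the element `z = Ψ(e₀)` would both
kill `e₀` and satisfy `κ(h_l, z) = -a_l`, so that the weight `a` would have norm zero. -/
theorem not_rS_le {h e f : 𝔤} (p : IsPrincipalTriple β h e f) {e₀ : V}
    (he₀ : IsHighest β.symm e₀) {a : ι → ℤ} (hh : ∀ i, ⁅β.h i, e₀⁆ = a i • e₀) {k : ι}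
    (hk : a k ≠ 0) : ¬ (rS 𝔤 V).map (embTensor 𝔤) ≤ tNegOne 𝔤 e₀ := by
  intro hle
  have hk0 : ⁅β.h k, e₀⁆ ≠ 0 := by
    rw [hh, zsmul_eq_intCast_smul]
    exact smul_ne_zero (by exact_mod_cast hk) he₀.ne_zero
  obtain ⟨m', hm'⟩ : ∃ m : Module.Dual ℂ V, m e₀ ≠ 0 := by
    by_contra! h0
    exact he₀.ne_zero ((Module.forall_dual_apply_eq_zero_iff ℂ e₀).mp h0)
  obtain ⟨m, hm⟩ : ∃ m : Module.Dual ℂ V, m e₀ = 1 :=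
    ⟨(m' e₀)⁻¹ • m', by rw [LinearMap.smul_apply, smul_eq_mul, inv_mul_cancel₀ hm']⟩
  let κ := LinearEquiv.ofBijective (killingForm ℂ 𝔤) (killingForm_bijective 𝔤)
  let Ψ : V →ₗ[ℂ] 𝔤 := κ.symm.toLinearMap ∘ₗ
    (-(LinearMap.compRight ℂ m ∘ₗ (toEnd ℂ 𝔤 V : 𝔤 →ₗ[ℂ] Module.End ℂ V).flip))
  have hΨ : ∀ y v, killingForm ℂ 𝔤 y (Ψ v) = -m ⁅y, v⁆ := by
    intro y v
    rw [killingForm_comm]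
    exact congrArg (fun φ : Module.Dual ℂ 𝔤 => φ y) (κ.apply_symm_apply _)
  obtain ⟨τ, hτ⟩ := (dualTensorHomEquiv ℂ V 𝔤).surjective Ψ
  have hτ' : dualTensorHom ℂ V 𝔤 τ = Ψ := hτ
  have h1 : embTensor 𝔤 τ ∈ tNegOne 𝔤 e₀ := by
    refine hle ⟨τ, ⟨m, fun y => ?_⟩, rfl⟩
    refine LinearMap.ext fun v => ?_
    rw [contract_eq, hτ', hΨ]
    simp
  obtain ⟨Ψ', hΨ', hcomp⟩ := tNegOne_le hk0 h1
  have h2 : Ψ' = Ψ := by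
    refine LinearMap.ext fun v => toEnd_injective hk0 ?_
    rw [embTensor_eq_comp, hτ'] at hcomp
    exact congrArg (fun T : V →ₗ[ℂ] Module.End ℂ V => T v) hcomp
  rw [h2] at hΨ'
  obtain ⟨x, hx, t, c, hc, hdec, -, ht, -⟩ :=
    exists_triangular_of_lie_eq_zero p he₀ (lie_apply_self_eq_zero hΨ')
  obtain ⟨G, hG, hκ⟩ := exists_isCartanPair β
  have hta : ∑ l, t l * a l = 0 := by
    have h3 : (∑ l, t l * a l) • e₀ = 0 := by
      rw [← ht, sum_lie, Finset.sum_smul]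
      refine Finset.sum_congr rfl fun l _ => ?_
      rw [smul_lie, hh, zsmul_eq_intCast_smul, smul_smul]
    exact (smul_eq_zero.mp h3).resolve_right he₀.ne_zero
  have hGt : ∀ l, ∑ j, (G l j : ℂ) * t j = -a l := by
    intro l
    have h3 := hΨ (β.h l) e₀
    rw [hh, zsmul_eq_intCast_smul, map_smul, hm, smul_eq_mul, mul_one, hdec, map_add, map_add,
      killingForm_comm _ x, killingForm_comm _ c,
      killingForm_eq_zero_of_above (h := -h) (b := 0) le_rfl (p.symm.upper_le hx)
        (by rw [neg_lie, p.lie_h_h]; simp),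
      killingForm_eq_zero_of_above (h := h) (b := 0) le_rfl (p.upper_le hc)
        (by rw [p.lie_h_h]; simp), zero_add, add_zero, map_sum] at h3
    rw [← h3]
    refine Finset.sum_congr rfl fun j _ => ?_
    rw [map_smul, hκ, smul_eq_mul, mul_comm]
  obtain ⟨s, -, hs'⟩ := hG.exists_gram_mulVec_eq fun k => (a k : ℚ)
  have hs0 : s ≠ 0 := by
    rintro rfl
    have := hs' k
    simp only [Pi.zero_apply, mul_zero, Finset.sum_const_zero] at this
    exact hk (by exact_mod_cast this.symm)
  have hpos := hG.pos s hs0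
  have h4 : ∑ l, (s l : ℂ) * a l = 0 := by
    have h5 : ∑ l, (s l : ℂ) * ∑ j, (G l j : ℂ) * t j = ∑ j, t j * a j := by
      simp only [Finset.mul_sum]
      rw [Finset.sum_comm]
      refine Finset.sum_congr rfl fun j _ => ?_
      have h6 : (a j : ℂ) = ∑ l, (G j l : ℂ) * s l := by
        exact_mod_cast (congrArg (Rat.cast : ℚ → ℂ) (hs' j)).symm
      rw [h6, Finset.mul_sum]
      refine Finset.sum_congr rfl fun l _ => ?_
      rw [hG.symm l j]
      ring
    rw [hta] at h5
    simp only [hGt, mul_neg, Finset.sum_neg_distrib, neg_eq_zero] at h5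
    exact h5
  have h5 : ∑ l, s l * (a l : ℚ) = 0 := by exact_mod_cast h4
  have h6 : ∑ k, ∑ l, s k * G k l * s l = ∑ l, s l * (a l : ℚ) := by
    refine Finset.sum_congr rfl fun l _ => ?_
    rw [← hs' l, Finset.mul_sum]
    exact Finset.sum_congr rfl fun j _ => by ring
  rw [h6, h5] at hpos
  exact lt_irrefl _ hpos

omit [FiniteDimensional ℂ V] in
/-- The highest weight vector `w ⊗ z` of the large component violates the Serre relation, as
neither `w(e₀)` nor `z e₀` vanishes. -/
theorem not_rL_le {h e f : 𝔤} (p : IsPrincipalTriple β h e f) {e₀ : V}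
    (he₀ : IsHighest β.symm e₀) {a : ι → ℤ} (hh : ∀ i, ⁅β.h i, e₀⁆ = a i • e₀) {k : ι}
    (hk : a k ≠ 0) : ¬ (rL V β).map (embTensor 𝔤) ≤ tNegOne 𝔤 e₀ := by
  intro hle
  have hf : ∀ i, ⁅β.f i, e₀⁆ = 0 := he₀.e_eq_zero
  have hk0 : ⁅β.h k, e₀⁆ ≠ 0 := by
    rw [hh, zsmul_eq_intCast_smul]
    exact smul_ne_zero (by exact_mod_cast hk) he₀.ne_zero
  obtain ⟨z, -, hz⟩ := exists_isHighest_mem β p (⊤ : Submodule ℂ 𝔤)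
    (by
      intro hb
      have h1 : β.h k ∈ (⊤ : Submodule ℂ 𝔤) := trivial
      rw [hb, Submodule.mem_bot] at h1
      exact hk0 (by rw [h1, zero_lie])) (fun _ _ _ => trivial) (fun _ _ _ => trivial)
  have hze : ⁅z, e₀⁆ ≠ 0 := by
    intro h0
    have htop : LinearMap.ker (evalAt 𝔤 e₀) = ⊤ := by
      refine eq_top_of_highest_le β (W := ℂ ∙ z) ?_ ?_ ?_ ?_ ?_
      · rw [Ne, Submodule.span_singleton_eq_bot]; exact hz.ne_zero
      · intro i m hm
        obtain ⟨c, rfl⟩ := Submodule.mem_span_singleton.mp hm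
        rw [lie_smul, hz.e_eq_zero, smul_zero]
      · intro i m hm
        obtain ⟨c, rfl⟩ := Submodule.mem_span_singleton.mp hm
        obtain ⟨d, hd⟩ := hz.h_smul i
        rw [lie_smul, hd]
        exact Submodule.smul_mem _ _ (Submodule.smul_mem _ _ (Submodule.mem_span_singleton_self z))
      · intro i m hm
        have hm' : ⁅m, e₀⁆ = 0 := hm
        change ⁅⁅β.f i, m⁆, e₀⁆ = 0
        rw [lie_lie, hf, hm', lie_zero, lie_zero, sub_zero]
      · rw [Submodule.span_singleton_le_iff_mem]; exact h0
    have h1 : β.h k ∈ LinearMap.ker (evalAt 𝔤 e₀) := by rw [htop]; trivial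
    exact hk0 h1
  obtain ⟨μ, hμ⟩ := he₀.exists_smul p.symm.h_mem
  rw [neg_lie, neg_eq_iff_eq_neg, ← neg_smul] at hμ
  have hnot : e₀ ∉ eigenAbove V h (-μ) := fun h0 =>
    he₀.ne_zero (eq_zero_of_mem_eigenAbove h0 hμ)
  obtain ⟨w, hw0, hw⟩ := Submodule.exists_le_ker_of_notMem hnot
  have hVtop := span_sup_eigenAbove_eq_top β p he₀ hμ
  have hwe : ∀ i, ⁅β.e i, w⁆ = 0 := by
    intro i
    refine LinearMap.ext fun v => ?_
    have h1 : ⁅β.e i, v⁆ ∈ eigenAbove V h (-μ) := by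
      have hv : v ∈ (ℂ ∙ e₀) ⊔ eigenAbove V h (-μ) := by rw [hVtop]; trivial
      obtain ⟨x, hx, y, hy, rfl⟩ := Submodule.mem_sup.mp hv
      obtain ⟨c, rfl⟩ := Submodule.mem_span_singleton.mp hx
      rw [lie_add, lie_smul]
      refine Submodule.add_mem _ (Submodule.smul_mem _ _
        (lie_mem_eigenAbove_of_mem (p.upper_le (LieSubalgebra.subset_lieSpan ⟨i, rfl⟩)) hμ)) ?_
      exact lie_mem_eigenAbove (a := 2) (by norm_num) (by rw [p.lie_e]; norm_num) hy
    have h2 : w ⁅β.e i, v⁆ = 0 := hw h1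
    simp [h2]
  have h1 : embTensor 𝔤 (w ⊗ₜ[ℂ] z) ∈ tNegOne 𝔤 e₀ :=
    hle ⟨w ⊗ₜ[ℂ] z, LieSubmodule.subset_lieSpan ⟨w, z, hwe, hz.e_eq_zero, rfl⟩, rfl⟩
  obtain ⟨Ψ, hΨ, hcomp⟩ := tNegOne_le hk0 h1
  have h2 : Ψ e₀ = w e₀ • z := by
    refine toEnd_injective hk0 ?_
    rw [embTensor_eq_comp] at hcomp
    have h3 := congrArg (fun T : V →ₗ[ℂ] Module.End ℂ V => T e₀) hcomp
    simpa using h3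
  have h3 := lie_apply_self_eq_zero hΨ
  rw [h2, smul_lie] at h3
  exact smul_ne_zero hw0 hze h3

theorem tNegOne_le_rM {h e f : 𝔤} (p : IsPrincipalTriple β h e f) {e₀ : V}
    (he₀ : IsHighest β.symm e₀) {a : ι → ℤ} (hh : ∀ i, ⁅β.h i, e₀⁆ = a i • e₀) {k : ι}
    (hk : a k ≠ 0)
    (htr : ∀ z : 𝔤, ⁅z, e₀⁆ = 0 → ∀ hW : ∀ w ∈ LinearMap.range (evalAt 𝔤 e₀),
      toEnd ℂ 𝔤 V z w ∈ LinearMap.range (evalAt 𝔤 e₀),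
      LinearMap.trace ℂ (LinearMap.range (evalAt 𝔤 e₀)) ((toEnd ℂ 𝔤 V z).restrict hW) = 0) :
    tNegOne 𝔤 e₀ ≤ (rM V β).map (embTensor 𝔤) := by
  intro Φ hΦ
  have hk0 : ⁅β.h k, e₀⁆ ≠ 0 := by
    rw [hh, zsmul_eq_intCast_smul]
    exact smul_ne_zero (by exact_mod_cast hk) he₀.ne_zero
  obtain ⟨Ψ, hΨ, rfl⟩ := tNegOne_le hk0 hΦ
  obtain ⟨τ, hτ⟩ := (dualTensorHomEquiv ℂ V 𝔤).surjective Ψ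
  have hτ' : dualTensorHom ℂ V 𝔤 τ = Ψ := hτ
  refine ⟨τ, fun σ hσ => ?_, by rw [embTensor_eq_comp, hτ']; rfl⟩
  obtain ⟨σ₁, hσ₁, σ₂, hσ₂, rfl⟩ := Submodule.mem_sup.mp hσ
  obtain ⟨m, hm⟩ := hσ₁
  rw [adjPairing_eq_homPairing, hτ', map_add, homPairing_eq_trace Ψ σ₁ hm,
    trace_comp_evalAt_eq_zero he₀.ne_zero htr m hΨ,
    largePart_le_serreAnnihilator p he₀ hh hk hσ₂ Ψ hΨ, add_zero]

end Orthogonal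

/-! ### The adjoint module -/

section Adjoint

open LieModule Module LieAlgebra

variable {𝔤 : Type*} [LieRing 𝔤] [LieAlgebra ℂ 𝔤]
variable {V : Type*} [AddCommGroup V] [Module ℂ V] [LieRingModule 𝔤 V] [LieModule ℂ 𝔤 V]

/-- The alternating part `κ(Ψ(x), ψ(y)) - κ(Ψ(y), ψ(x))` of `Ψ : V → 𝔤` when `ψ : V ≅ 𝔤`. -/
noncomputable def altPart (ψ : V ≃ₗ⁅ℂ, 𝔤⁆ 𝔤) (Ψ : V →ₗ[ℂ] 𝔤) : V →ₗ[ℂ] V →ₗ[ℂ] ℂ :=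
  (killingForm ℂ 𝔤).compl₁₂ Ψ (ψ : V →ₗ[ℂ] 𝔤) -
    ((killingForm ℂ 𝔤).compl₁₂ Ψ (ψ : V →ₗ[ℂ] 𝔤)).flip

omit [LieModule ℂ 𝔤 V] in
theorem altPart_apply (ψ : V ≃ₗ⁅ℂ, 𝔤⁆ 𝔤) (Ψ : V →ₗ[ℂ] 𝔤) (x y : V) :
    altPart ψ Ψ x y = killingForm ℂ 𝔤 (Ψ x) (ψ y) - killingForm ℂ 𝔤 (Ψ y) (ψ x) := rfl

theorem altPart_lie (ψ : V ≃ₗ⁅ℂ, 𝔤⁆ 𝔤) (Ψ : V →ₗ[ℂ] 𝔤) (z : 𝔤) (x y : V) :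
    altPart ψ ⁅z, Ψ⁆ x y = -altPart ψ Ψ ⁅z, x⁆ y - altPart ψ Ψ x ⁅z, y⁆ := by
  have h1 : ∀ u v : V, killingForm ℂ 𝔤 ⁅z, Ψ u⁆ (ψ v) = -killingForm ℂ 𝔤 (Ψ u) (ψ ⁅z, v⁆) := by
    intro u v
    have h2 : ψ ⁅z, v⁆ = ⁅z, ψ v⁆ := (ψ : V →ₗ⁅ℂ, 𝔤⁆ 𝔤).map_lie z v
    rw [h2, ← killingForm_lie, ← lie_skew z, map_neg, LinearMap.neg_apply]
  simp only [altPart_apply, LieHom.lie_apply, map_sub, LinearMap.sub_apply, h1]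
  ring

variable [FiniteDimensional ℂ 𝔤] [LieAlgebra.IsSimple ℂ 𝔤]

omit [FiniteDimensional ℂ 𝔤] [LieAlgebra.IsSimple ℂ 𝔤] in
/-- If `ad x` squares to zero, then `x` is in the radical of the Killing form, since then
`(ad x ∘ ad y)² = 0` for all `y`. -/
theorem killingForm_eq_zero_of_sq {x : 𝔤} (hx : ∀ y : 𝔤, ⁅x, ⁅x, y⁆⁆ = 0) (y : 𝔤) :
    killingForm ℂ 𝔤 x y = 0 := by
  have h1 : ∀ w : 𝔤, ⁅x, ⁅y, ⁅x, w⁆⁆⁆ = 0 := by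
    intro w
    have h2 : ⁅⁅x, ⁅x, y⁆⁆, w⁆ = 0 := by rw [hx, zero_lie]
    rw [lie_lie, lie_lie x y w, lie_sub, hx, lie_lie x y ⁅x, w⁆, hx w, lie_zero, sub_zero,
      zero_sub] at h2
    have h3 : (2 : ℂ) • ⁅x, ⁅y, ⁅x, w⁆⁆⁆ = 0 := by
      rw [two_smul, ← neg_eq_zero, ← h2]; abel
    exact (smul_eq_zero.mp h3).resolve_left two_ne_zero
  have h2 : IsNilpotent (toEnd ℂ 𝔤 𝔤 x ∘ₗ toEnd ℂ 𝔤 𝔤 y) := by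
    refine ⟨2, LinearMap.ext fun w => ?_⟩
    rw [pow_two]
    exact h1 ⁅y, w⁆
  exact (LinearMap.isNilpotent_trace_of_isNilpotent h2).eq_zero

variable [FiniteDimensional ℂ V] [LieModule.IsIrreducible ℂ 𝔤 V]
variable {ι : Type*} [Fintype ι] {H : LieSubalgebra ℂ 𝔤} {β : LieAlgebra.Basis ι H}

omit [FiniteDimensional ℂ V] [LieModule.IsIrreducible ℂ 𝔤 V] in
/-- The vectors `[y, [z, f]]` with `f` a lowest root vector span `𝔤`: their orthogonal complement is
stable under the lower Borel subalgebra, so if it were non-zero it would contain `f`, and `ad f`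
would square to zero. -/
theorem eq_zero_of_killingForm_lie_lie {h e f : 𝔤} (p : IsPrincipalTriple β h e f) {x : 𝔤}
    (hx : IsHighest β.symm x) {q : 𝔤} (hq : ∀ y z : 𝔤, killingForm ℂ 𝔤 q ⁅y, ⁅z, x⁆⁆ = 0) :
    q = 0 := by
  let U : Submodule ℂ 𝔤 :=
    { carrier := {q | ∀ y z : 𝔤, killingForm ℂ 𝔤 q ⁅y, ⁅z, x⁆⁆ = 0}
      add_mem' := fun h h' y z => by rw [map_add, LinearMap.add_apply, h, h', add_zero]
      zero_mem' := fun y z => by simp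
      smul_mem' := fun c q h y z => by rw [map_smul, LinearMap.smul_apply, h, smul_zero] }
  have hlie : ∀ u : 𝔤, (∃ c : ℂ, ⁅u, x⁆ = c • x) → ∀ q ∈ U, ⁅u, q⁆ ∈ U := by
    rintro u ⟨c, hc⟩ q hq y z
    have hq' : ∀ y z : 𝔤, killingForm ℂ 𝔤 q ⁅y, ⁅z, x⁆⁆ = 0 := hq
    rw [← lie_skew, map_neg, LinearMap.neg_apply, killingForm_lie, leibniz_lie u y,
      leibniz_lie u z, hc, lie_add, map_add, map_add, hq', hq', lie_smul, lie_smul, map_smul, hq',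
      smul_zero, add_zero, add_zero, neg_zero]
  by_contra hq0
  have hU : U ≠ ⊥ := by
    intro hb
    have h1 : q ∈ U := hq
    rw [hb] at h1
    exact hq0 ((Submodule.mem_bot ℂ).mp h1)
  obtain ⟨v, hvU, hv⟩ := exists_isHighest_mem β.symm p.symm U hU
    (fun i => hlie _ ⟨0, by rw [zero_smul]; exact hx.e_eq_zero i⟩) (fun i => hlie _ (hx.h_smul i))
  obtain ⟨c, rfl⟩ := Submodule.mem_span_singleton.mp
    (mem_span_of_f_eq_zero β p hx (v := v) hv.e_eq_zero)
  have hc : c ≠ 0 := by rintro rfl; exact hv.ne_zero (zero_smul _ _)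
  have hxU : ∀ y z : 𝔤, killingForm ℂ 𝔤 x ⁅y, ⁅z, x⁆⁆ = 0 := by
    have h1 := U.smul_mem c⁻¹ hvU
    rw [smul_smul, inv_mul_cancel₀ hc, one_smul] at h1
    exact h1
  have hinj := (killingForm_bijective 𝔤).1
  have hsq : ∀ y : 𝔤, ⁅x, ⁅x, y⁆⁆ = 0 := by
    intro y
    refine hinj (LinearMap.ext fun z => ?_)
    rw [map_zero, LinearMap.zero_apply, ← lie_skew, map_neg, LinearMap.neg_apply, killingForm_lie,
      killingForm_lie, ← lie_skew x z, lie_neg, map_neg, hxU, neg_zero, neg_zero]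
  exact hx.ne_zero (hinj (by
    rw [map_zero]
    exact LinearMap.ext (killingForm_eq_zero_of_sq hsq)))

omit [FiniteDimensional ℂ V] in
/-- Maps that respect the Serre relation are symmetric: the relation gives `ω(e₀, z e₀) = 0` for the
alternating part `ω`, applied to `z Ψ` and polarised it gives `ω(e₀, y z e₀) = 0`, and the vectors
`y z e₀` span. -/
theorem altPart_eq_zero {h e f : 𝔤} (p : IsPrincipalTriple β h e f) {e₀ : V}
    (he₀ : IsHighest β.symm e₀) {a : ι → ℤ} (hh : ∀ i, ⁅β.h i, e₀⁆ = a i • e₀) {k : ι}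
    (hk : a k ≠ 0) (ψ : V ≃ₗ⁅ℂ, 𝔤⁆ 𝔤) {Ψ : V →ₗ[ℂ] 𝔤} (hΨ : Ψ ∈ serreHom 𝔤 e₀) :
    altPart ψ Ψ = 0 := by
  have hψ : ∀ (z : 𝔤) (v : V), ψ ⁅z, v⁆ = ⁅z, ψ v⁆ := fun z v => (ψ : V →ₗ⁅ℂ, 𝔤⁆ 𝔤).map_lie z v
  have hx : IsHighest β.symm (ψ e₀) :=
    ⟨fun h0 => he₀.ne_zero (ψ.injective (by rw [h0]; exact (map_zero (ψ : V →ₗ[ℂ] 𝔤)).symm)),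
      fun i => by rw [← hψ, he₀.e_eq_zero]; exact map_zero (ψ : V →ₗ[ℂ] 𝔤),
      fun i => by
        obtain ⟨c, hc⟩ := he₀.h_smul i
        exact ⟨c, by rw [← hψ, hc]; exact map_smul (ψ : V →ₗ[ℂ] 𝔤) c e₀⟩⟩
  have hak : (a k : ℂ) ≠ 0 := by exact_mod_cast hk
  obtain ⟨w, hw⟩ : ∃ w : 𝔤, ⁅ψ e₀, w⁆ = ψ e₀ := by
    refine ⟨-((a k : ℂ)⁻¹ • β.h k), ?_⟩
    have h1 : ⁅β.h k, ψ e₀⁆ = (a k : ℂ) • ψ e₀ := by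
      rw [← hψ, hh, zsmul_eq_intCast_smul]
      exact map_smul (ψ : V →ₗ[ℂ] 𝔤) _ e₀
    rw [← lie_skew, neg_lie, neg_neg, smul_lie, h1, smul_smul, inv_mul_cancel₀ hak, one_smul]
  have h1 : ∀ Ψ ∈ serreHom 𝔤 e₀, ∀ z : 𝔤, altPart ψ Ψ e₀ ⁅z, e₀⁆ = 0 := by
    intro Ψ hΨ z
    have hz : ∀ z : 𝔤, killingForm ℂ 𝔤 (Ψ e₀) ⁅ψ e₀, z⁆ = 0 := fun z => by
      rw [← killingForm_lie, ← hψ, lie_apply_self_eq_zero hΨ]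
      change killingForm ℂ 𝔤 ((ψ : V →ₗ[ℂ] 𝔤) 0) z = 0
      rw [map_zero, map_zero, LinearMap.zero_apply]
    have hz' : ∀ z : 𝔤, killingForm ℂ 𝔤 (Ψ e₀) ⁅z, ψ e₀⁆ = 0 := fun z => by
      rw [← lie_skew, map_neg, hz, neg_zero]
    have h2 : killingForm ℂ 𝔤 (Ψ ⁅z, e₀⁆) (ψ e₀) = 0 := by
      have h3 : ⁅Ψ ⁅z, e₀⁆, ψ e₀⁆ = -⁅Ψ e₀, ⁅z, ψ e₀⁆⁆ := by
        rw [← hψ, lie_apply_lie_self hΨ, ← hψ, ← hψ]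
        exact map_neg (ψ : V →ₗ[ℂ] 𝔤) _
      rw [← hw, ← killingForm_lie, h3, map_neg, LinearMap.neg_apply, killingForm_lie, lie_lie, hw,
        map_sub, hz, hz', sub_zero, neg_zero]
    rw [altPart_apply, hψ, hz', h2, sub_zero]
  have h2 : ∀ Ψ ∈ serreHom 𝔤 e₀, ∀ z : 𝔤, altPart ψ Ψ e₀ ⁅z, ⁅z, e₀⁆⁆ = 0 := by
    intro Ψ hΨ z
    have h3 := h1 _ ((serreHom 𝔤 e₀).lie_mem (x := z) hΨ) z
    rw [altPart_lie] at h3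
    have h4 : altPart ψ Ψ ⁅z, e₀⁆ ⁅z, e₀⁆ = 0 := by rw [altPart_apply, sub_self]
    rw [h4, neg_zero, zero_sub, neg_eq_zero] at h3
    exact h3
  have h3 : ∀ Ψ ∈ serreHom 𝔤 e₀, ∀ y z : 𝔤, altPart ψ Ψ e₀ ⁅y, ⁅z, e₀⁆⁆ = 0 := by
    intro Ψ hΨ y z
    have h4 := h2 Ψ hΨ (y + z)
    rw [add_lie, add_lie, lie_add, lie_add, map_add, map_add, map_add, h2 Ψ hΨ, h2 Ψ hΨ,
      leibniz_lie z y, map_add, h1 Ψ hΨ] at h4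
    have h5 : (2 : ℂ) * altPart ψ Ψ e₀ ⁅y, ⁅z, e₀⁆⁆ = 0 := by linear_combination h4
    exact (mul_eq_zero.mp h5).resolve_left two_ne_zero
  have h4 : ∀ Ψ ∈ serreHom 𝔤 e₀, altPart ψ Ψ e₀ = 0 := by
    intro Ψ hΨ
    obtain ⟨q, hq⟩ := (killingForm_bijective 𝔤).2
      (altPart ψ Ψ e₀ ∘ₗ (ψ.symm : 𝔤 →ₗ[ℂ] V))
    have hq' : ∀ v : V, killingForm ℂ 𝔤 q (ψ v) = altPart ψ Ψ e₀ v := by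
      intro v
      rw [hq]
      change altPart ψ Ψ e₀ (ψ.symm (ψ v)) = _
      rw [LieModuleEquiv.symm_apply_apply]
    have hq0 : q = 0 := eq_zero_of_killingForm_lie_lie p hx fun y z => by
      rw [← hψ, ← hψ, hq', h3 Ψ hΨ]
    refine LinearMap.ext fun v => ?_
    rw [← hq', hq0, map_zero, LinearMap.zero_apply, LinearMap.zero_apply]
  let R : LieSubmodule ℂ 𝔤 V :=
    { carrier := {x | ∀ Ψ ∈ serreHom 𝔤 e₀, altPart ψ Ψ x = 0}
      add_mem' := fun h h' Ψ hΨ => by rw [map_add, h Ψ hΨ, h' Ψ hΨ, add_zero]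
      zero_mem' := fun Ψ _ => map_zero _
      smul_mem' := fun c m h Ψ hΨ => by rw [map_smul, h Ψ hΨ, smul_zero]
      lie_mem := by
        intro z m hm Ψ hΨ
        refine LinearMap.ext fun y => ?_
        have h5 := altPart_lie ψ Ψ z m y
        rw [hm _ ((serreHom 𝔤 e₀).lie_mem hΨ), hm Ψ hΨ, LinearMap.zero_apply,
          LinearMap.zero_apply, sub_zero] at h5
        rw [LinearMap.zero_apply, ← neg_eq_zero, ← h5] }
  have hR : R = ⊤ := (IsSimpleOrder.eq_bot_or_eq_top R).resolve_left (by
    intro hb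
    have h5 : e₀ ∈ R := h4
    rw [hb] at h5
    exact he₀.ne_zero ((LieSubmodule.mem_bot e₀).mp h5))
  refine LinearMap.ext fun v => ?_
  have hv : v ∈ R := by rw [hR]; trivial
  exact hv Ψ hΨ

theorem tNegOne_le_symPart {h e f : 𝔤} (p : IsPrincipalTriple β h e f) {e₀ : V}
    (he₀ : IsHighest β.symm e₀) {a : ι → ℤ} (hh : ∀ i, ⁅β.h i, e₀⁆ = a i • e₀) {k : ι}
    (hk : a k ≠ 0) (ψ : V ≃ₗ⁅ℂ, 𝔤⁆ 𝔤) :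
    tNegOne 𝔤 e₀ ≤ (symPart ψ).map (embTensor 𝔤) := by
  intro Φ hΦ
  have hk0 : ⁅β.h k, e₀⁆ ≠ 0 := by
    rw [hh, zsmul_eq_intCast_smul]
    exact smul_ne_zero (by exact_mod_cast hk) he₀.ne_zero
  obtain ⟨Ψ, hΨ, rfl⟩ := tNegOne_le hk0 hΦ
  let F : 𝔤 ≃ₗ[ℂ] Module.Dual ℂ V :=
    (LinearEquiv.ofBijective (killingForm ℂ 𝔤) (killingForm_bijective 𝔤)).trans
      ψ.toLinearEquiv.dualMap
  let G : 𝔤 ⊗[ℂ] 𝔤 ≃ₗ[ℂ] (V →ₗ[ℂ] 𝔤) :=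
    (LinearEquiv.rTensor 𝔤 F).trans (dualTensorHomEquiv ℂ V 𝔤)
  have hG : ∀ a b v, G (a ⊗ₜ[ℂ] b) v = killingForm ℂ 𝔤 a (ψ v) • b := fun a b v => rfl
  have hswap : ∀ (t : 𝔤 ⊗[ℂ] 𝔤) (v w : V),
      killingForm ℂ 𝔤 (G (TensorProduct.comm ℂ 𝔤 𝔤 t) v) (ψ w) =
        killingForm ℂ 𝔤 (G t w) (ψ v) := by
    intro t v w
    induction t with
    | zero => simp
    | add s t hs ht =>
      simp only [map_add, LinearMap.add_apply] at hs ht ⊢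
      rw [hs, ht]
    | tmul a b =>
      rw [TensorProduct.comm_tmul, hG, hG]
      simp [mul_comm]
  obtain ⟨t, ht⟩ := G.surjective Ψ
  refine ⟨LinearMap.rTensor 𝔤 F.toLinearMap t, ⟨t, ?_, rfl⟩, ?_⟩
  · have h1 : G (TensorProduct.comm ℂ 𝔤 𝔤 t) = G t := by
      refine LinearMap.ext fun v => (killingForm_bijective 𝔤).1 (LinearMap.ext fun y => ?_)
      obtain ⟨w, rfl⟩ := ψ.surjective y
      have h2 : altPart ψ Ψ w v = 0 := by rw [altPart_eq_zero p he₀ hh hk ψ hΨ]; rfl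
      rw [hswap, ht]
      exact sub_eq_zero.mp h2
    exact G.injective h1
  · rw [embTensor_eq_comp]
    have h1 : dualTensorHom ℂ V 𝔤 (LinearMap.rTensor 𝔤 F.toLinearMap t) = Ψ := ht
    rw [h1]
    rfl

end Adjoint
end TensorHierarchy

theorem mainTheorem5
    {𝔤 : Type*} [LieRing 𝔤] [LieAlgebra ℂ 𝔤] [FiniteDimensional ℂ 𝔤] [LieAlgebra.IsSimple ℂ 𝔤]
    {ι : Type*} [Fintype ι] [DecidableEq ι] {H : LieSubalgebra ℂ 𝔤} (β : LieAlgebra.Basis ι H)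
    (a : ι → ℤ) (ha : ∀ i, a i ≤ 0) (D : ℕ) (hD : 3 ≤ D)
    (hdet : ((TensorHierarchy.extendedCartanMatrix β a).det : ℚ) =
      -(((D : ℚ) - 1) / ((D : ℚ) - 2)) * (β.A.det : ℚ))
    {V : Type*} [AddCommGroup V] [Module ℂ V] [FiniteDimensional ℂ V]
    [LieRingModule 𝔤 V] [LieModule ℂ 𝔤 V] [LieModule.IsIrreducible ℂ 𝔤 V]
    (e₀ : V) (he₀ : e₀ ≠ 0) (hf : ∀ i, ⁅β.f i, e₀⁆ = 0) (hh : ∀ i, ⁅β.h i, e₀⁆ = a i • e₀) :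
    ¬ (TensorHierarchy.rS 𝔤 V).map (TensorHierarchy.embTensor 𝔤) ≤ TensorHierarchy.tNegOne 𝔤 e₀ ∧
    ¬ (TensorHierarchy.rL V β).map (TensorHierarchy.embTensor 𝔤) ≤ TensorHierarchy.tNegOne 𝔤 e₀ ∧
    TensorHierarchy.tNegOne 𝔤 e₀ ≤ (TensorHierarchy.rM V β).map (TensorHierarchy.embTensor 𝔤) ∧
    (D = 3 → ∀ ψ : V ≃ₗ⁅ℂ, 𝔤⁆ 𝔤,
      TensorHierarchy.tNegOne 𝔤 e₀ ≤
        (TensorHierarchy.symPart ψ).map (TensorHierarchy.embTensor 𝔤)) := by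
  have := LieModule.nontrivial_of_isIrreducible ℂ 𝔤 𝔤
  obtain ⟨h, e, f, p⟩ := TensorHierarchy.exists_isPrincipalTriple β
  obtain ⟨ha0, y, hy, hsum⟩ := TensorHierarchy.exists_of_det_extendedCartanMatrix β hD hdet
  obtain ⟨k, hk⟩ := Function.ne_iff.mp ha0
  have hlow : TensorHierarchy.IsHighest β.symm e₀ := ⟨he₀, hf, fun i => ⟨-(a i : ℂ), by
    change ⁅-β.h i, e₀⁆ = _
    rw [neg_lie, hh, TensorHierarchy.zsmul_eq_intCast_smul, neg_smul]⟩⟩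
  exact ⟨TensorHierarchy.not_rS_le p hlow hh hk, TensorHierarchy.not_rL_le p hlow hh hk,
    TensorHierarchy.tNegOne_le_rM p hlow hh hk fun z hz hW =>
      TensorHierarchy.trace_orbitSpace_eq_zero p hlow ha hh ha0 hy hsum hz hW,
    fun _ ψ => TensorHierarchy.tNegOne_le_symPart p hlow hh hk ψ⟩
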